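/- **Setting.** Let $N\in\mathbb N$ be the number of charges, $m_i\in\mathbb R\setminus\{0\}$ the masses, $e_{ij}\in\mathbb R$ an arbitrary coupling matrix ($1\le i,j\le N$; $e_{ij}=1$ for all $i,j$ gives ML$_\varrho$, $e_{ij}=1-\delta_{ij}$ gives ML-SI$_\varrho$), and $\varrho_i\in C_c^\infty(\mathbb R^3,\mathbb R)$ the charge distributions. Let $\mathcal W$ be the set of $w\in C^\infty(\mathbb R^3,(0,\infty))$ for which there are $C_w\ge 0$ and $P_w\in\mathbb N$ with $w(x+y)\le(1+C_w\|y\|)^{P_w}w(x)$ for all $x,y\in\mathbb R^3$, and let $\mathcal W^1$ be the set of $w\in\mathcal W$ for which there is $C$ with $|D^\alpha\sqrt w|\le C\sqrt w$ for all $|\alpha|\le 1$. Let $L^2_w$ be the Hilbert space of (classes of) measurable $F:\mathbb R^3\to\mathbb R^3$ with $\|F\|_{L^2_w}^2=\int w(x)\|F(x)\|^2\,d^3x<\infty$ (the same norm is used for scalar functions), and $H^{curl}_w=\{F\in L^2_w\mid\nabla\wedge F\in L^2_w\}$. All spatial derivatives are taken in the sense of distributions. The phase space is the Hilbert space direct sum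 $$\mathcal H_w=\bigoplus_{i=1}^N\left(\mathbb R^3\oplus\mathbb R^3\oplus L^2_w\oplus L^2_w\right)\ni\varphi=(q_i,p_i,E_i,B_i)_{1\le i\le N}.$$ On $D_w(A)=\bigoplus_{i=1}^N(\mathbb R^3\oplus\mathbb R^3\oplus H^{curl}_w\oplus H^{curl}_w)$ put $A\varphi=(0,0,\nabla\wedge B_i,-\nabla\wedge E_i)_{1\le i\le N}$; let $D_w(A^0)=\mathcal H_w$ and $D_w(A^n)=\{\varphi\in D_w(A)\mid A^k\varphi\in D_w(A),\ 0\le k\le n-1\}$ for $n\ge 1$. With $v_i(p)=\operatorname{sign}(m_i)\,p/\sqrt{m_i^2+p^2}$ let $$J(\varphi)=\Big(v_i(p_i),\ \sum_{j=1}^N e_{ij}\int d^3x\,\varrho_i(x-q_i)\big(E_j(x)+v_i(p_i)\wedge B_j(x)\big),\ -4\pi v_i(p_i)\varrho_i(\cdot-q_i),\ 0\Big)_{1\le i\le N}.$$ For an open interval $\Lambda\subseteq\mathbb R$, a *solution on $\Lambda$* is a map $\varphi:\Lambda\to D_w(A)$, once continuously differentiable with respect to the norm of $\mathcal H_w$,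 with $\dot\varphi_t=A\varphi_t+J(\varphi_t)$ for all $t\in\Lambda$. A *bounding function* is a continuous function of finitely many arguments in $[0,\infty)$, with values in $[0,\infty)$, that is non-decreasing in each argument. **Theorem.** Let $w\in\mathcal W^1$. 1. *(Global existence)* For all $\varrho_1,\dots,\varrho_N$, $n\ge 1$ and $\varphi^0\in D_w(A^n)$ there is an $n$-times continuously differentiable map $\varphi:\mathbb R\to\mathcal H_w$ which is a solution on $\mathbb R$ with $\varphi_0=\varphi^0$, and $\frac{d^j}{dt^j}\varphi_t\in D_w(A^{n-j})$ for all $t\in\mathbb R$ and $0\le j\le n$. 2. *(Uniqueness and growth)* If $\widetilde\varphi$ is a solution on an open interval $\Lambda$ and $\widetilde\varphi_{t^*}=\varphi_{t^*}$ for some $t^*\in\Lambda$, then $\widetilde\varphi_t=\varphi_t$ for all $t\in\Lambda$. - Given $\varrho_1,\dots,\varrho_N$, there is a bounding function $C_1$ such that for every solution $\varphi$ on $\mathbb R$, every solution $\widetilde\varphi$ on an open interval $\Lambda$, every $T>0$ with $(-T,T)\subseteq\Lambda$ and all $t_0,t\in[-T,T]\cap\Lambda$, $$\|\varphi_t-\widetilde\varphi_t\|_{\mathcal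 H_w}\le C_1\big(T,\|\varphi_{t_0}\|_{\mathcal H_w},\|\widetilde\varphi_{t_0}\|_{\mathcal H_w}\big)\,\|\varphi_{t_0}-\widetilde\varphi_{t_0}\|_{\mathcal H_w}.$$ - There is a bounding function $C_2$, independent of the $\varrho_i$ and of the initial value, such that for all $\varrho_1,\dots,\varrho_N$, every solution $\varphi$ on $\mathbb R$ with initial value $\varphi_0=\varphi^0$ and every $T>0$, $$\sup_{t\in[-T,T]}\|\varphi_t\|_{\mathcal H_w}\le C_2\big(T,\|\varphi^0\|_{\mathcal H_w},\|w^{-1/2}\varrho_i\|_{L^2},\|\varrho_i\|_{L^2_w};1\le i\le N\big)\,\|\varphi^0\|_{\mathcal H_w}.$$ 3. *(Constraints)* If the solution $\varphi$ of part 1 satisfies the Maxwell constraints $\nabla\cdot E_{i,t}=4\pi\varrho_i(\cdot-q_{i,t})$ and $\nabla\cdot B_{i,t}=0$ for all $1\le i\le N$ at one time $t\in\mathbb R$, then it satisfies them at all times $t\in\mathbb R$. -/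

import Mathlib

open MeasureTheory
open scoped NNReal ContDiff

namespace MaxwellLorentz

/-- Euclidean space `ℝ³`. -/
abbrev E3 : Type := EuclideanSpace ℝ (Fin 3)

/-- The cross product `a ∧ b` on `ℝ³`. -/
def cross (a b : E3) : E3 :=
  !₂[a 1 * b 2 - a 2 * b 1, a 2 * b 0 - a 0 * b 2, a 0 * b 1 - a 1 * b 0]

/-- The classical partial derivative `∂ⱼ uₖ` at `x` of a vector field on `ℝ³`. -/
noncomputable def partialDeriv (u : E3 → E3) (j k : Fin 3) (x : E3) : ℝ :=
  fderiv ℝ u x (EuclideanSpace.single j 1) k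

/-- The classical curl `∇ ∧ u` of a differentiable vector field. -/
noncomputable def curl (u : E3 → E3) (x : E3) : E3 :=
  !₂[partialDeriv u 1 2 x - partialDeriv u 2 1 x,
     partialDeriv u 2 0 x - partialDeriv u 0 2 x,
     partialDeriv u 0 1 x - partialDeriv u 1 0 x]

/-! ### Weights and charge densities -/

/-- The class `𝒲` of weight functions. -/
structure Weight where
  toFun : E3 → ℝ
  contDiff : ContDiff ℝ ∞ toFun
  pos : ∀ x, 0 < toFun x
  growth : ∃ C : ℝ, 0 ≤ C ∧ ∃ P : ℕ, ∀ x y, toFun (x + y) ≤ (1 + C * ‖y‖) ^ P * toFun x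

instance : CoeFun Weight (fun _ => E3 → ℝ) := ⟨Weight.toFun⟩

/-- The class `𝒲ᵏ`: all derivatives of `√w` up to order `k` are bounded by a multiple of `√w`.
(The norm of the `j`-th Fréchet derivative is comparable to the maximum of the moduli of the
partial derivatives `D^α` with `|α| = j`.) -/
def Weight.MemClass (w : Weight) (k : ℕ) : Prop :=
  ∀ j ≤ k, ∃ C : ℝ, 0 ≤ C ∧ ∀ x,
    ‖iteratedFDeriv ℝ j (fun y => √(w y)) x‖ ≤ C * √(w x)

/-- A rigid charge distribution `ϱ ∈ C_c^∞(ℝ³, ℝ)`. -/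
structure ChargeDensity where
  toFun : E3 → ℝ
  contDiff : ContDiff ℝ ∞ toFun
  hasCompactSupport : HasCompactSupport toFun

instance : CoeFun ChargeDensity (fun _ => E3 → ℝ) := ⟨ChargeDensity.toFun⟩

/-! ### Weighted `L²` spaces -/

/-- The measure `w(x) d³x`. -/
noncomputable def Weight.measure (w : Weight) : Measure E3 :=
  (volume : Measure E3).withDensity (fun x => ENNReal.ofReal (w x))

instance (w : Weight) : IsLocallyFiniteMeasure w.measure :=
  IsLocallyFiniteMeasure.withDensity_ofReal w.contDiff.continuous

/-- `L²_w(ℝ³, ℝ³)`, with norm `‖F‖² = ∫ w(x) ‖F(x)‖² d³x`. -/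
abbrev L2w (w : Weight) : Type := Lp E3 2 w.measure

/-- `g` is the curl of `f` in the sense of distributions:
`∫ f · (∇ ∧ ψ) = ∫ g · ψ` for all test vector fields `ψ`. -/
def IsWeakCurl (f g : E3 → E3) : Prop :=
  ∀ ψ : E3 → E3, ContDiff ℝ ∞ ψ → HasCompactSupport ψ →
    ∫ x, inner ℝ (f x) (curl ψ x) = ∫ x, inner ℝ (g x) (ψ x)

/-- `H^curl_w`: the elements of `L²_w` whose distributional curl belongs to `L²_w`. -/
def Hcurl (w : Weight) : Set (L2w w) :=
  {f | ∃ g : L2w w, IsWeakCurl f g}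

open Classical in
/-- The distributional curl on `H^curl_w` (with value `0` outside `H^curl_w`). -/
noncomputable def weakCurl {w : Weight} (f : L2w w) : L2w w :=
  if h : f ∈ Hcurl w then h.choose else 0

theorem isWeakCurl_weakCurl {w : Weight} {f : L2w w} (h : f ∈ Hcurl w) :
    IsWeakCurl f (weakCurl f) := by
  rw [weakCurl, dif_pos h]
  exact h.choose_spec

theorem volume_absolutelyContinuous (w : Weight) : (volume : Measure E3) ≪ w.measure :=
  withDensity_absolutelyContinuous' (w.contDiff.continuous.measurable.ennreal_ofReal.aemeasurable)
    (Filter.Eventually.of_forall fun x => by simpa using w.pos x)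

theorem locallyIntegrable_L2w {w : Weight} (f : L2w w) :
    LocallyIntegrable (f : E3 → E3) volume := by
  have h1 : LocallyIntegrable (f : E3 → E3) w.measure :=
    (Lp.memLp f).locallyIntegrable (by norm_num)
  have hw : Continuous (w : E3 → ℝ) := w.contDiff.continuous
  rw [locallyIntegrable_iff] at h1 ⊢
  intro K hK
  have h2 := h1 K hK
  have hm : Measurable fun x => (w x).toNNReal := hw.measurable.real_toNNReal
  have h3 : w.measure.restrict K =
      (volume.restrict K).withDensity (fun x => ((w x).toNNReal : ENNReal)) :=
    restrict_withDensity hK.measurableSet _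
  rw [IntegrableOn, h3, integrable_withDensity_iff_integrable_smul hm] at h2
  have h4 : IntegrableOn (fun x => (w x)⁻¹ • ((w x).toNNReal • (f : E3 → E3) x)) K volume :=
    IntegrableOn.continuousOn_smul h2 (hw.inv₀ fun x => (w.pos x).ne').continuousOn hK
  refine h4.congr (Filter.Eventually.of_forall fun x => ?_)
  simp only [NNReal.smul_def, Real.coe_toNNReal _ (w.pos x).le, smul_smul,
    inv_mul_cancel₀ (w.pos x).ne', one_smul]

/-- The distributional curl is unique, so `weakCurl f` is *the* curl of `f ∈ H^curl_w`. -/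
theorem IsWeakCurl.unique {w : Weight} {f g g' : L2w w} (h : IsWeakCurl f g)
    (h' : IsWeakCurl f g') : g = g' := by
  have key : ∀ k : Fin 3, ∀ᵐ x ∂(volume : Measure E3), (g x - g' x) k = 0 := by
    intro k
    have hint : LocallyIntegrable (fun x => (g x - g' x) k) (volume : Measure E3) := by
      have h0 := (locallyIntegrable_L2w g).sub (locallyIntegrable_L2w g')
      intro x
      obtain ⟨s, hs, hi⟩ := h0 x
      exact ⟨s, hs, (EuclideanSpace.proj (𝕜 := ℝ) k).integrable_comp hi⟩
    refine ae_eq_zero_of_integral_contDiff_smul_eq_zero hint fun η hη hηc => ?_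
    have hψ : ContDiff ℝ ∞ fun x => η x • (EuclideanSpace.single k (1 : ℝ) : E3) :=
      hη.smul contDiff_const
    have hψc : HasCompactSupport fun x => η x • (EuclideanSpace.single k (1 : ℝ) : E3) :=
      hηc.smul_right
    have e := (h _ hψ hψc).symm.trans (h' _ hψ hψc)
    have hcoord : ∀ u : L2w w, Integrable (fun x => η x * u x k) (volume : Measure E3) := by
      intro u
      have hu : LocallyIntegrable (fun x => u x k) (volume : Measure E3) := by
        intro x
        obtain ⟨s, hs, hi⟩ := locallyIntegrable_L2w u x
        exact ⟨s, hs, (EuclideanSpace.proj (𝕜 := ℝ) k).integrable_comp hi⟩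
      exact hu.integrable_smul_left_of_hasCompactSupport hη.continuous hηc
    have hin : ∀ u : E3 → E3, (fun x => inner ℝ (u x)
        (η x • (EuclideanSpace.single k (1 : ℝ) : E3))) = fun x => η x * u x k := by
      intro u
      funext x
      rw [inner_smul_right, EuclideanSpace.inner_single_right]
      simp
    rw [hin, hin] at e
    have : (fun x => η x • (g x - g' x) k) = fun x => η x * g x k - η x * g' x k := by
      funext x
      simp [mul_sub]
    rw [this, integral_sub (hcoord g) (hcoord g'), e, sub_self]
  have hae : (g : E3 → E3) =ᵐ[volume] g' := by
    have := Filter.eventually_all.2 key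
    filter_upwards [this] with x hx
    exact sub_eq_zero.1 (by ext k; exact hx k)
  exact Lp.ext (((withDensity_absolutelyContinuous _ _).ae_le) hae)

/-! ### Phase space -/

/-- `ℋ_w = ⊕ᵢ (ℝ³ ⊕ ℝ³ ⊕ L²_w ⊕ L²_w)` with the Hilbert direct sum norm. -/
abbrev PhaseSpace (w : Weight) (N : ℕ) : Type :=
  PiLp 2 fun _ : Fin N => WithLp 2 (WithLp 2 (E3 × E3) × WithLp 2 (L2w w × L2w w))

section Components

variable {w : Weight} {N : ℕ}

/-- Position `qᵢ`. -/
def PhaseSpace.q (φ : PhaseSpace w N) (i : Fin N) : E3 := (φ i).fst.fst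

/-- Momentum `pᵢ`. -/
def PhaseSpace.p (φ : PhaseSpace w N) (i : Fin N) : E3 := (φ i).fst.snd

/-- Electric field `Eᵢ`. -/
def PhaseSpace.E (φ : PhaseSpace w N) (i : Fin N) : L2w w := (φ i).snd.fst

/-- Magnetic field `Bᵢ`. -/
def PhaseSpace.B (φ : PhaseSpace w N) (i : Fin N) : L2w w := (φ i).snd.snd

/-- The phase space point `(qᵢ, pᵢ, Eᵢ, Bᵢ)ᵢ`. -/
def PhaseSpace.mk (q p : Fin N → E3) (E B : Fin N → L2w w) : PhaseSpace w N :=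
  WithLp.toLp 2 fun i =>
    WithLp.toLp 2 (WithLp.toLp 2 (q i, p i), WithLp.toLp 2 (E i, B i))

end Components

/-! ### The operators `A` and `J` -/

/-- `D_w(A)`: all fields lie in `H^curl_w`. -/
def domA (w : Weight) (N : ℕ) : Set (PhaseSpace w N) :=
  {φ | ∀ i, PhaseSpace.E φ i ∈ Hcurl w ∧ PhaseSpace.B φ i ∈ Hcurl w}

/-- `A (qᵢ, pᵢ, Eᵢ, Bᵢ)ᵢ = (0, 0, ∇ ∧ Bᵢ, -∇ ∧ Eᵢ)ᵢ` for `φ ∈ D_w(A)`. -/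
noncomputable def opA {w : Weight} {N : ℕ} (φ : PhaseSpace w N) : PhaseSpace w N :=
  PhaseSpace.mk 0 0 (fun i => weakCurl (PhaseSpace.B φ i)) (fun i => -weakCurl (PhaseSpace.E φ i))

/-- `D_w(Aⁿ) = {φ | Aᵏ φ ∈ D_w(A) for 0 ≤ k ≤ n - 1}`; in particular `D_w(A⁰) = ℋ_w`. -/
def domPow (w : Weight) (N n : ℕ) : Set (PhaseSpace w N) :=
  {φ | ∀ k < n, opA^[k] φ ∈ domA w N}

/-- The relativistic velocity `v(p) = sign(m) p / √(m² + p²)`. -/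
noncomputable def velocity (m : ℝ) (p : E3) : E3 :=
  (Real.sign m / √(m ^ 2 + ‖p‖ ^ 2)) • p

/-- The smeared Lorentz force on the `i`-th charge. -/
noncomputable def lorentzForce {w : Weight} {N : ℕ} (m : Fin N → ℝ) (e : Fin N → Fin N → ℝ)
    (ρ : Fin N → ChargeDensity) (φ : PhaseSpace w N) (i : Fin N) : E3 :=
  ∑ j, e i j • ∫ x, ρ i (x - PhaseSpace.q φ i) •
    (PhaseSpace.E φ j x + cross (velocity (m i) (PhaseSpace.p φ i)) (PhaseSpace.B φ j x))

theorem memLp_current (w : Weight) (ρ : ChargeDensity) (q v : E3) :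
    MemLp (fun x => (-(4 * Real.pi) * ρ (x - q)) • v) 2 w.measure := by
  have hc : Continuous fun x => (-(4 * Real.pi) * ρ (x - q)) • v :=
    (continuous_const.mul (ρ.contDiff.continuous.comp (continuous_id.sub continuous_const))).smul
      continuous_const
  refine hc.memLp_of_hasCompactSupport ?_
  have hs : HasCompactSupport fun x => ρ (x - q) :=
    ρ.hasCompactSupport.comp_homeomorph (Homeomorph.subRight q)
  exact hs.mul_left.smul_right

/-- The source term `-4π ϱ(· - q) v` as an element of `L²_w`. -/
noncomputable def current (w : Weight) (ρ : ChargeDensity) (q v : E3) : L2w w :=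
  (memLp_current w ρ q v).toLp _

/-- The nonlinear operator `J`. -/
noncomputable def opJ {w : Weight} {N : ℕ} (m : Fin N → ℝ) (e : Fin N → Fin N → ℝ)
    (ρ : Fin N → ChargeDensity) (φ : PhaseSpace w N) : PhaseSpace w N :=
  PhaseSpace.mk (fun i => velocity (m i) (PhaseSpace.p φ i))
    (lorentzForce m e ρ φ)
    (fun i => current w (ρ i) (PhaseSpace.q φ i) (velocity (m i) (PhaseSpace.p φ i)))
    0

/-! ### Solutions, constraints, bounds -/

/-- `φ` is a once continuously differentiable (in `ℋ_w`), `D_w(A)`-valued solution of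
`φ̇ = A φ + J(φ)` on the open set `Λ` of times. -/
structure IsSolutionOn {w : Weight} {N : ℕ} (m : Fin N → ℝ) (e : Fin N → Fin N → ℝ)
    (ρ : Fin N → ChargeDensity) (Λ : Set ℝ) (φ : ℝ → PhaseSpace w N) : Prop where
  contDiffOn : ContDiffOn ℝ 1 φ Λ
  mem_domA : ∀ t ∈ Λ, φ t ∈ domA w N
  hasDerivAt : ∀ t ∈ Λ, HasDerivAt φ (opA (φ t) + opJ m e ρ (φ t)) t

/-- `∇ · F = r` in the sense of distributions: `∫ F · ∇η = -∫ r η` for all test functions `η`. -/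
def IsWeakDiv (F : E3 → E3) (r : E3 → ℝ) : Prop :=
  ∀ η : E3 → ℝ, ContDiff ℝ ∞ η → HasCompactSupport η →
    ∫ x, inner ℝ (F x) (gradient η x) = -∫ x, r x * η x

/-- The Maxwell constraints `∇ · Eᵢ = 4π ϱᵢ(· - qᵢ)` and `∇ · Bᵢ = 0` for all `i`. -/
def MaxwellConstraints {w : Weight} {N : ℕ} (ρ : Fin N → ChargeDensity)
    (φ : PhaseSpace w N) : Prop :=
  ∀ i, IsWeakDiv (PhaseSpace.E φ i) (fun x => 4 * Real.pi * ρ i (x - PhaseSpace.q φ i)) ∧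
    IsWeakDiv (PhaseSpace.B φ i) 0

/-- A bounding function: continuous and non-decreasing in all of its arguments (`α` is a finite
product of copies of `[0, ∞)` with the componentwise order). -/
def IsBound {α : Type} [TopologicalSpace α] [Preorder α] (C : α → ℝ≥0) : Prop :=
  Continuous C ∧ Monotone C

/-- `‖ϱ‖_{L²_w}`. -/
noncomputable def normL2w (w : Weight) (ρ : ChargeDensity) : ℝ≥0 :=
  (eLpNorm (ρ : E3 → ℝ) 2 w.measure).toNNReal

/-- `‖w^{-1/2} ϱ‖_{L²}`. -/
noncomputable def normInvSqrt (w : Weight) (ρ : ChargeDensity) : ℝ≥0 :=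
  (eLpNorm (fun x => (√(w x))⁻¹ * ρ x) 2 (volume : Measure E3)).toNNReal

end MaxwellLorentz

open MaxwellLorentz

/-! ### Strongly continuous groups and semilinear evolution equations -/

namespace Evolution

open Filter Topology Set

variable {H : Type*} [NormedAddCommGroup H] [InnerProductSpace ℝ H]

/-! The equation is semilinear, `φ' = A φ + J φ`, and everything follows from three facts.

The operator `A` generates a strongly continuous group. Curl is not symmetric on `L²_w`, but for `w`
in `𝒲¹` one has `|∇w| ≤ C w`, so its defect of symmetry is a bounded form and `|⟨φ, A φ⟩| ≤ γ ‖φ‖²`.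
No resolvents are used. The curl of a mollification at scale `ε` is a bounded operator. The
resulting approximations of `A` commute with each other, preserve the graph of `A`, converge to `A`
on its domain, and satisfy the same energy inequality with `γ` independent of `ε`. Their
exponentials therefore converge strongly to a group (`exists_inner_mollCurl_sub_le`,
`exists_c0Group`, `exists_group`).

The map `J` is smooth, is Lipschitz on balls, and takes values in every `D(Aⁿ)` with `Aᵏ J` again
smooth: the only field it produces is a translate of a test function, and the curls fall on that
profile (`powJ_mem`, `tame_powJ`). Hence the Picard iteration can be run in `ℋ_w` alone. A mild
solution starting in `D(A)` is automatically strong, and one starting in `D(Aⁿ)` is `n` times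
differentiable (`exists_chain`).

Velocities are bounded by one, so over a time `T` a charge moves by at most `T`, and translating
`ϱᵢ` by its position changes the weighted norms by a controlled factor. This gives `‖J φ‖ ≤ K(‖q‖)
‖φ‖` with a factor that sees the positions only (`linearGrowth_opJ`). Combined with the energy
inequality it yields an a priori bound, which is the growth bound of the theorem and also excludes
blow-up. The same inequality applied to the difference of two solutions gives uniqueness and
Lipschitz dependence.

The constraints are conserved because, tested against `∇η`, curls vanish and the current cancels the
time derivative of the moving charge. -/

/-- Two-sided energy form of Grönwall's inequality. -/
theorem norm_le_exp_mul_norm {u u' : ℝ → H} {K s t : ℝ}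
    (hu : ∀ r ∈ uIcc s t, HasDerivAt u (u' r) r)
    (hK : ∀ r ∈ uIcc s t, |inner ℝ (u r) (u' r)| ≤ K * ‖u r‖ ^ 2) :
    ‖u t‖ ≤ Real.exp (K * |t - s|) * ‖u s‖ := by
  -- The energy `exp (c r) ‖u r‖²` is decreasing for `c = -2K`, which serves `s ≤ t`, and increasing
  -- for `c = 2K`, which serves `t ≤ s`.
  have hd : ∀ c : ℝ, ∀ r ∈ uIcc s t, HasDerivAt (fun r => Real.exp (c * r) * ‖u r‖ ^ 2)
      (Real.exp (c * r) * (c * ‖u r‖ ^ 2 + 2 * inner ℝ (u r) (u' r))) r := by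
    intro c r hr
    have h1 : HasDerivAt (fun r => Real.exp (c * r)) (Real.exp (c * r) * c) r := by
      simpa using ((hasDerivAt_id r).const_mul c).exp
    convert! h1.mul (hu r hr).norm_sq using 1
    ring
  have key : ‖u t‖ ^ 2 ≤ (Real.exp (K * |t - s|) * ‖u s‖) ^ 2 := by
    rcases le_total s t with hst | hst
    · rw [uIcc_of_le hst] at hd hK
      have h := (antitoneOn_of_deriv_nonpos (convex_Icc s t)
        (fun r hr => (hd (-(2 * K)) r hr).continuousAt.continuousWithinAt)
        (fun r hr => (hd (-(2 * K)) r (interior_subset hr)).differentiableAt.differentiableWithinAt)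
        (fun r hr => by
          rw [(hd (-(2 * K)) r (interior_subset hr)).deriv]
          have := (abs_le.1 (hK r (interior_subset hr))).2
          exact mul_nonpos_of_nonneg_of_nonpos (Real.exp_pos _).le (by linarith)))
        (left_mem_Icc.2 hst) (right_mem_Icc.2 hst) hst
      simp only at h
      rw [abs_of_nonneg (sub_nonneg.2 hst), mul_pow, ← Real.exp_nat_mul]
      have h2 := mul_le_mul_of_nonneg_left h (Real.exp_pos (2 * K * t)).le
      rw [← mul_assoc, ← mul_assoc, ← Real.exp_add, ← Real.exp_add] at h2
      ring_nf at h2 ⊢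
      simpa using h2
    · rw [uIcc_of_ge hst] at hd hK
      have h := (monotoneOn_of_deriv_nonneg (convex_Icc t s)
        (fun r hr => (hd (2 * K) r hr).continuousAt.continuousWithinAt)
        (fun r hr => (hd (2 * K) r (interior_subset hr)).differentiableAt.differentiableWithinAt)
        (fun r hr => by
          rw [(hd (2 * K) r (interior_subset hr)).deriv]
          have := (abs_le.1 (hK r (interior_subset hr))).1
          exact mul_nonneg (Real.exp_pos _).le (by linarith)))
        (left_mem_Icc.2 hst) (right_mem_Icc.2 hst) hst
      simp only at h
      rw [abs_of_nonpos (sub_nonpos.2 hst), mul_pow, ← Real.exp_nat_mul]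
      have h2 := mul_le_mul_of_nonneg_left h (Real.exp_pos (-(2 * K * t))).le
      rw [← mul_assoc, ← mul_assoc, ← Real.exp_add, ← Real.exp_add] at h2
      ring_nf at h2 ⊢
      simpa using h2
  exact le_of_sq_le_sq key (by positivity)

/-- A strongly continuous one-parameter group with growth rate `γ`. -/
structure C0Group (H : Type*) [NormedAddCommGroup H] [InnerProductSpace ℝ H] (γ : ℝ) where
  toFun : ℝ → H →L[ℝ] H
  map_zero : ∀ x, toFun 0 x = x
  map_add : ∀ s t x, toFun (s + t) x = toFun s (toFun t x)
  norm_le : ∀ t x, ‖toFun t x‖ ≤ Real.exp (γ * |t|) * ‖x‖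
  continuous : ∀ x, Continuous fun t => toFun t x

instance (γ : ℝ) : CoeFun (C0Group H γ) fun _ => ℝ → H →L[ℝ] H := ⟨C0Group.toFun⟩

/-- The group preserves the graph `G` and is differentiable on its domain. -/
structure C0Group.Generates {γ : ℝ} (W : C0Group H γ) (G : Submodule ℝ (H × H)) : Prop where
  mem : ∀ {x y}, (x, y) ∈ G → ∀ t, (W t x, W t y) ∈ G
  hasDerivAt : ∀ {x y}, (x, y) ∈ G → ∀ t, HasDerivAt (fun t => W t x) (W t y) t

/-! ### Generation of a group from commuting bounded approximations -/

section Generation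

theorem exp_apply_comm {A B : H →L[ℝ] H} (h : Commute A B) (t : ℝ) (x : H) :
    NormedSpace.exp (t • A) (B x) = B (NormedSpace.exp (t • A) x) :=
  DFunLike.congr_fun ((h.smul_left t).exp_left).eq x

variable [CompleteSpace H]

theorem hasDerivAt_exp_apply (A : H →L[ℝ] H) (x : H) (t : ℝ) :
    HasDerivAt (fun t : ℝ => NormedSpace.exp (t • A) x) (NormedSpace.exp (t • A) (A x)) t := by
  have h := hasDerivAt_exp_smul_const (𝕂 := ℝ) A t
  exact (ContinuousLinearMap.apply ℝ H x).hasFDerivAt.comp_hasDerivAt t h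

/-- The orbit solves `u' = A u`, so the energy form of Grönwall applies. The bound involves `γ`
only, not the operator norm of `A`, and is thus uniform along the approximations. -/
theorem norm_exp_apply_le {A : H →L[ℝ] H} {γ : ℝ}
    (hA : ∀ x, |inner ℝ x (A x)| ≤ γ * ‖x‖ ^ 2) (t : ℝ) (x : H) :
    ‖NormedSpace.exp (t • A) x‖ ≤ Real.exp (γ * |t|) * ‖x‖ := by
  have h := norm_le_exp_mul_norm (s := 0) (t := t) (K := γ)
    (fun r _ => hasDerivAt_exp_apply A x r)
    (fun r _ => by rw [exp_apply_comm (Commute.refl A)]; exact hA _)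
  simpa using h

/-- Every partial sum of the exponential series, applied to both coordinates, stays in `G`, and `G`
is closed. -/
theorem exp_apply_mem {G : Submodule ℝ (H × H)} (hG : IsClosed (G : Set (H × H)))
    {A : H →L[ℝ] H} (hA : ∀ x y, (x, y) ∈ G → (A x, A y) ∈ G) {x y : H} (h : (x, y) ∈ G)
    (t : ℝ) : (NormedSpace.exp (t • A) x, NormedSpace.exp (t • A) y) ∈ G := by
  have hs := NormedSpace.exp_series_hasSum_exp' (𝕂 := ℝ) (t • A)
  have hx := ((ContinuousLinearMap.apply ℝ H x).prod
    (ContinuousLinearMap.apply ℝ H y)).hasSum hs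
  refine hG.mem_of_tendsto hx (Eventually.of_forall fun s => G.sum_mem fun k _ => ?_)
  have hk : ∀ k : ℕ, ((A ^ k) x, (A ^ k) y) ∈ G := by
    intro k
    induction k with
    | zero => simpa using h
    | succ k ih =>
      rw [pow_succ']
      exact hA _ _ ih
  have := G.smul_mem ((k.factorial : ℝ)⁻¹) (G.smul_mem (t ^ k) (hk k))
  simpa [smul_pow, Function.comp] using this

/-- Interpolate by `exp (s A) exp ((t - s) B) x`. Since `A` and `B` commute, its `s`-derivative is
the same product of exponentials applied to `A x - B x`. The difference of the orbits is thus
controlled by `A x - B x` at the single vector `x`, which is small on the domain of the limit. Each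
of the two exponentials contributes `exp (γ |t|)`, hence the `2 γ`. -/
theorem norm_exp_sub_exp_le {A B : H →L[ℝ] H} {γ : ℝ} (hγ : 0 ≤ γ) (hAB : Commute A B)
    (hA : ∀ x, |inner ℝ x (A x)| ≤ γ * ‖x‖ ^ 2) (hB : ∀ x, |inner ℝ x (B x)| ≤ γ * ‖x‖ ^ 2)
    (t : ℝ) (x : H) :
    ‖NormedSpace.exp (t • A) x - NormedSpace.exp (t • B) x‖ ≤
      Real.exp (2 * γ * |t|) * ‖A x - B x‖ * |t| := by
  let g : ℝ → H := fun s => NormedSpace.exp (s • A) (NormedSpace.exp ((t - s) • B) x)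
  have hg : ∀ s, HasDerivAt g
      (NormedSpace.exp (s • A) (NormedSpace.exp ((t - s) • B) (A x - B x))) s := by
    intro s
    have h1 := hasDerivAt_exp_smul_const (𝕂 := ℝ) A s
    have h2 : HasDerivAt (fun s => NormedSpace.exp ((t - s) • B) x)
        (-(NormedSpace.exp ((t - s) • B) (B x))) s := by
      have := (hasDerivAt_exp_apply B x (t - s)).scomp s ((hasDerivAt_id s).const_sub t)
      simpa [Function.comp_def] using this
    have h3 := h1.clm_apply h2
    convert! h3 using 1
    simp only [mul_apply_eq_comp, map_neg, map_sub, exp_apply_comm hAB.symm]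
    abel
  have hb : ∀ s ∈ uIcc 0 t,
      ‖NormedSpace.exp (s • A) (NormedSpace.exp ((t - s) • B) (A x - B x))‖ ≤
        Real.exp (2 * γ * |t|) * ‖A x - B x‖ := by
    intro s hs
    have h1 := norm_exp_apply_le hA s (NormedSpace.exp ((t - s) • B) (A x - B x))
    have h2 := norm_exp_apply_le hB (t - s) (A x - B x)
    have e1 : |s| ≤ |t| := by simpa using abs_sub_left_of_mem_uIcc hs
    have e2 : |t - s| ≤ |t| := by simpa using abs_sub_right_of_mem_uIcc hs
    calc _ ≤ Real.exp (γ * |s|) * (Real.exp (γ * |t - s|) * ‖A x - B x‖) :=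
          h1.trans (by gcongr)
      _ ≤ Real.exp (γ * |t|) * (Real.exp (γ * |t|) * ‖A x - B x‖) := by gcongr
      _ = _ := by rw [← mul_assoc, ← Real.exp_add]; ring_nf
  have := (convex_uIcc 0 t).norm_image_sub_le_of_norm_hasDerivWithin_le
    (fun s _ => (hg s).hasDerivWithinAt) hb left_mem_uIcc right_mem_uIcc
  simpa [g] using this

variable {G : Submodule ℝ (H × H)} {A : ℕ → H →L[ℝ] H} {γ : ℝ}

/-- On the domain the previous estimate applies because `A n x` converges. Density and the bound
uniform in `n` extend this to all vectors by an `ε / 3` argument. -/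
theorem cauchySeq_exp_apply (hγ : 0 ≤ γ) (hdense : Dense {x | ∃ y, (x, y) ∈ G})
    (hcomm : ∀ m n, Commute (A m) (A n)) (hdiss : ∀ n x, |inner ℝ x (A n x)| ≤ γ * ‖x‖ ^ 2)
    (hlim : ∀ x y, (x, y) ∈ G → Tendsto (fun n => A n x) atTop (𝓝 y)) (t : ℝ) (x : H) :
    CauchySeq fun n => NormedSpace.exp (t • A n) x := by
  rw [Metric.cauchySeq_iff]
  intro ε hε
  have hE := Real.exp_pos (γ * |t|)
  have hE2 := Real.exp_pos (2 * γ * |t|)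
  obtain ⟨x', ⟨y', hx'⟩, hd⟩ := hdense.exists_dist_lt x
    (show 0 < ε / (3 * Real.exp (γ * |t|)) by positivity)
  obtain ⟨M, hM⟩ := Metric.cauchySeq_iff.1 (hlim x' y' hx').cauchySeq
    (ε / (3 * (Real.exp (2 * γ * |t|) * (|t| + 1)))) (by positivity)
  refine ⟨M, fun m hm n hn => ?_⟩
  rw [dist_eq_norm] at hd
  have h1 : ∀ k, ‖NormedSpace.exp (t • A k) (x - x')‖ < ε / 3 := fun k =>
    calc _ ≤ Real.exp (γ * |t|) * ‖x - x'‖ := norm_exp_apply_le (hdiss k) t _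
      _ < Real.exp (γ * |t|) * (ε / (3 * Real.exp (γ * |t|))) := by gcongr
      _ = ε / 3 := by field_simp
  have h2 : ‖NormedSpace.exp (t • A m) x' - NormedSpace.exp (t • A n) x'‖ ≤ ε / 3 := by
    have h3 := (hM m hm n hn).le
    rw [dist_eq_norm] at h3
    calc _ ≤ Real.exp (2 * γ * |t|) * ‖A m x' - A n x'‖ * |t| :=
          norm_exp_sub_exp_le hγ (hcomm m n) (hdiss m) (hdiss n) t x'
      _ ≤ Real.exp (2 * γ * |t|) * (ε / (3 * (Real.exp (2 * γ * |t|) * (|t| + 1)))) *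
          (|t| + 1) := by gcongr; linarith
      _ = ε / 3 := by field_simp
  have e : NormedSpace.exp (t • A m) x - NormedSpace.exp (t • A n) x =
      NormedSpace.exp (t • A m) (x - x') - NormedSpace.exp (t • A n) (x - x') +
      (NormedSpace.exp (t • A m) x' - NormedSpace.exp (t • A n) x') := by
    simp only [map_sub]; abel
  rw [dist_eq_norm, e]
  have h4 := norm_add_le (NormedSpace.exp (t • A m) (x - x') - NormedSpace.exp (t • A n) (x - x'))
    (NormedSpace.exp (t • A m) x' - NormedSpace.exp (t • A n) x')
  have h5 := norm_sub_le (NormedSpace.exp (t • A m) (x - x')) (NormedSpace.exp (t • A n) (x - x'))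
  linarith [h1 m, h1 n]

/-- The group generated by a limit of commuting bounded quasi-skew operators. -/
theorem exists_c0Group (hγ : 0 ≤ γ) (hG : IsClosed (G : Set (H × H)))
    (hdense : Dense {x | ∃ y, (x, y) ∈ G}) (hcomm : ∀ m n, Commute (A m) (A n))
    (hdiss : ∀ n x, |inner ℝ x (A n x)| ≤ γ * ‖x‖ ^ 2)
    (hpres : ∀ n x y, (x, y) ∈ G → (A n x, A n y) ∈ G)
    (hlim : ∀ x y, (x, y) ∈ G → Tendsto (fun n => A n x) atTop (𝓝 y)) :
    ∃ W : C0Group H γ, W.Generates G := by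
  choose V hV using fun (t : ℝ) (x : H) =>
    cauchySeq_tendsto_of_complete (cauchySeq_exp_apply hγ hdense hcomm hdiss hlim t x)
  have hVle : ∀ t x, ‖V t x‖ ≤ Real.exp (γ * |t|) * ‖x‖ := fun t x =>
    le_of_tendsto (hV t x).norm (Eventually.of_forall fun n => norm_exp_apply_le (hdiss n) t x)
  let W : ℝ → H →L[ℝ] H := fun t => LinearMap.mkContinuous
    { toFun := V t
      map_add' := fun x y => tendsto_nhds_unique (hV t (x + y))
        (by simpa only [map_add] using (hV t x).add (hV t y))
      map_smul' := fun c x => tendsto_nhds_unique (hV t (c • x))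
        (by simpa only [map_smul, RingHom.id_apply] using (hV t x).const_smul c) }
    (Real.exp (γ * |t|)) (hVle t)
  have hW : ∀ t x, Tendsto (fun n => NormedSpace.exp (t • A n) x) atTop (𝓝 (W t x)) := hV
  have hWle : ∀ t x, ‖W t x‖ ≤ Real.exp (γ * |t|) * ‖x‖ := hVle
  have hW0 : ∀ x, W 0 x = x := fun x => tendsto_nhds_unique (hW 0 x) (by simp)
  have hWadd : ∀ s t x, W (s + t) x = W s (W t x) := by
    intro s t x
    refine tendsto_nhds_unique (hW (s + t) x) ?_
    -- Operator and argument both depend on `n`. The error in the argument tends to zero and the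
    -- operators are bounded uniformly in `n`, so the first summand vanishes in the limit.
    have e : ∀ n, NormedSpace.exp ((s + t) • A n) x =
        NormedSpace.exp (s • A n) (NormedSpace.exp (t • A n) x - W t x) +
        NormedSpace.exp (s • A n) (W t x) := by
      intro n
      let : NormedAlgebra ℚ (H →L[ℝ] H) := .restrictScalars ℚ ℝ _
      rw [map_sub, sub_add_cancel, add_smul,
        NormedSpace.exp_add_of_commute (((Commute.refl (A n)).smul_left s).smul_right t)]
      rfl
    simp only [e]
    have h1 : Tendsto (fun n => NormedSpace.exp (s • A n) (NormedSpace.exp (t • A n) x - W t x))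
        atTop (𝓝 0) := by
      refine squeeze_zero_norm (fun n => norm_exp_apply_le (hdiss n) s _) ?_
      have := ((hW t x).sub_const (W t x)).norm.const_mul (Real.exp (γ * |s|))
      simpa using this
    simpa using h1.add (hW s (W t x))
  have hWsub : ∀ x y, (x, y) ∈ G → ∀ t n, ‖W t x - NormedSpace.exp (t • A n) x‖ ≤
      Real.exp (2 * γ * |t|) * ‖y - A n x‖ * |t| := by
    intro x y h t n
    exact le_of_tendsto_of_tendsto' ((hW t x).sub_const _).norm
      ((((hlim x y h).sub_const _).norm.const_mul _).mul_const _)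
      fun m => norm_exp_sub_exp_le hγ (hcomm m n) (hdiss m) (hdiss n) t x
  have hWcont : ∀ x, Continuous fun t => W t x := by
    intro x
    -- Near `t` the orbit of `x` is uniformly close to the norm-continuous curve `exp (s A n) x'`,
    -- with `x'` in the domain close to `x` and `n` large; `T = |t| + 1` bounds all times in the
    -- unit ball around `t`.
    refine continuous_of_locally_uniform_approx_of_continuousAt fun t u hu => ?_
    obtain ⟨ε, hε, hu⟩ := Metric.mem_uniformity_dist.1 hu
    set T := |t| + 1 with hT
    have hT1 : 0 < T := by positivity
    obtain ⟨x', ⟨y', hx'⟩, hd⟩ := hdense.exists_dist_lt x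
      (show 0 < ε / (2 * Real.exp (γ * T)) by positivity)
    obtain ⟨n, hn⟩ := (Metric.tendsto_atTop.1 (hlim x' y' hx')
      (ε / (2 * (Real.exp (2 * γ * T) * T))) (by positivity))
    refine ⟨Metric.ball t 1, Metric.ball_mem_nhds t one_pos,
      fun s => NormedSpace.exp (s • A n) x', (hasDerivAt_exp_apply _ _ _).continuousAt,
      fun s hs => hu ?_⟩
    have hs' : |s| ≤ T := by
      rw [Metric.mem_ball, Real.dist_eq] at hs
      have := abs_sub_abs_le_abs_sub s t
      linarith
    rw [dist_eq_norm] at hd ⊢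
    have h2 := hn n le_rfl
    rw [dist_comm, dist_eq_norm] at h2
    have e : W s x - NormedSpace.exp (s • A n) x' =
        W s (x - x') + (W s x' - NormedSpace.exp (s • A n) x') := by
      rw [map_sub]; abel
    rw [e]
    calc _ ≤ Real.exp (γ * |s|) * ‖x - x'‖ + Real.exp (2 * γ * |s|) * ‖y' - A n x'‖ * |s| :=
          (norm_add_le _ _).trans (add_le_add (hWle _ _) (hWsub _ _ hx' _ _))
      _ ≤ Real.exp (γ * T) * ‖x - x'‖ + Real.exp (2 * γ * T) * ‖y' - A n x'‖ * T := by gcongr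
      _ < Real.exp (γ * T) * (ε / (2 * Real.exp (γ * T))) +
          Real.exp (2 * γ * T) * (ε / (2 * (Real.exp (2 * γ * T) * T))) * T := by gcongr
      _ = ε := by field_simp; norm_num
  refine ⟨⟨W, hW0, hWadd, hWle, hWcont⟩, ⟨fun {x y} h t => ?_, fun {x y} h t => ?_⟩⟩
  · exact hG.mem_of_tendsto ((hW t x).prodMk_nhds (hW t y))
      (Eventually.of_forall fun n => exp_apply_mem hG (hpres n) h t)
  -- The integrated equation of the approximations passes to the limit by dominated convergence; its
  -- right side is differentiable since the orbit of `y` is continuous.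
  · have hint : ∀ t, W t x = x + ∫ s in (0 : ℝ)..t, W s y := by
      intro t
      have h1 : ∀ n, NormedSpace.exp (t • A n) x =
          x + ∫ s in (0 : ℝ)..t, NormedSpace.exp (s • A n) (A n x) := by
        intro n
        rw [intervalIntegral.integral_eq_sub_of_hasDerivAt
          (fun s _ => hasDerivAt_exp_apply (A n) x s)
          (Continuous.intervalIntegrable (continuous_iff_continuousAt.2 fun s =>
            (hasDerivAt_exp_apply (A n) (A n x) s).continuousAt) _ _)]
        simp
      refine tendsto_nhds_unique (hW t x) ?_
      simp only [h1]
      refine Tendsto.const_add x ?_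
      obtain ⟨C, hC⟩ := (hlim x y h).norm.bddAbove_range
      refine intervalIntegral.tendsto_integral_filter_of_dominated_convergence
        (fun s => Real.exp (γ * |t|) * C) (Eventually.of_forall fun n => ?_)
        (Eventually.of_forall fun n => Eventually.of_forall fun s hs => ?_)
        intervalIntegrable_const (Eventually.of_forall fun s _ => ?_)
      · exact (continuous_iff_continuousAt.2 fun s =>
          (hasDerivAt_exp_apply (A n) (A n x) s).continuousAt).aestronglyMeasurable
      · have hs' : |s| ≤ |t| := by simpa using abs_sub_left_of_mem_uIcc (uIoc_subset_uIcc hs)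
        have : ‖A n x‖ ≤ C := hC ⟨n, rfl⟩
        exact (norm_exp_apply_le (hdiss n) s _).trans (by gcongr)
      · have h2 : Tendsto (fun n => NormedSpace.exp (s • A n) (A n x - y)) atTop (𝓝 0) := by
          refine squeeze_zero_norm (fun n => norm_exp_apply_le (hdiss n) s _) ?_
          simpa using ((hlim x y h).sub_const y).norm.const_mul (Real.exp (γ * |s|))
        simpa using h2.add (hW s y)
    have h2 := ((hWcont y).integral_hasStrictDerivAt 0 t).hasDerivAt.const_add x
    exact h2.congr_of_eventuallyEq (Eventually.of_forall hint)

end Generation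
end Evolution

namespace Evolution

open Filter Topology Set

/-! ### Duhamel's formula -/

section Forced

variable {H : Type*} [NormedAddCommGroup H] [InnerProductSpace ℝ H]
variable {γ : ℝ} (W : C0Group H γ) {G : Submodule ℝ (H × H)}

theorem C0Group.map_neg_map (t : ℝ) (x : H) : W t (W (-t) x) = x := by
  rw [← W.map_add, add_neg_cancel, W.map_zero]

/-- Strong continuity and a locally uniform operator bound together give joint continuity in time
and vector. -/
theorem C0Group.continuousAt_uncurry {α : Type*} [TopologicalSpace α] {τ : α → ℝ} {x : α → H}
    {a : α} (hτ : ContinuousAt τ a) (hx : ContinuousAt x a) :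
    ContinuousAt (fun b => W (τ b) (x b)) a := by
  have h1 : Tendsto (fun b => W (τ b) (x b - x a)) (𝓝 a) (𝓝 0) := by
    refine squeeze_zero_norm (fun b => W.norm_le _ _) ?_
    have h2 : ContinuousAt (fun b => Real.exp (γ * |τ b|) * ‖x b - x a‖) a := by fun_prop
    simpa using h2.tendsto
  have h3 := h1.add (((W.continuous (x a)).continuousAt (x := τ a)).comp hτ).tendsto
  simpa [ContinuousAt] using h3

theorem C0Group.continuous_comp {α : Type*} [TopologicalSpace α] {τ : α → ℝ} {x : α → H}
    (hτ : Continuous τ) (hx : Continuous x) : Continuous fun b => W (τ b) (x b) :=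
  continuous_iff_continuousAt.2 fun _ => W.continuousAt_uncurry hτ.continuousAt hx.continuousAt

variable {W}

/-- Product rule for the action of the group on a differentiable curve. -/
theorem C0Group.Generates.hasDerivAt_apply (hW : W.Generates G) {u : ℝ → H} {u' y : H} {t : ℝ}
    (hu : HasDerivAt u u' t) (hy : (u t, y) ∈ G) :
    HasDerivAt (fun t => W t (u t)) (W t y + W t u') t := by
  have h1 := hW.hasDerivAt hy t
  rw [hasDerivAt_iff_tendsto_slope] at h1 hu ⊢
  -- Giving the slope the value `u'` at `t` makes it continuous there, so joint continuity of the
  -- group action applies.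
  have h2 : Tendsto (fun s => W s (slope u t s)) (𝓝[≠] t) (𝓝 (W t u')) := by
    have h3 : ContinuousAt (fun s => W s (Function.update (slope u t) t u' s)) t :=
      W.continuousAt_uncurry continuousAt_id (continuousAt_update_same.2 hu)
    have h4 := h3.continuousWithinAt (s := {t}ᶜ)
    refine (by simpa using h4.tendsto : Tendsto _ _ (𝓝 (W t u'))).congr' ?_
    filter_upwards [self_mem_nhdsWithin] with s hs
    rw [Function.update_of_ne hs]
  refine (h1.add h2).congr fun s => ?_
  simp only [slope_def_module, map_smul, map_sub]
  rw [← smul_add]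
  congr 1
  abel

/-- The mild solution of `φ' = A φ + f` with `φ 0 = x`. -/
noncomputable def C0Group.forced (W : C0Group H γ) (x : H) (f : ℝ → H) (t : ℝ) : H :=
  W t (x + ∫ s in (0 : ℝ)..t, W (-s) (f s))

theorem C0Group.forced_zero (x : H) (f : ℝ → H) : W.forced x f 0 = x := by
  simp [C0Group.forced, W.map_zero]

theorem C0Group.continuous_forced {x : H} {f : ℝ → H} (hf : Continuous f) : Continuous (W.forced x f) :=
  W.continuous_comp continuous_id (continuous_const.add
    (intervalIntegral.continuous_primitive (fun _ _ =>
      (W.continuous_comp continuous_neg hf).intervalIntegrable _ _) 0))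

variable [CompleteSpace H] {f g : ℝ → H} {x y : H}

/-- The quotient map by `S` is continuous, commutes with the integral and kills the integrand. If
`f` is not integrable, the integral has the default value `0`, which is in `S`. -/
theorem integral_mem_closed_submodule {E α : Type*} [NormedAddCommGroup E] [NormedSpace ℝ E]
    [CompleteSpace E] {_ : MeasurableSpace α} {μ : Measure α} {S : Submodule ℝ E}
    (hS : IsClosed (S : Set E)) {f : α → E} (h : ∀ s, f s ∈ S) : ∫ s, f s ∂μ ∈ S := by
  by_cases hf : Integrable f μ
  · have : IsClosed (S : Set E) := hS
    let L : E →L[ℝ] E ⧸ S := ⟨S.mkQ, continuous_quot_mk⟩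
    have h1 : L (∫ s, f s ∂μ) = ∫ s, L (f s) ∂μ := (L.integral_comp_comm hf).symm
    have h2 : ∀ s, L (f s) = 0 := fun s => (Submodule.Quotient.mk_eq_zero S).2 (h s)
    simp only [h2, integral_zero] at h1
    exact (Submodule.Quotient.mk_eq_zero S).1 h1
  · rw [integral_undef hf]
    exact S.zero_mem

theorem intervalIntegral_mem (hG : IsClosed (G : Set (H × H))) (hf : Continuous f)
    (hg : Continuous g) (h : ∀ s, (f s, g s) ∈ G) (t : ℝ) :
    (∫ s in (0 : ℝ)..t, f s, ∫ s in (0 : ℝ)..t, g s) ∈ G := by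
  have hi : ∀ a b : ℝ, (∫ s in Ioc a b, f s, ∫ s in Ioc a b, g s) ∈ G := by
    intro a b
    have hfi := hf.integrableOn_Ioc (a := a) (b := b) (μ := volume)
    have hgi := hg.integrableOn_Ioc (a := a) (b := b) (μ := volume)
    rw [← integral_pair hfi hgi]
    exact integral_mem_closed_submodule hG h
  simp only [intervalIntegral]
  have := G.sub_mem (hi 0 t) (hi t 0)
  simpa using this

theorem C0Group.Generates.forced_mem (hW : W.Generates G) (hG : IsClosed (G : Set (H × H)))
    (hf : Continuous f) (hg : Continuous g) (hfg : ∀ s, (f s, g s) ∈ G) (hxy : (x, y) ∈ G)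
    (t : ℝ) : (W.forced x f t, W.forced y g t) ∈ G :=
  hW.mem (G.add_mem hxy (intervalIntegral_mem hG (W.continuous_comp continuous_neg hf)
    (W.continuous_comp continuous_neg hg) (fun s => hW.mem (hfg s) (-s)) t)) t

/-- As the source takes values in the domain, with continuous image `g`, closedness moves the
generator inside the Duhamel integral: it sends the mild solution for `(x, f)` to the one for `(y,
g)`. A source that is merely continuous in time therefore already gives a strong solution. -/
theorem C0Group.Generates.hasDerivAt_forced (hW : W.Generates G) (hG : IsClosed (G : Set (H × H)))
    (hf : Continuous f) (hg : Continuous g) (hfg : ∀ s, (f s, g s) ∈ G) (hxy : (x, y) ∈ G)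
    (t : ℝ) : HasDerivAt (W.forced x f) (W.forced y g t + f t) t := by
  have h1 := (((W.continuous_comp continuous_neg hf).integral_hasStrictDerivAt 0 t).hasDerivAt
    ).const_add x
  have h2 := hW.hasDerivAt_apply h1 (G.add_mem hxy (intervalIntegral_mem hG
    (W.continuous_comp continuous_neg hf)
    (W.continuous_comp continuous_neg hg) (fun s => hW.mem (hfg s) (-s)) t))
  convert! h2 using 1
  rw [W.map_neg_map]
  rfl

end Forced

end Evolution

namespace Evolution

open Filter Topology Set

/-! ### Semilinear equations: a priori bounds, existence, regularity -/

section Semilinear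

variable {H : Type*} [NormedAddCommGroup H] [InnerProductSpace ℝ H]
variable {V : Type*} [NormedAddCommGroup V] [NormedSpace ℝ V]

/-- `φ` is a strong solution of `φ' = A φ + J φ` on `S`, where `G` is the graph of `A`. -/
def IsStrongSol (G : Submodule ℝ (H × H)) (J : H → H) (φ : ℝ → H) (S : Set ℝ) : Prop :=
  ∀ t ∈ S, ∃ z, (φ t, z) ∈ G ∧ HasDerivAt φ (z + J (φ t)) t

/-- `G` is the graph of a quasi-skew operator. -/
def QuasiSkew (G : Submodule ℝ (H × H)) (γ : ℝ) : Prop :=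
  ∀ x y, (x, y) ∈ G → |inner ℝ x y| ≤ γ * ‖x‖ ^ 2

/-- `J` grows at most linearly, with a factor that depends on `π x`, and moves `π x` at bounded
speed. -/
structure LinearGrowth (J : H → H) (π : H →L[ℝ] V) (c : ℝ) (K : ℝ → ℝ) : Prop where
  norm_proj_le : ∀ x, ‖π (J x)‖ ≤ c
  monotone : Monotone K
  nonneg : ∀ r, 0 ≤ K r
  norm_le : ∀ x, ‖J x‖ ≤ K ‖π x‖ * ‖x‖

variable {G : Submodule ℝ (H × H)} {γ c s t : ℝ} {J : H → H} {π : H →L[ℝ] V} {K : ℝ → ℝ}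
  {φ ψ : ℝ → H}

theorem IsStrongSol.mono {S S' : Set ℝ} (h : IsStrongSol G J φ S) (hS : S' ⊆ S) :
    IsStrongSol G J φ S' := fun t ht => h t (hS ht)

/-- The generator does not act on the `π` component, so `π φ` moves with speed at most `c` and stays
within `‖π (φ s)‖ + c |t - s|`. On this range `K` is bounded, and the energy inequality closes with
the constant `γ + K`. -/
theorem IsStrongSol.norm_le (hφ : IsStrongSol G J φ (uIcc s t)) (hG : QuasiSkew G γ)
    (hπ : ∀ x z, (x, z) ∈ G → π z = 0) (hJ : LinearGrowth J π c K) :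
    ‖φ t‖ ≤ Real.exp ((γ + K (‖π (φ s)‖ + c * |t - s|)) * |t - s|) * ‖φ s‖ := by
  choose! z hz hd using hφ
  have hc : 0 ≤ c := (norm_nonneg _).trans (hJ.norm_proj_le 0)
  have hp : ∀ r ∈ uIcc s t, ‖π (φ r)‖ ≤ ‖π (φ s)‖ + c * |t - s| := by
    intro r hr
    have h1 := (convex_uIcc s t).norm_image_sub_le_of_norm_hasDerivWithin_le
      (f := fun r => π (φ r)) (f' := fun r => π (z r + J (φ r))) (C := c)
      (fun r hr => (π.hasFDerivAt.comp_hasDerivAt r (hd r hr)).hasDerivWithinAt)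
      (fun r hr => by rw [map_add, hπ _ _ (hz r hr), zero_add]; exact hJ.norm_proj_le _)
      left_mem_uIcc hr
    have h2 : ‖r - s‖ ≤ |t - s| := abs_sub_left_of_mem_uIcc hr
    have h3 := norm_sub_norm_le (π (φ r)) (π (φ s))
    have h4 := mul_le_mul_of_nonneg_left h2 hc
    linarith
  refine norm_le_exp_mul_norm hd fun r hr => ?_
  rw [inner_add_right]
  calc _ ≤ |inner ℝ (φ r) (z r)| + |inner ℝ (φ r) (J (φ r))| := abs_add_le _ _
    _ ≤ γ * ‖φ r‖ ^ 2 + ‖φ r‖ * (K (‖π (φ s)‖ + c * |t - s|) * ‖φ r‖) := by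
        gcongr
        · exact hG _ _ (hz r hr)
        · refine (abs_real_inner_le_norm _ _).trans ?_
          gcongr
          refine (hJ.norm_le _).trans ?_
          gcongr
          exact hJ.monotone (hp r hr)
    _ = _ := by ring

/-- The difference of the two solutions satisfies an energy inequality: the linear part contributes
`γ` and the nonlinear part its Lipschitz constant on the ball containing both orbits. -/
theorem IsStrongSol.norm_sub_le (hφ : IsStrongSol G J φ (uIcc s t))
    (hψ : IsStrongSol G J ψ (uIcc s t)) (hG : QuasiSkew G γ) {R : ℝ} {L : ℝ≥0}
    (hJ : LipschitzOnWith L J (Metric.closedBall 0 R)) (hφR : ∀ r ∈ uIcc s t, ‖φ r‖ ≤ R)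
    (hψR : ∀ r ∈ uIcc s t, ‖ψ r‖ ≤ R) :
    ‖φ t - ψ t‖ ≤ Real.exp ((γ + L) * |t - s|) * ‖φ s - ψ s‖ := by
  choose! z hz hd using hφ
  choose! z' hz' hd' using hψ
  refine norm_le_exp_mul_norm (u := fun r => φ r - ψ r)
    (fun r hr => (hd r hr).sub (hd' r hr)) fun r hr => ?_
  have h1 : |inner ℝ (φ r - ψ r) (z r - z' r)| ≤ γ * ‖φ r - ψ r‖ ^ 2 :=
    hG _ _ (G.sub_mem (hz r hr) (hz' r hr))
  have h2 := hJ.norm_sub_le (mem_closedBall_zero_iff.2 (hφR r hr))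
    (mem_closedBall_zero_iff.2 (hψR r hr))
  rw [show z r + J (φ r) - (z' r + J (ψ r)) = z r - z' r + (J (φ r) - J (ψ r)) by abel,
    inner_add_right]
  calc _ ≤ |inner ℝ (φ r - ψ r) (z r - z' r)| + |inner ℝ (φ r - ψ r) (J (φ r) - J (ψ r))| :=
        abs_add_le _ _
    _ ≤ γ * ‖φ r - ψ r‖ ^ 2 + ‖φ r - ψ r‖ * (L * ‖φ r - ψ r‖) := by
        exact add_le_add h1 ((abs_real_inner_le_norm _ _).trans (by gcongr))
    _ = _ := by ring

theorem IsStrongSol.continuousOn {S : Set ℝ} (hφ : IsStrongSol G J φ S) : ContinuousOn φ S :=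
  fun t ht => (hφ t ht).choose_spec.2.continuousAt.continuousWithinAt

theorem IsStrongSol.eq_of_eq (hφ : IsStrongSol G J φ (uIcc s t))
    (hψ : IsStrongSol G J ψ (uIcc s t)) (hG : QuasiSkew G γ)
    (hJ : ∀ R : ℝ, ∃ L, LipschitzOnWith L J (Metric.closedBall 0 R)) (h : φ s = ψ s) :
    φ t = ψ t := by
  obtain ⟨R₁, h1⟩ := isCompact_uIcc.exists_bound_of_continuousOn hφ.continuousOn
  obtain ⟨R₂, h2⟩ := isCompact_uIcc.exists_bound_of_continuousOn hψ.continuousOn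
  obtain ⟨L, hL⟩ := hJ (max R₁ R₂)
  have := hφ.norm_sub_le hψ hG hL (fun r hr => (h1 r hr).trans (le_max_left _ _))
    (fun r hr => (h2 r hr).trans (le_max_right _ _))
  rw [h, sub_self, norm_zero, mul_zero] at this
  exact sub_eq_zero.1 (norm_le_zero_iff.1 this)

/-- Radial retraction onto the closed ball of radius `R`. -/
noncomputable def retract (R : ℝ) (x : H) : H := (R / max R ‖x‖) • x

theorem norm_retract_le {R : ℝ} (hR : 0 < R) (x : H) : ‖retract R x‖ ≤ R := by
  have h1 : 0 < max R ‖x‖ := lt_max_of_lt_left hR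
  rw [retract, norm_smul, Real.norm_of_nonneg (by positivity), div_mul_eq_mul_div, div_le_iff₀ h1]
  gcongr
  exact le_max_right _ _

theorem retract_of_norm_le {R : ℝ} (hR : 0 < R) {x : H} (hx : ‖x‖ ≤ R) : retract R x = x := by
  rw [retract, max_eq_left hx, div_self hR.ne', one_smul]

theorem norm_map_retract_le {R : ℝ} (hR : 0 < R) (L : H →L[ℝ] V) (x : H) :
    ‖L (retract R x)‖ ≤ ‖L x‖ := by
  have h1 : 0 < max R ‖x‖ := lt_max_of_lt_left hR
  rw [retract, map_smul, norm_smul, Real.norm_of_nonneg (by positivity)]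
  exact mul_le_of_le_one_left (norm_nonneg _) ((div_le_one h1).2 (le_max_left _ _))

/-- In a Hilbert space the sharp constant is one; splitting off the difference of the two scaling
factors gives two, which suffices for truncation. -/
theorem norm_retract_sub_le {R : ℝ} (hR : 0 < R) (x y : H) :
    ‖retract R x - retract R y‖ ≤ 2 * ‖x - y‖ := by
  set a := max R ‖x‖ with ha
  set b := max R ‖y‖ with hb
  have ha0 : 0 < a := lt_max_of_lt_left hR
  have hb0 : 0 < b := lt_max_of_lt_left hR
  have hab : |b - a| ≤ ‖x - y‖ := by
    rw [ha, hb, abs_sub_comm]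
    exact (abs_max_sub_max_le_abs ‖x‖ ‖y‖ R |>.trans (abs_norm_sub_norm_le x y) |> fun h => by
      simpa only [max_comm] using h)
  have e : retract R x - retract R y = (R / a) • (x - y) + ((b - a) * (R / a) / b) • y := by
    rw [retract, retract, smul_sub, show (b - a) * (R / a) / b = R / a - R / b by field_simp,
      sub_smul]
    abel
  have h1 : R / a ≤ 1 := (div_le_one ha0).2 (le_max_left _ _)
  have h2 : ‖y‖ / b ≤ 1 := (div_le_one hb0).2 (le_max_right _ _)
  rw [e]
  refine (norm_add_le _ _).trans ?_
  rw [norm_smul, norm_smul, Real.norm_eq_abs, Real.norm_eq_abs, abs_div ((b - a) * (R / a)), abs_mul,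
    abs_of_nonneg (div_nonneg hR.le ha0.le), abs_of_pos hb0]
  calc _ = (R / a) * ‖x - y‖ + |b - a| * (R / a) * (‖y‖ / b) := by ring
    _ ≤ 1 * ‖x - y‖ + ‖x - y‖ * 1 * 1 := by gcongr
    _ = _ := by ring

/-- The retraction shrinks both `x` and `π x`, so truncating `J` keeps the same `c` and `K`. The a
priori bound for the truncated equation is therefore independent of the truncation radius. -/
theorem LinearGrowth.comp_retract {R : ℝ} (hR : 0 < R) (hJ : LinearGrowth J π c K) :
    LinearGrowth (fun x => J (retract R x)) π c K where
  norm_proj_le x := hJ.norm_proj_le _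
  monotone := hJ.monotone
  nonneg := hJ.nonneg
  norm_le x := by
    refine (hJ.norm_le _).trans ?_
    have h1 := hJ.monotone (norm_map_retract_le hR π x)
    have h2 : ‖retract R x‖ ≤ ‖x‖ := norm_map_retract_le hR (ContinuousLinearMap.id ℝ H) x
    have := hJ.nonneg ‖π x‖
    gcongr

variable [CompleteSpace H] {W : C0Group H γ} {AJ : H → H} {x y : H}

/-- In the moving frame `u t = W (-t) (φ t)` the unbounded generator disappears: `u' = W (-t) (F (W
t u))` is an ordinary differential equation with a bounded, Lipschitz right side, so Picard–Lindelöf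
covers the whole interval at once. The values of `F` lie in the domain, which turns the mild
solution into a strong one. -/
theorem exists_isStrongSol_of_bounded (hγ : 0 ≤ γ) (hW : W.Generates G)
    (hG : IsClosed (G : Set (H × H))) {F AF : H → H} {L : ℝ≥0} (hF : LipschitzWith L F)
    {M : ℝ≥0} (hM : ∀ x, ‖F x‖ ≤ M) (hAF : Continuous AF) (hFG : ∀ x, (F x, AF x) ∈ G)
    (hxy : (x, y) ∈ G) (T : ℝ≥0) :
    ∃ φ : ℝ → H, φ 0 = x ∧ IsStrongSol G F φ (Icc (-T) T) := by
  let E : ℝ≥0 := (Real.exp (γ * T)).toNNReal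
  have hE : (E : ℝ) = Real.exp (γ * T) := Real.coe_toNNReal _ (Real.exp_pos _).le
  have hWE : ∀ t : ℝ, |t| ≤ T → ∀ z, ‖W t z‖ ≤ E * ‖z‖ := fun t ht z =>
    (W.norm_le t z).trans (by rw [hE]; gcongr)
  have hT : -(T : ℝ) ≤ T := by linarith [T.2]
  have h0 : (0 : ℝ) ∈ Icc (-(T : ℝ)) T := ⟨by linarith [T.2], T.2⟩
  let f : ℝ → H → H := fun t u => W (-t) (F (W t u))
  -- With `E` bounding the group on `[-T, T]`, the field has size at most `E M`, so a curve cannot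
  -- leave the ball of radius `E M T` in time `T`.
  have hpl : IsPicardLindelof f (⟨0, h0⟩ : Icc (-(T : ℝ)) T) x (E * M * T) 0 (E * M)
      (E * L * E) := by
    refine ⟨fun t ht => LipschitzOnWith.of_dist_le_mul fun u _ v _ => ?_, fun u _ => ?_,
      fun t ht u _ => ?_, ?_⟩
    · have ht' : |t| ≤ T := abs_le.2 ht
      simp only [f, dist_eq_norm, ← map_sub]
      have h1 := hWE (-t) (by rwa [abs_neg]) (F (W t u) - F (W t v))
      have h2 := hF.norm_sub_le (W t u) (W t v)
      have h3 := hWE t ht' (u - v)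
      rw [map_sub] at h3
      push_cast
      calc _ ≤ (E : ℝ) * ‖F (W t u) - F (W t v)‖ := h1
        _ ≤ E * (L * (E * ‖u - v‖)) := by gcongr; exact h2.trans (by gcongr)
        _ = _ := by ring
    · exact (W.continuous_comp continuous_neg (hF.continuous.comp (W.continuous u))).continuousOn
    · have ht' : |-t| ≤ T := by rw [abs_neg]; exact abs_le.2 ht
      refine (hWE (-t) ht' _).trans ?_
      push_cast
      gcongr
      exact hM _
    · simp
  obtain ⟨u, hu0, hu⟩ := hpl.exists_eq_forall_mem_Icc_hasDerivWithinAt₀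
  have huc : ContinuousOn u (Icc (-T) T) := fun t ht => (hu t ht).continuousWithinAt
  -- Clamping time extends the curve to a continuous one on the whole line, so that it can serve as
  -- the source of a Duhamel formula; nothing changes inside the interval.
  let τ : ℝ → ℝ := fun t => projIcc _ _ hT t
  have hτ : Continuous τ := continuous_subtype_val.comp continuous_projIcc
  have hτm : ∀ t, τ t ∈ Icc (-(T : ℝ)) T := fun t => (projIcc _ _ hT t).2
  have hτe : ∀ t ∈ Icc (-(T : ℝ)) T, τ t = t := fun t ht => by simp [τ, projIcc_of_mem hT ht]
  let v : ℝ → H := fun t => W (τ t) (u (τ t))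
  have hv : Continuous v := W.continuous_comp hτ (huc.comp_continuous hτ hτm)
  have hφv : ∀ t ∈ Icc (-(T : ℝ)) T, W.forced x (fun s => F (v s)) t = v t := by
    intro t ht
    have hsub : uIcc 0 t ⊆ Icc (-(T : ℝ)) T := (convex_Icc _ _).ordConnected.uIcc_subset h0 ht
    have h1 : ∫ s in (0 : ℝ)..t, W (-s) (F (v s)) = u t - u 0 := by
      refine intervalIntegral.integral_eq_sub_of_hasDeriv_right (huc.mono hsub) (fun s hs => ?_)
        ((W.continuous_comp continuous_neg (hF.continuous.comp hv)).intervalIntegrable _ _)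
      have hs' := hsub (Ioo_subset_Icc_self hs)
      have h2 := hu s hs'
      have hn : Icc (-(T : ℝ)) T ∈ 𝓝 s := mem_of_superset (isOpen_Ioo.mem_nhds hs)
        (Ioo_subset_Icc_self.trans hsub)
      have h3 := (h2.hasDerivAt hn).hasDerivWithinAt (s := Ioi s)
      simpa only [f, v, hτe s hs'] using h3
    rw [C0Group.forced, h1, hu0]
    simp only [v, hτe t ht]
    congr 1
    abel
  refine ⟨W.forced x (fun s => F (v s)), W.forced_zero _ _, fun t ht =>
    ⟨W.forced y (fun s => AF (v s)) t, hW.forced_mem hG (hF.continuous.comp hv) (hAF.comp hv)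
      (fun s => hFG _) hxy t, ?_⟩⟩
  have := hW.hasDerivAt_forced hG (hF.continuous.comp hv) (hAF.comp hv) (fun s => hFG _) hxy t
  rwa [hφv t ht]

theorem exists_isStrongSol_Icc (hγ : 0 ≤ γ) (hW : W.Generates G)
    (hG : IsClosed (G : Set (H × H))) (hskew : QuasiSkew G γ)
    (hπ : ∀ x z, (x, z) ∈ G → π z = 0) (hJ : LinearGrowth J π c K)
    (hLip : ∀ R : ℝ, ∃ L, LipschitzOnWith L J (Metric.closedBall 0 R))
    (hAJ : Continuous AJ) (hJG : ∀ x, (J x, AJ x) ∈ G) (hxy : (x, y) ∈ G) (T : ℝ≥0) :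
    ∃ φ : ℝ → H, φ 0 = x ∧ IsStrongSol G J φ (Icc (-T) T) := by
  have hc : 0 ≤ c := (norm_nonneg _).trans (hJ.norm_proj_le 0)
  -- The radius is the a priori bound up to time `T`, plus one to make it positive. The truncated
  -- solution obeys that bound, so it never meets the truncation and solves the original equation.
  set R : ℝ := Real.exp ((γ + K (‖π x‖ + c * T)) * T) * ‖x‖ + 1 with hRdef
  have hR : 0 < R := by positivity
  obtain ⟨L, hL⟩ := hLip R
  have hmem : ∀ z : H, retract R z ∈ Metric.closedBall (0 : H) R := fun z =>
    mem_closedBall_zero_iff.2 (norm_retract_le hR z)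
  have hF : LipschitzWith (L * 2) (fun z => J (retract R z)) :=
    LipschitzWith.of_dist_le_mul fun u v => by
      rw [dist_eq_norm, dist_eq_norm]
      refine (hL.norm_sub_le (hmem u) (hmem v)).trans ?_
      have := norm_retract_sub_le hR u v
      push_cast
      rw [mul_assoc]
      gcongr
  have hrc : Continuous (retract R : H → H) :=
    (LipschitzWith.of_dist_le_mul (K := 2) fun u v => by
      rw [dist_eq_norm, dist_eq_norm]; exact norm_retract_sub_le hR u v).continuous
  have hb : ∀ z, ‖J (retract R z)‖ ≤ ((K (‖π‖ * R) * R).toNNReal : ℝ≥0) := by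
    intro z
    have h0 := hJ.nonneg (‖π‖ * R)
    rw [Real.coe_toNNReal _ (by positivity)]
    refine (hJ.norm_le _).trans ?_
    have h1 : ‖π (retract R z)‖ ≤ ‖π‖ * R :=
      (π.le_opNorm _).trans (by gcongr; exact norm_retract_le hR z)
    have h2 := hJ.monotone h1
    have h3 := norm_retract_le hR z
    gcongr
  obtain ⟨φ, h0, hφ⟩ := exists_isStrongSol_of_bounded hγ hW hG hF hb (hAJ.comp hrc)
    (fun z => hJG _) hxy T
  refine ⟨φ, h0, fun t ht => ?_⟩
  have hT : (0 : ℝ) ∈ Icc (-(T : ℝ)) T := ⟨by linarith [T.2], T.2⟩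
  have hn := (hφ.mono ((convex_Icc _ _).ordConnected.uIcc_subset hT ht)).norm_le hskew hπ
    (hJ.comp_retract hR)
  have ht' : |t| ≤ T := abs_le.2 ht
  have hle : ‖φ t‖ ≤ R := by
    rw [sub_zero, h0] at hn
    refine hn.trans (le_trans ?_ (lt_add_one _).le)
    have h1 : K (‖π x‖ + c * |t|) ≤ K (‖π x‖ + c * T) := hJ.monotone (by gcongr)
    have h2 := hJ.nonneg (‖π x‖ + c * T)
    gcongr
  simpa only [retract_of_norm_le hR hle] using hφ t ht

/-- Global existence for semilinear evolution equations. -/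
theorem exists_isStrongSol (hγ : 0 ≤ γ) (hW : W.Generates G)
    (hG : IsClosed (G : Set (H × H))) (hskew : QuasiSkew G γ)
    (hπ : ∀ x z, (x, z) ∈ G → π z = 0) (hJ : LinearGrowth J π c K)
    (hLip : ∀ R : ℝ, ∃ L, LipschitzOnWith L J (Metric.closedBall 0 R))
    (hAJ : Continuous AJ) (hJG : ∀ x, (J x, AJ x) ∈ G) (hxy : (x, y) ∈ G) :
    ∃ φ : ℝ → H, φ 0 = x ∧ IsStrongSol G J φ univ := by
  choose φ h0 hφ using fun n : ℕ =>
    exists_isStrongSol_Icc hγ hW hG hskew hπ hJ hLip hAJ hJG hxy n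
  have hmem : ∀ {n : ℕ} {t : ℝ}, |t| ≤ n → t ∈ Icc (-((n : ℝ≥0) : ℝ)) ((n : ℝ≥0) : ℝ) :=
    fun h => by simpa using abs_le.1 h
  have heq : ∀ {m n : ℕ} {t : ℝ}, |t| ≤ m → m ≤ n → φ m t = φ n t := by
    intro m n t ht hmn
    have htn : |t| ≤ n := ht.trans (by exact_mod_cast hmn)
    have hz : ∀ k : ℕ, |(0 : ℝ)| ≤ k := fun k => by simp
    exact ((hφ m).mono ((convex_Icc _ _).ordConnected.uIcc_subset (hmem (hz m)) (hmem ht))).eq_of_eq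
      ((hφ n).mono ((convex_Icc _ _).ordConnected.uIcc_subset (hmem (hz n)) (hmem htn))) hskew hLip
      ((h0 m).trans (h0 n).symm)
  -- By uniqueness the solutions on `[-n, n]` agree where they overlap. Near `t` the glued curve is
  -- compared with index `⌈|t|⌉₊ + 1`, which makes `t` an interior point.
  refine ⟨fun t => φ ⌈|t|⌉₊ t, by simpa using h0 0, fun t _ => ?_⟩
  have hloc : ∀ s : ℝ, |s| < ⌈|t|⌉₊ + 1 → φ ⌈|s|⌉₊ s = φ (⌈|t|⌉₊ + 1) s := fun s hs =>
    heq (Nat.le_ceil _) (Nat.ceil_le.2 (by push_cast; exact hs.le))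
  have ht : |t| < ⌈|t|⌉₊ + 1 := (Nat.le_ceil _).trans_lt (lt_add_one _)
  obtain ⟨z, hz, hd⟩ := hφ (⌈|t|⌉₊ + 1) t (hmem (by push_cast; exact ht.le))
  simp only [hloc t ht]
  refine ⟨z, hz, hd.congr_of_eventuallyEq ?_⟩
  filter_upwards [continuous_abs.continuousAt.eventually_lt continuousAt_const ht] with s hs
  exact hloc s hs

/-- The orbit of a point in the domain of the `n`-th power of the generator is `n` times
continuously differentiable. -/
theorem IsStrongSol.exists_chain (hW : W.Generates G) (hG : IsClosed (G : Set (H × H)))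
    (hskew : QuasiSkew G γ) {n : ℕ} (hn : 1 ≤ n) {x : ℕ → H}
    (hx : ∀ k < n, (x k, x (k + 1)) ∈ G) {Jc : ℕ → H → H} (hsm : ∀ k, ContDiff ℝ ∞ (Jc k))
    (hJc : ∀ k u, (Jc k u, Jc (k + 1) u) ∈ G) {φ : ℝ → H} (h0 : φ 0 = x 0)
    (hφ : IsStrongSol G (Jc 0) φ univ) :
    ∃ Φ : ℕ → ℝ → H, Φ 0 = φ ∧ (∀ k < n, ∀ t, (Φ k t, Φ (k + 1) t) ∈ G) ∧
      ∀ j k, k + j ≤ n → ContDiff ℝ j (Φ k) := by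
  have hφc : Continuous φ := continuousOn_univ.1 hφ.continuousOn
  have hf : ∀ k, Continuous fun s => Jc k (φ s) := fun k => (hsm k).continuous.comp hφc
  -- The candidate for the image of `φ` under the `k`-th power of the generator: apply that power to
  -- the data and to the source in Duhamel's formula.
  let Φ : ℕ → ℝ → H := fun k => W.forced (x k) (fun s => Jc k (φ s))
  have hmem : ∀ k < n, ∀ t, (Φ k t, Φ (k + 1) t) ∈ G := fun k hk t =>
    hW.forced_mem hG (hf k) (hf (k + 1)) (fun s => hJc k _) (hx k hk) t
  have hd : ∀ k < n, ∀ t, HasDerivAt (Φ k) (Φ (k + 1) t + Jc k (φ t)) t := fun k hk t =>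
    hW.hasDerivAt_forced hG (hf k) (hf (k + 1)) (fun s => hJc k _) (hx k hk) t
  -- The difference of the two curves solves the homogeneous linear equation with value zero at time
  -- `0`, so quasi-skewness makes it vanish.
  have hΦ0 : Φ 0 = φ := by
    choose! z hz hφd using hφ
    funext t
    have := norm_le_exp_mul_norm (u := fun r => Φ 0 r - φ r) (s := 0) (t := t) (K := γ)
      (fun r _ => (hd 0 hn r).sub (hφd r (mem_univ r))) (fun r _ => by
        rw [show Φ (0 + 1) r + Jc 0 (φ r) - (z r + Jc 0 (φ r)) = Φ 1 r - z r by
          rw [zero_add]; abel]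
        exact hskew _ _ (G.sub_mem (hmem 0 hn r) (hz r (mem_univ r))))
    have e : Φ 0 0 = x 0 := W.forced_zero _ _
    rw [e, h0, sub_self, norm_zero, mul_zero] at this
    exact sub_eq_zero.1 (norm_le_zero_iff.1 this)
  -- Since `Φ k' = Φ (k + 1) + Jc k ∘ Φ 0`, one more derivative of `Φ k` costs one step up the
  -- chain, which explains the condition `k + j ≤ n`.
  refine ⟨Φ, hΦ0, hmem, fun j => ?_⟩
  induction j with
  | zero => exact fun k _ => contDiff_zero.2 (W.continuous_forced (hf k))
  | succ j ih =>
    intro k hk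
    have hkn : k < n := by omega
    push_cast
    refine contDiff_succ_iff_deriv.2 ⟨fun t => (hd k hkn t).differentiableAt, by simp, ?_⟩
    have e : deriv (Φ k) = fun t => Φ (k + 1) t + Jc k (φ t) := funext fun t => (hd k hkn t).deriv
    rw [e, ← hΦ0]
    exact (ih (k + 1) (by omega)).add
      (((hsm k).of_le (by exact_mod_cast le_top)).comp (ih 0 (by omega)))

/-- Difference quotients of a curve in `G` lie in `G` by linearity, and so do their limits by
closedness; then iterate. -/
theorem iteratedDeriv_mem_graph {E : Type*} [NormedAddCommGroup E] [NormedSpace ℝ E]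
    {G : Submodule ℝ (E × E)} (hG : IsClosed (G : Set (E × E))) (j : ℕ) :
    ∀ {f g : ℝ → E}, ContDiff ℝ j f → ContDiff ℝ j g → (∀ t, (f t, g t) ∈ G) →
      ∀ t, (iteratedDeriv j f t, iteratedDeriv j g t) ∈ G := by
  induction j with
  | zero => intro f g _ _ h t; simpa using h t
  | succ j ih =>
    intro f g hf hg h
    rw [iteratedDeriv_succ', iteratedDeriv_succ']
    push_cast at hf hg
    rw [contDiff_succ_iff_deriv] at hf hg
    refine ih hf.2.2 hg.2.2 fun t => ?_
    have hd := (hf.1 t).hasDerivAt.prodMk (hg.1 t).hasDerivAt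
    exact hG.mem_of_tendsto (hasDerivAt_iff_tendsto_slope.1 hd)
      (Eventually.of_forall fun s => by
        rw [slope_def_module]
        exact G.smul_mem _ (G.sub_mem (h s) (h t)))

end Semilinear

end Evolution

namespace MaxwellLorentz

open Filter Topology Set

/-! ### Weighted `L²`: test functions, translations -/

section Weighted

variable {w : Weight}

theorem Weight.continuous (w : Weight) : Continuous (w : E3 → ℝ) := w.contDiff.continuous

theorem ae_measure_iff {p : E3 → Prop} : (∀ᵐ x ∂w.measure, p x) ↔ ∀ᵐ x, p x :=
  ⟨fun h => (volume_absolutelyContinuous w).ae_le h,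
    fun h => (withDensity_absolutelyContinuous _ _).ae_le h⟩

theorem integral_measure (F : E3 → ℝ) : ∫ x, F x ∂w.measure = ∫ x, w x * F x := by
  rw [Weight.measure, integral_withDensity_eq_integral_toReal_smul
    w.continuous.measurable.ennreal_ofReal (Eventually.of_forall fun x => ENNReal.ofReal_lt_top)]
  simp only [ENNReal.toReal_ofReal (w.pos _).le, smul_eq_mul]

theorem inner_eq_integral (f g : L2w w) :
    inner ℝ f g = ∫ x, w x * inner ℝ ((f : E3 → E3) x) ((g : E3 → E3) x) := by
  rw [L2.inner_def, integral_measure]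

open Classical in
/-- The class of a square integrable function (`0` for other functions). -/
noncomputable def ofFun (w : Weight) (F : E3 → E3) : L2w w :=
  if h : MemLp F 2 w.measure then h.toLp F else 0

theorem coeFn_ofFun {F : E3 → E3} (h : MemLp F 2 w.measure) : ofFun w F =ᵐ[volume] F := by
  rw [ofFun, dif_pos h]
  exact ae_measure_iff.1 h.coeFn_toLp

/-- Smooth vector fields with compact support. -/
structure IsTestField (g : E3 → E3) : Prop where
  contDiff : ContDiff ℝ ∞ g
  hasCompactSupport : HasCompactSupport g

theorem memLp_of_continuous {F : E3 → E3} (h : Continuous F) (hc : HasCompactSupport F) :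
    MemLp F 2 w.measure := h.memLp_of_hasCompactSupport hc

theorem memLp_smul_translate {a : E3 → ℝ} (ha : Continuous a) {g : E3 → E3} (hg : Continuous g)
    (hc : HasCompactSupport g) (q : E3) :
    MemLp (fun x => a x • g (x - q)) 2 w.measure :=
  memLp_of_continuous (by fun_prop)
    ((hc.comp_homeomorph (Homeomorph.subRight q)).smul_left (f := a))

/-- The functional `f ↦ ∫ f · ψ`. -/
noncomputable def pair (w : Weight) (ψ : E3 → E3) : L2w w →L[ℝ] ℝ :=
  innerSL ℝ (ofFun w fun x => (w x)⁻¹ • ψ x)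

theorem Weight.continuous_inv (w : Weight) : Continuous fun x => (w x)⁻¹ :=
  w.continuous.inv₀ fun x => (w.pos x).ne'

/-- Dividing the test field by `w` cancels the weight, so unweighted distributional pairings become
continuous functionals on `L²_w`. A shift of the test field is a shift of the representing vector.
-/
theorem inner_ofFun_inv {ψ : E3 → E3} (h : Continuous ψ) (hc : HasCompactSupport ψ) (q : E3)
    (f : L2w w) : inner ℝ (ofFun w fun x => (w x)⁻¹ • ψ (x - q)) f =
      ∫ x, inner ℝ ((f : E3 → E3) x) (ψ (x - q)) := by
  rw [inner_eq_integral]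
  refine integral_congr_ae ?_
  filter_upwards [coeFn_ofFun (memLp_smul_translate w.continuous_inv h hc q)] with x hx
  rw [hx, real_inner_smul_left, real_inner_comm, ← mul_assoc, mul_inv_cancel₀ (w.pos x).ne',
    one_mul]

theorem pair_apply {ψ : E3 → E3} (h : Continuous ψ) (hc : HasCompactSupport ψ) (f : L2w w) :
    pair w ψ f = ∫ x, inner ℝ ((f : E3 → E3) x) (ψ x) := by
  simpa [pair] using inner_ofFun_inv h hc 0 f

/-! #### Translations -/

/-- Pushing `w(x) dx` forward under `x ↦ x - z` gives `w(x + z) dx`. This is how the growth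
condition on the weight becomes boundedness of translations. -/
theorem map_sub_measure_le {c : ℝ} {z : E3} (hc : ∀ x, w (x + z) ≤ c * w x) :
    w.measure.map (fun x => x - z) ≤ ENNReal.ofReal c • w.measure := by
  have hc0 : 0 ≤ c := by
    by_contra! h
    exact absurd (hc 0) (not_le.2 ((mul_neg_of_neg_of_pos h (w.pos 0)).trans (w.pos _)))
  have hm : Measurable fun x : E3 => x - z := measurable_id.sub_const z
  refine Measure.le_iff.2 fun s hs => ?_
  rw [Measure.map_apply hm hs, Measure.smul_apply, Weight.measure, withDensity_apply _ (hm hs),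
    withDensity_apply _ hs, smul_eq_mul, ← lintegral_const_mul _
      w.continuous.measurable.ennreal_ofReal]
  have h1 := (measurePreserving_sub_right (volume : Measure E3) z).setLIntegral_comp_preimage hs
    (f := fun x => ENNReal.ofReal (w (x + z)))
    (w.continuous.measurable.ennreal_ofReal.comp (measurable_id.add_const z))
  simp only [sub_add_cancel] at h1
  rw [h1]
  refine lintegral_mono fun x => ?_
  rw [← ENNReal.ofReal_mul hc0]
  exact ENNReal.ofReal_le_ofReal (hc x)

theorem eLpNorm_translate_le {E : Type*} [NormedAddCommGroup E] {f : E3 → E}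
    (hf : AEStronglyMeasurable f w.measure) {c : ℝ} {z : E3} (hc : ∀ x, w (x + z) ≤ c * w x) :
    eLpNorm (fun x => f (x - z)) 2 w.measure ≤ ENNReal.ofReal (√c) * eLpNorm f 2 w.measure := by
  have hc0 : 0 ≤ c := by
    by_contra! h
    exact absurd (hc 0) (not_le.2 ((mul_neg_of_neg_of_pos h (w.pos 0)).trans (w.pos _)))
  have hle := map_sub_measure_le hc
  have hf' : AEStronglyMeasurable f (w.measure.map (fun x => x - z)) :=
    (hf.smul_measure _).mono_measure hle
  have h1 := eLpNorm_map_measure (p := 2) hf' (measurable_id.sub_const z).aemeasurable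
  have h2 : eLpNorm (fun x => f (x - z)) 2 w.measure =
      eLpNorm f 2 (w.measure.map (fun x => x - z)) := h1.symm
  rw [h2]
  refine (eLpNorm_mono_measure f hle).trans ?_
  rw [eLpNorm_smul_measure_of_ne_top (by norm_num), Real.sqrt_eq_rpow,
    ← ENNReal.ofReal_rpow_of_nonneg hc0 (by norm_num)]
  simp

/-- The growth factor `(1 + C ‖z‖) ^ P` of the weight. -/
noncomputable def Weight.factor (w : Weight) (r : ℝ) : ℝ :=
  (1 + w.growth.choose * r) ^ w.growth.choose_spec.2.choose

theorem Weight.le_factor (w : Weight) (x z : E3) : w (x + z) ≤ w.factor ‖z‖ * w x :=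
  w.growth.choose_spec.2.choose_spec x z

theorem Weight.factor_mono (w : Weight) {r s : ℝ} (hr : 0 ≤ r) (h : r ≤ s) :
    w.factor r ≤ w.factor s := by
  have := w.growth.choose_spec.1
  unfold Weight.factor
  gcongr

theorem Weight.continuous_factor (w : Weight) : Continuous w.factor := by
  unfold Weight.factor
  fun_prop

theorem Weight.one_le_factor (w : Weight) {r : ℝ} (hr : 0 ≤ r) : 1 ≤ w.factor r :=
  one_le_pow₀ (by have := w.growth.choose_spec.1; nlinarith)

theorem memLp_translate (f : L2w w) (z : E3) :
    MemLp (fun x => (f : E3 → E3) (x - z)) 2 w.measure := by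
  have h1 := Lp.memLp f
  refine ⟨?_, (eLpNorm_translate_le h1.1 fun x => w.le_factor x z).trans_lt
    (ENNReal.mul_lt_top ENNReal.ofReal_lt_top h1.2)⟩
  refine AEStronglyMeasurable.comp_quasiMeasurePreserving h1.1 ⟨measurable_id.sub_const z, ?_⟩
  exact (Measure.absolutelyContinuous_of_le (map_sub_measure_le fun x => w.le_factor x z)).trans
    (Measure.AbsolutelyContinuous.rfl.smul_left _)

theorem ae_translate {p : E3 → Prop} (h : ∀ᵐ x, p x) (z : E3) : ∀ᵐ x, p (x - z) :=
  (measurePreserving_sub_right (volume : Measure E3) z).quasiMeasurePreserving.ae h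

/-- Translation by `z` on `L²_w`. -/
noncomputable def trans (w : Weight) (z : E3) : L2w w →L[ℝ] L2w w :=
  LinearMap.mkContinuous
    { toFun := fun f => (memLp_translate f z).toLp _
      map_add' := fun f g => by
        rw [← MemLp.toLp_add, MemLp.toLp_eq_toLp_iff]
        exact ae_measure_iff.2 (ae_translate (ae_measure_iff.1 (Lp.coeFn_add f g)) z)
      map_smul' := fun c f => by
        rw [RingHom.id_apply, ← MemLp.toLp_const_smul, MemLp.toLp_eq_toLp_iff]
        exact ae_measure_iff.2 (ae_translate (ae_measure_iff.1 (Lp.coeFn_smul c f)) z) }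
    (√(w.factor ‖z‖)) fun f => by
      have h := eLpNorm_translate_le (Lp.memLp f).1 fun x => w.le_factor x z
      rw [LinearMap.coe_mk, AddHom.coe_mk, Lp.norm_toLp, Lp.norm_def]
      refine (ENNReal.toReal_mono (ENNReal.mul_ne_top ENNReal.ofReal_ne_top
        (Lp.eLpNorm_ne_top f)) h).trans_eq ?_
      rw [ENNReal.toReal_mul, ENNReal.toReal_ofReal (Real.sqrt_nonneg _)]

theorem coeFn_trans (z : E3) (f : L2w w) :
    trans w z f =ᵐ[volume] fun x => (f : E3 → E3) (x - z) :=
  ae_measure_iff.1 (memLp_translate f z).coeFn_toLp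

theorem norm_trans_le (z : E3) (f : L2w w) : ‖trans w z f‖ ≤ √(w.factor ‖z‖) * ‖f‖ :=
  LinearMap.mkContinuous_norm_le _ (Real.sqrt_nonneg _) _ |> fun h => (trans w z).le_of_opNorm_le h f

theorem L2w_ext {f g : L2w w} (h : f =ᵐ[volume] g) : f = g := Lp.ext (ae_measure_iff.2 h)

theorem trans_trans (y z : E3) (f : L2w w) : trans w y (trans w z f) = trans w (y + z) f := by
  refine L2w_ext ?_
  filter_upwards [coeFn_trans y (trans w z f), ae_translate (coeFn_trans z f) y,
    coeFn_trans (y + z) f] with x h1 h2 h3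
  rw [h1, h2, h3, sub_sub]

theorem trans_zero (f : L2w w) : trans w 0 f = f := by
  refine L2w_ext ?_
  filter_upwards [coeFn_trans 0 f] with x h
  rw [h, sub_zero]

/-- Pointwise application of a linear map. -/
noncomputable def lift (w : Weight) (L : E3 →L[ℝ] E3) : L2w w →L[ℝ] L2w w :=
  L.compLpL 2 w.measure

theorem coeFn_lift (L : E3 →L[ℝ] E3) (f : L2w w) :
    lift w L f =ᵐ[volume] fun x => L ((f : E3 → E3) x) :=
  ae_measure_iff.1 (L.coeFn_compLpL f)

theorem trans_lift (L : E3 →L[ℝ] E3) (z : E3) (f : L2w w) :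
    trans w z (lift w L f) = lift w L (trans w z f) := by
  refine L2w_ext ?_
  filter_upwards [coeFn_trans z (lift w L f), ae_translate (coeFn_lift L f) z, coeFn_trans z f,
    coeFn_lift L (trans w z f)] with x h1 h2 h3 h4
  rw [h1, h2, h4, h3]

theorem inner_lift {L L' : E3 →L[ℝ] E3} (h : ∀ a b, inner ℝ (L a) b = inner ℝ a (L' b))
    (f g : L2w w) : inner ℝ (lift w L f) g = inner ℝ f (lift w L' g) := by
  rw [inner_eq_integral, inner_eq_integral]
  refine integral_congr_ae ?_
  filter_upwards [coeFn_lift L f, coeFn_lift L' g] with x h1 h2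
  rw [h1, h2, h]

theorem norm_lift_le {L : E3 →L[ℝ] E3} {c : ℝ} (h : ∀ a, ‖L a‖ ≤ c * ‖a‖)
    (f : L2w w) : ‖lift w L f‖ ≤ c * ‖f‖ := by
  refine Lp.norm_le_mul_norm_of_ae_le_mul (ae_measure_iff.2 ?_)
  filter_upwards [coeFn_lift L f] with x h1
  rw [h1]
  exact h _

end Weighted

end MaxwellLorentz

namespace MaxwellLorentz

open Filter Topology Set

/-! ### Smooth dependence of translated fields on the shift -/

section Translates

variable {w : Weight}

theorem IsTestField.fderiv_apply {g : E3 → E3} (hg : IsTestField g) (h : E3) :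
    IsTestField fun x => fderiv ℝ g x h where
  contDiff := (hg.contDiff.fderiv_right (m := ∞) (by simp)).clm_apply contDiff_const
  hasCompactSupport := hg.hasCompactSupport.fderiv_apply ℝ h

/-- The field `x ↦ a(x) g(x - q)`. -/
noncomputable def translate (w : Weight) (a : E3 → ℝ) (g : E3 → E3) (q : E3) : L2w w :=
  ofFun w fun x => a x • g (x - q)

theorem coeFn_translate {a : E3 → ℝ} (ha : Continuous a) {g : E3 → E3} (hg : IsTestField g)
    (q : E3) : translate w a g q =ᵐ[volume] fun x => a x • g (x - q) :=
  coeFn_ofFun (memLp_smul_translate ha hg.contDiff.continuous hg.hasCompactSupport q)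

theorem norm_taylor_le {g : E3 → E3} (hg : IsTestField g) :
    ∃ M : ℝ, 0 ≤ M ∧ ∀ y h, ‖g (y + h) - g y - fderiv ℝ g y h‖ ≤ M * ‖h‖ ^ 2 := by
  have hd : ContDiff ℝ ∞ (fderiv ℝ g) := hg.contDiff.fderiv_right (by simp)
  obtain ⟨M, hM⟩ := hd.lipschitzWith_of_hasCompactSupport (hg.hasCompactSupport.fderiv ℝ) (by simp)
  refine ⟨M, M.2, fun y h => ?_⟩
  have h1 := (convex_segment y (y + h)).norm_image_sub_le_of_norm_hasFDerivWithin_le'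
    (f := g) (f' := fderiv ℝ g) (φ := fderiv ℝ g y) (C := M * ‖h‖)
    (fun x _ => ((hg.contDiff.differentiable (by simp)) x).hasFDerivAt.hasFDerivWithinAt)
    (fun x hx => by
      refine (hM.norm_sub_le x y).trans ?_
      have := norm_sub_le_of_mem_segment hx
      rw [add_sub_cancel_left] at this
      gcongr)
    (left_mem_segment ℝ _ _) (right_mem_segment ℝ _ _)
  rw [add_sub_cancel_left] at h1
  refine h1.trans_eq (by ring)

theorem translate_add {a : E3 → ℝ} (ha : Continuous a) {g g' : E3 → E3} (hg : IsTestField g)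
    (hg' : IsTestField g') (q : E3) :
    translate w a (fun x => g x + g' x) q = translate w a g q + translate w a g' q := by
  refine L2w_ext ?_
  filter_upwards [coeFn_translate (w := w) ha ⟨hg.1.add hg'.1, hg.2.add hg'.2⟩ q,
    coeFn_translate (w := w) ha hg q, coeFn_translate (w := w) ha hg' q,
    ae_measure_iff.1 (Lp.coeFn_add (translate w a g q) (translate w a g' q))] with x h1 h2 h3 h4
  rw [h1, h4, Pi.add_apply, h2, h3, smul_add]

theorem translate_smul {a : E3 → ℝ} (ha : Continuous a) {g : E3 → E3} (hg : IsTestField g)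
    (c : ℝ) (q : E3) : translate w a (fun x => c • g x) q = c • translate w a g q := by
  refine L2w_ext ?_
  filter_upwards [coeFn_translate (w := w) ha ⟨hg.1.const_smul c, hg.2.smul_left (f := fun _ => c)⟩ q,
    coeFn_translate (w := w) ha hg q,
    ae_measure_iff.1 (Lp.coeFn_smul c (translate w a g q))] with x h1 h2 h3
  rw [h1, h3, Pi.smul_apply, h2, smul_comm]

/-- The derivative of `q ↦ translate w a g q`. -/
noncomputable def translateDeriv (w : Weight) {a : E3 → ℝ} (ha : Continuous a) {g : E3 → E3}
    (hg : IsTestField g) (q : E3) : E3 →L[ℝ] L2w w :=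
  LinearMap.toContinuousLinearMap
    { toFun := fun h => -translate w a (fun x => fderiv ℝ g x h) q
      map_add' := fun h h' => by
        simp only [map_add]
        rw [translate_add ha (hg.fderiv_apply h) (hg.fderiv_apply h'), neg_add]
      map_smul' := fun c h => by
        simp only [map_smul]
        rw [translate_smul ha (hg.fderiv_apply h), RingHom.id_apply, smul_neg] }

theorem translateDeriv_apply {a : E3 → ℝ} (ha : Continuous a) {g : E3 → E3} (hg : IsTestField g)
    (q h : E3) :
    translateDeriv w ha hg q h = -translate w a (fun x => fderiv ℝ g x h) q := rfl

/-- The pointwise Taylor remainder is at most `M ‖h‖²`, and for `‖h‖ ≤ 1` it vanishes outside a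
fixed ball. Its `L²_w` norm is then of order `‖h‖²`. -/
theorem hasFDerivAt_translate {a : E3 → ℝ} (ha : Continuous a) {g : E3 → E3}
    (hg : IsTestField g) (q : E3) :
    HasFDerivAt (translate w a g) (translateDeriv w ha hg q) q := by
  obtain ⟨M, hM0, hM⟩ := norm_taylor_le hg
  obtain ⟨r, hr⟩ := hg.hasCompactSupport.isCompact.isBounded.subset_closedBall (0 : E3)
  -- Support radius `r`, shift by `q`, and a further shift of norm at most one.
  set B := Metric.closedBall (0 : E3) (r + ‖q‖ + 1) with hB
  obtain ⟨A, hA⟩ := (isCompact_closedBall (0 : E3) (r + ‖q‖ + 1)).exists_bound_of_continuousOn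
    ha.continuousOn
  have hBm : MeasurableSet B := Metric.isClosed_closedBall.measurableSet
  have hBf : w.measure B ≠ ⊤ := (isCompact_closedBall (0 : E3) _).measure_lt_top.ne
  let b : Lp ℝ 2 w.measure := indicatorConstLp 2 hBm hBf 1
  have hb : b =ᵐ[volume] B.indicator fun _ => 1 := ae_measure_iff.1 indicatorConstLp_coeFn
  have hout : ∀ x ∉ B, ∀ h : E3, ‖h‖ ≤ 1 → x - q - h ∉ tsupport g := by
    intro x hx h hh hmem
    refine hx ?_
    have h1 := hr hmem
    rw [mem_closedBall_zero_iff] at h1 ⊢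
    have h2 : x = x - q - h + (q + h) := by abel
    have h3 := norm_add_le (x - q - h) (q + h)
    rw [← h2] at h3
    linarith [norm_add_le q h]
  have hkey : ∀ h : E3, ‖h‖ ≤ 1 →
      ‖translate w a g (q + h) - translate w a g q - translateDeriv w ha hg q h‖ ≤
        (|A| * M * ‖h‖ ^ 2) * ‖b‖ := by
    intro h hh
    refine Lp.norm_le_mul_norm_of_ae_le_mul (ae_measure_iff.2 ?_)
    have e : translate w a g (q + h) - translate w a g q - translateDeriv w ha hg q h =
      translate w a g (q + h) - translate w a g q +
        translate w a (fun x => fderiv ℝ g x h) q := sub_neg_eq_add _ _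
    rw [e]
    filter_upwards [hb, coeFn_translate (w := w) ha hg (q + h), coeFn_translate (w := w) ha hg q,
      coeFn_translate (w := w) ha (hg.fderiv_apply h) q,
      ae_measure_iff.1 (Lp.coeFn_add (translate w a g (q + h) - translate w a g q)
        (translate w a (fun x => fderiv ℝ g x h) q)),
      ae_measure_iff.1 (Lp.coeFn_sub (translate w a g (q + h)) (translate w a g q))]
      with x h1 h2 h3 h4 h5 h6
    rw [h5, Pi.add_apply, h6, Pi.sub_apply, h1, h2, h3, h4]
    have e2 : a x • g (x - (q + h)) - a x • g (x - q) + a x • fderiv ℝ g (x - q) h =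
        a x • (g (x - q + -h) - g (x - q) - fderiv ℝ g (x - q) (-h)) := by
      rw [map_neg, sub_neg_eq_add, smul_add, smul_sub, ← sub_eq_add_neg, sub_sub]
    by_cases hx : x ∈ B
    · rw [indicator_of_mem hx, norm_one, mul_one, e2, norm_smul]
      have h7 := hM (x - q) (-h)
      rw [norm_neg] at h7
      have h8 : ‖a x‖ ≤ |A| := (hA x hx).trans (le_abs_self A)
      rw [mul_assoc]
      gcongr
    · have h7 : g (x - (q + h)) = 0 := by
        rw [← sub_sub]
        exact image_eq_zero_of_notMem_tsupport (hout x hx h hh)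
      have h8 : x - q ∉ tsupport g := by simpa using hout x hx 0 (by simp)
      have h9 : fderiv ℝ g (x - q) = 0 :=
        image_eq_zero_of_notMem_tsupport fun hc => h8 (tsupport_fderiv_subset ℝ hc)
      rw [h7, image_eq_zero_of_notMem_tsupport h8, h9, indicator_of_notMem hx]
      simp
  rw [hasFDerivAt_iff_isLittleO_nhds_zero]
  have hO : (fun h => translate w a g (q + h) - translate w a g q - translateDeriv w ha hg q h)
      =O[𝓝 0] fun h : E3 => ‖h‖ ^ 2 := by
    refine Asymptotics.IsBigO.of_bound (|A| * M * ‖b‖) ?_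
    filter_upwards [Metric.closedBall_mem_nhds (0 : E3) one_pos] with h hh
    rw [norm_pow, norm_norm]
    refine (hkey h (mem_closedBall_zero_iff.1 hh)).trans_eq (by ring)
  exact hO.trans_isLittleO (by
    simpa using (Asymptotics.isLittleO_norm_pow_id (E' := E3) one_lt_two))

/-- A directional derivative is again a translated test field with the same factor `a`, so the
induction closes. The factor is `1` for the currents and `w⁻¹` for functionals that integrate
against a moving density. -/
theorem contDiff_translate {a : E3 → ℝ} (ha : Continuous a) {g : E3 → E3}
    (hg : IsTestField g) : ContDiff ℝ ∞ (translate w a g) := by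
  rw [contDiff_infty]
  intro n
  induction n generalizing g with
  | zero =>
    exact contDiff_zero.2 (continuous_iff_continuousAt.2 fun q =>
      (hasFDerivAt_translate ha hg q).continuousAt)
  | succ n ih =>
    push_cast
    refine contDiff_succ_iff_fderiv_apply.2
      ⟨fun q => (hasFDerivAt_translate ha hg q).differentiableAt, by simp, fun h => ?_⟩
    have e : (fun q => fderiv ℝ (translate w a g) q h) =
        fun q => -translate w a (fun x => fderiv ℝ g x h) q := by
      funext q
      rw [(hasFDerivAt_translate ha hg q).fderiv]
      rfl
    rw [e]
    exact (ih (hg.fderiv_apply h)).neg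

theorem trans_translate_one {g : E3 → E3} (hg : IsTestField g) (z : E3) :
    trans w z (translate w (fun _ => 1) g 0) = translate w (fun _ => 1) g z := by
  refine L2w_ext ?_
  filter_upwards [coeFn_trans z (translate w (fun _ => 1) g 0),
    ae_translate (coeFn_translate (w := w) continuous_const hg 0) z,
    coeFn_translate (w := w) continuous_const hg z] with x h1 h2 h3
  rw [h1, h2, h3, sub_zero]

theorem dense_testField (w : Weight) :
    Dense {f : L2w w | ∃ g, IsTestField g ∧ f = translate w (fun _ => 1) g 0} := by
  refine (Lp.dense_hasCompactSupport_contDiff (F := E3) (μ := w.measure) (p := 2)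
    (by norm_num)).mono ?_
  rintro f ⟨g, hfg, hc, hs⟩
  refine ⟨g, ⟨hs, hc⟩, L2w_ext ?_⟩
  filter_upwards [ae_measure_iff.1 hfg, coeFn_translate (w := w) continuous_const ⟨hs, hc⟩ 0]
    with x h1 h2
  rw [h1, h2, sub_zero, one_smul]

/-- Translates of test fields move differentiably, test fields are dense, and translations are
bounded uniformly for nearby shifts. -/
theorem continuous_trans (f : L2w w) : Continuous fun z => trans w z f := by
  refine continuous_of_locally_uniform_approx_of_continuousAt fun z u hu => ?_
  obtain ⟨ε, hε, hu⟩ := Metric.mem_uniformity_dist.1 hu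
  set c := √(w.factor (‖z‖ + 1)) with hcdef
  have hc : 0 < c := Real.sqrt_pos.2 (one_pos.trans_le (w.one_le_factor (by positivity)))
  obtain ⟨f', ⟨g, hg, rfl⟩, hd⟩ := (dense_testField w).exists_dist_lt f
    (show 0 < ε / c by positivity)
  refine ⟨Metric.ball z 1, Metric.ball_mem_nhds z one_pos, translate w (fun _ => 1) g,
    (hasFDerivAt_translate continuous_const hg z).continuousAt, fun y hy => hu ?_⟩
  rw [← trans_translate_one hg, dist_eq_norm, ← map_sub]
  rw [dist_eq_norm] at hd
  have hy' : ‖y‖ ≤ ‖z‖ + 1 := by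
    rw [Metric.mem_ball, dist_eq_norm] at hy
    linarith [norm_sub_norm_le y z]
  calc _ ≤ √(w.factor ‖y‖) * ‖f - translate w (fun _ => 1) g 0‖ := norm_trans_le _ _
    _ ≤ c * ‖f - translate w (fun _ => 1) g 0‖ := by
        gcongr
        exact Real.sqrt_le_sqrt (w.factor_mono (norm_nonneg _) hy')
    _ < c * (ε / c) := by gcongr
    _ = ε := by field_simp

theorem pair_trans {ψ : E3 → E3} (hψ : IsTestField ψ) (z : E3) (f : L2w w) :
    pair w ψ (trans w z f) = inner ℝ (translate w (fun x => (w x)⁻¹) ψ (-z)) f := by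
  rw [pair_apply hψ.1.continuous hψ.2, translate,
    inner_ofFun_inv hψ.1.continuous hψ.2,
    ← integral_sub_right_eq_self (fun x => inner ℝ ((f : E3 → E3) x) (ψ (x - -z))) z]
  refine integral_congr_ae ?_
  filter_upwards [coeFn_trans z f] with x hx
  rw [hx, sub_neg_eq_add, sub_add_cancel]

/-- The translation is moved onto the test field, where the dependence on `z` is smooth although `f`
is only square integrable. -/
theorem hasFDerivAt_pair_trans {ψ : E3 → E3} (hψ : IsTestField ψ) (f : L2w w) (z : E3) :
    ∃ D : E3 →L[ℝ] ℝ, HasFDerivAt (fun z => pair w ψ (trans w z f)) D z ∧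
      ∀ h, D h = pair w (fun x => fderiv ℝ ψ x h) (trans w z f) := by
  have hD := hasFDerivAt_translate (w := w) w.continuous_inv hψ (-z)
  have hDa := translateDeriv_apply (w := w) w.continuous_inv hψ (-z)
  generalize translateDeriv w w.continuous_inv hψ (-z) = D at hD hDa
  have h1 : HasFDerivAt (fun y => translate w (fun x => (w x)⁻¹) ψ (-y)) (-D) z := by
    convert! hD.comp z (hasFDerivAt_id z).neg using 1
    ext h : 1
    simp
  refine ⟨(innerSL ℝ f).comp (-D), ?_, fun h => ?_⟩
  · refine ((innerSL ℝ f).hasFDerivAt.comp z h1).congr_of_eventuallyEq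
      (Eventually.of_forall fun y => ?_)
    simp only [pair_trans hψ, Function.comp_apply, innerSL_apply_apply]
    exact real_inner_comm _ _
  · rw [pair_trans (hψ.fderiv_apply h), real_inner_comm, ContinuousLinearMap.comp_apply,
      neg_apply, hDa, neg_neg, innerSL_apply_apply]

end Translates

end MaxwellLorentz

namespace MaxwellLorentz

open Filter Topology Set

/-! ### Translations and the weight -/

section Commutator

variable {w : Weight}

/-- Writing `w = (√w)²` gives `∇w = 2 √w ∇√w`, so membership in `𝒲¹` means `|∇w| ≤ 2 C w`. The mean
value inequality on a segment of length at most one gives the claim, with `w.factor 1` comparing the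
weight along it. -/
theorem Weight.exists_sub_le (hw : w.MemClass 1) :
    ∃ C : ℝ, 0 ≤ C ∧ ∀ x z, ‖z‖ ≤ 1 → |w x - w (x - z)| ≤ C * ‖z‖ * w x := by
  obtain ⟨C, hC0, hC⟩ := hw 1 le_rfl
  have hs : ∀ x, DifferentiableAt ℝ (fun y => √(w y)) x := fun x =>
    ((w.contDiff.differentiable (by simp)) x).sqrt (w.pos x).ne'
  have hd : ∀ x, HasFDerivAt (w : E3 → ℝ) ((2 * √(w x)) • fderiv ℝ (fun y => √(w y)) x) x := by
    intro x
    have h1 := (hs x).hasFDerivAt.mul (hs x).hasFDerivAt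
    have e : (fun y => √(w y)) * (fun y => √(w y)) = (w : E3 → ℝ) := by
      funext y
      exact Real.mul_self_sqrt (w.pos y).le
    rw [e] at h1
    convert! h1 using 1
    rw [two_mul, add_smul]
  have hn : ∀ x, ‖(2 * √(w x)) • fderiv ℝ (fun y => √(w y)) x‖ ≤ 2 * C * w x := by
    intro x
    have h1 := hC x
    rw [norm_iteratedFDeriv_one] at h1
    rw [norm_smul, Real.norm_of_nonneg (by positivity)]
    calc _ ≤ 2 * √(w x) * (C * √(w x)) := by gcongr
      _ = 2 * C * (√(w x) * √(w x)) := by ring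
      _ = _ := by rw [Real.mul_self_sqrt (w.pos x).le]
  refine ⟨2 * C * w.factor 1, by have := w.one_le_factor zero_le_one; positivity,
    fun x z hz => ?_⟩
  have h1 := (convex_segment (x - z) x).norm_image_sub_le_of_norm_hasFDerivWithin_le
    (f := (w : E3 → ℝ)) (C := 2 * C * (w.factor 1 * w x))
    (fun y _ => (hd y).hasFDerivWithinAt) (fun y hy => by
      refine (hn y).trans ?_
      gcongr
      have h2 : ‖y - x‖ ≤ 1 := by
        have := norm_sub_le_of_mem_segment (segment_symm ℝ (x - z) x ▸ hy)
        rw [sub_sub_cancel_left, norm_neg] at this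
        linarith
      have h3 := w.le_factor x (y - x)
      rw [add_sub_cancel] at h3
      refine h3.trans ?_
      have := w.pos x
      gcongr
      exact w.factor_mono (norm_nonneg _) h2) (left_mem_segment ℝ _ _) (right_mem_segment ℝ _ _)
  rw [sub_sub_cancel, Real.norm_eq_abs] at h1
  refine h1.trans_eq (by ring)

theorem integral_norm_mul_norm_le (f g : L2w w) :
    Integrable (fun x => w x * (‖(f : E3 → E3) x‖ * ‖(g : E3 → E3) x‖)) ∧
      ∫ x, w x * (‖(f : E3 → E3) x‖ * ‖(g : E3 → E3) x‖) ≤ ‖f‖ * ‖g‖ := by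
  have hf := (Lp.memLp f).norm
  have hg := (Lp.memLp g).norm
  have h1 : Integrable (fun x => ‖(f : E3 → E3) x‖ * ‖(g : E3 → E3) x‖) w.measure :=
    hf.integrable_mul hg
  constructor
  · have := (integrable_withDensity_iff_integrable_smul'
      w.continuous.measurable.ennreal_ofReal
      (Eventually.of_forall fun x => ENNReal.ofReal_lt_top)).1 h1
    simpa only [ENNReal.toReal_ofReal (w.pos _).le, smul_eq_mul] using this
  · rw [← integral_measure (w := w) fun x => ‖(f : E3 → E3) x‖ * ‖(g : E3 → E3) x‖]
    have h2 := real_inner_le_norm (hf.toLp _) (hg.toLp _)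
    rw [Lp.norm_toLp, Lp.norm_toLp, eLpNorm_norm, eLpNorm_norm, L2.inner_def] at h2
    rw [Lp.norm_def, Lp.norm_def]
    refine le_trans (le_of_eq (integral_congr_ae ?_)) h2
    filter_upwards [hf.coeFn_toLp, hg.coeFn_toLp] with x h3 h4
    rw [h3, h4]
    simp [mul_comm]

theorem integrable_inner (f g : L2w w) :
    Integrable fun x => w x * inner ℝ ((f : E3 → E3) x) ((g : E3 → E3) x) := by
  have h1 : Integrable (fun x => inner ℝ ((f : E3 → E3) x) ((g : E3 → E3) x)) w.measure :=
    L2.integrable_inner f g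
  have := (integrable_withDensity_iff_integrable_smul'
    w.continuous.measurable.ennreal_ofReal
    (Eventually.of_forall fun x => ENNReal.ofReal_lt_top)).1 h1
  simpa only [ENNReal.toReal_ofReal (w.pos _).le, smul_eq_mul] using this

/-- Translations are almost unitary on `L²_w` for weights in `𝒲¹`. -/
theorem exists_inner_trans_sub_le (hw : w.MemClass 1) :
    ∃ C : ℝ, 0 ≤ C ∧ ∀ (f g : L2w w) (z : E3), ‖z‖ ≤ 1 →
      |inner ℝ (trans w z f) g - inner ℝ f (trans w (-z) g)| ≤ C * ‖z‖ * ‖f‖ * ‖g‖ := by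
  obtain ⟨C, hC0, hC⟩ := Weight.exists_sub_le hw
  refine ⟨C * √(w.factor 1), by positivity, fun f g z hz => ?_⟩
  -- After the change of variables the two inner products differ only in the argument of the weight,
  -- and `w x - w (x - z)` is `O(‖z‖) w x`.
  have h1 : inner ℝ f (trans w (-z) g) = ∫ x, w (x - z) * inner ℝ ((trans w z f : L2w w) x)
      ((g : E3 → E3) x) := by
    rw [inner_eq_integral, ← integral_sub_right_eq_self _ z]
    refine integral_congr_ae ?_
    filter_upwards [coeFn_trans z f, ae_translate (coeFn_trans (-z) g) z] with x h2 h3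
    rw [h2, h3, sub_neg_eq_add, sub_add_cancel]
  have hint : Integrable fun x => w (x - z) * inner ℝ ((trans w z f : L2w w) x)
      ((g : E3 → E3) x) := by
    refine ((integrable_inner f (trans w (-z) g)).comp_sub_right z).congr ?_
    filter_upwards [coeFn_trans z f, ae_translate (coeFn_trans (-z) g) z] with x h2 h3
    rw [h2, h3, sub_neg_eq_add, sub_add_cancel]
  obtain ⟨h4, h5⟩ := integral_norm_mul_norm_le (trans w z f) g
  rw [h1, inner_eq_integral, ← integral_sub (integrable_inner _ _) hint]
  have h6 : ‖∫ x, (w x * inner ℝ ((trans w z f : L2w w) x) ((g : E3 → E3) x) -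
      w (x - z) * inner ℝ ((trans w z f : L2w w) x) ((g : E3 → E3) x))‖ ≤
      ∫ x, (C * ‖z‖) * (w x * (‖(trans w z f : L2w w) x‖ * ‖(g : E3 → E3) x‖)) := by
    refine norm_integral_le_of_norm_le (h4.const_mul _) (Eventually.of_forall fun x => ?_)
    rw [← sub_mul, norm_mul, Real.norm_eq_abs, ← mul_assoc]
    exact mul_le_mul (hC x z hz) (norm_inner_le_norm _ _) (norm_nonneg _)
      ((abs_nonneg _).trans (hC x z hz))
  rw [integral_const_mul, Real.norm_eq_abs] at h6
  refine h6.trans ?_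
  have h7 : ‖trans w z f‖ ≤ √(w.factor 1) * ‖f‖ := (norm_trans_le z f).trans (by
    gcongr
    exact w.factor_mono (norm_nonneg _) hz)
  calc _ ≤ C * ‖z‖ * (√(w.factor 1) * ‖f‖ * ‖g‖) := by
        gcongr
        exact h5.trans (by gcongr)
    _ = _ := by ring

end Commutator

/-! ### Averages of translations -/

section Kernel

variable {w : Weight} {k k' : E3 → ℝ}

theorem continuous_kernel (hk : Continuous k) (ε : ℝ) (f : L2w w) :
    Continuous fun z => k z • trans w (ε • z) f :=
  hk.smul ((continuous_trans f).comp (continuous_const_smul ε))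

theorem integrable_kernel (hk : Continuous k) (hc : HasCompactSupport k) (ε : ℝ) (f : L2w w) :
    Integrable fun z => k z • trans w (ε • z) f :=
  (continuous_kernel hk ε f).integrable_of_hasCompactSupport hc.smul_right

/-- The average `∫ k(z) f(· - ε z) dz` of translates. -/
noncomputable def kernelOp (w : Weight) (hk : Continuous k) (hc : HasCompactSupport k) (ε : ℝ) :
    L2w w →L[ℝ] L2w w :=
  LinearMap.mkContinuous
    { toFun := fun f => ∫ z, k z • trans w (ε • z) f
      map_add' := fun f g => by
        rw [← integral_add (integrable_kernel hk hc ε f) (integrable_kernel hk hc ε g)]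
        simp only [map_add, smul_add]
      map_smul' := fun c f => by
        rw [RingHom.id_apply, ← integral_smul]
        simp only [map_smul, smul_comm c] }
    (∫ z, ‖k z‖ * √(w.factor ‖ε • z‖)) fun f => by
      rw [← integral_mul_const]
      refine norm_integral_le_of_norm_le ?_ (Eventually.of_forall fun z => ?_)
      · refine Integrable.mul_const (Continuous.integrable_of_hasCompactSupport ?_ ?_) _
        · have := w.continuous_factor
          fun_prop
        · exact hc.norm.mul_right
      · rw [norm_smul, mul_assoc]
        gcongr
        exact norm_trans_le _ _

theorem kernelOp_apply (hk : Continuous k) (hc : HasCompactSupport k) (ε : ℝ) (f : L2w w) :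
    kernelOp w hk hc ε f = ∫ z, k z • trans w (ε • z) f := rfl

theorem map_kernelOp {F : Type*} [NormedAddCommGroup F] [NormedSpace ℝ F] [CompleteSpace F]
    (hk : Continuous k) (hc : HasCompactSupport k) (ε : ℝ)
    (f : L2w w) (L : L2w w →L[ℝ] F) :
    L (kernelOp w hk hc ε f) = ∫ z, k z • L (trans w (ε • z) f) := by
  rw [kernelOp_apply, ← L.integral_comp_comm (integrable_kernel hk hc ε f)]
  simp only [map_smul]

theorem kernelOp_mem {G : Submodule ℝ (L2w w × L2w w)} (hG : IsClosed (G : Set (L2w w × L2w w)))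
    (htr : ∀ f g z, (f, g) ∈ G → (trans w z f, trans w z g) ∈ G) (hk : Continuous k)
    (hc : HasCompactSupport k) (ε : ℝ) {f g : L2w w} (h : (f, g) ∈ G) :
    (kernelOp w hk hc ε f, kernelOp w hk hc ε g) ∈ G := by
  rw [kernelOp_apply, kernelOp_apply,
    ← integral_pair (integrable_kernel hk hc ε f) (integrable_kernel hk hc ε g)]
  exact Evolution.integral_mem_closed_submodule hG fun z => G.smul_mem (k z) (htr _ _ _ h)

theorem kernelOp_trans (hk : Continuous k) (hc : HasCompactSupport k) (ε : ℝ) (z : E3)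
    (f : L2w w) : kernelOp w hk hc ε (trans w z f) = trans w z (kernelOp w hk hc ε f) := by
  rw [map_kernelOp, kernelOp_apply]
  simp only [trans_trans, add_comm]

theorem kernelOp_comm (hk : Continuous k) (hc : HasCompactSupport k) (ε : ℝ)
    (hk' : Continuous k') (hc' : HasCompactSupport k') (δ : ℝ) (f : L2w w) :
    kernelOp w hk hc ε (kernelOp w hk' hc' δ f) = kernelOp w hk' hc' δ (kernelOp w hk hc ε f) := by
  rw [map_kernelOp hk' hc' δ f, kernelOp_apply hk' hc']
  simp only [kernelOp_trans]

theorem kernelOp_lift (hk : Continuous k) (hc : HasCompactSupport k) (ε : ℝ) (L : E3 →L[ℝ] E3)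
    (f : L2w w) : kernelOp w hk hc ε (lift w L f) = lift w L (kernelOp w hk hc ε f) := by
  rw [map_kernelOp, kernelOp_apply]
  simp only [trans_lift]

/-- The average depends continuously on `ε`, including at `ε = 0`, where it returns `f` because the
kernel has integral one. -/
theorem tendsto_kernelOp (hk : Continuous k) (hc : HasCompactSupport k) (hk1 : ∫ z, k z = 1)
    (f : L2w w) {ε : ℕ → ℝ} (hε : Tendsto ε atTop (𝓝 0)) :
    Tendsto (fun n => kernelOp w hk hc (ε n) f) atTop (𝓝 f) := by
  have e : f = ∫ z, k z • trans w ((0 : ℝ) • z) f := by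
    simp only [zero_smul, trans_zero]
    rw [integral_smul_const, hk1, one_smul]
  have hcont : Continuous fun ε : ℝ => ∫ z, k z • trans w (ε • z) f := by
    refine (continuous_parametric_integral_of_continuous (μ := volume) (s := tsupport k)
      (f := fun ε z => k z • trans w (ε • z) f) ?_ hc.isCompact).congr fun ε => ?_
    · exact (hk.comp continuous_snd).smul ((continuous_trans f).comp
        (continuous_fst.smul continuous_snd))
    · refine setIntegral_eq_integral_of_forall_compl_eq_zero fun z hz => ?_
      rw [image_eq_zero_of_notMem_tsupport hz, zero_smul]
  have h1 := (hcont.tendsto 0).comp hε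
  rw [← e] at h1
  exact h1

end Kernel

end MaxwellLorentz

namespace MaxwellLorentz

open Filter Topology Set

/-! ### The curl -/

section Curl

variable {w : Weight}

/-- The standard basis vectors of `ℝ³`. -/
noncomputable abbrev basisVec (j : Fin 3) : E3 := EuclideanSpace.single j 1

/-- The cross product as a continuous bilinear map. -/
noncomputable def crossL : E3 →L[ℝ] E3 →L[ℝ] E3 :=
  LinearMap.toContinuousLinearMap
    { toFun := fun a => LinearMap.toContinuousLinearMap
        { toFun := fun b => cross a b
          map_add' := fun b c => by
            ext i
            fin_cases i <;> simp [cross] <;> ring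
          map_smul' := fun c b => by
            ext i
            fin_cases i <;> simp [cross] <;> ring }
      map_add' := fun a b => by
        ext c i
        fin_cases i <;> simp [cross] <;> ring
      map_smul' := fun c a => by
        ext b i
        fin_cases i <;> simp [cross] <;> ring }

theorem crossL_apply (a b : E3) : crossL a b = cross a b := rfl

theorem inner_crossL (a b c : E3) : inner ℝ (crossL a b) c = inner ℝ b (-crossL a c) := by
  simp only [crossL_apply, PiLp.inner_apply, Fin.sum_univ_three, cross, PiLp.neg_apply]
  simp
  ring

theorem norm_cross_le (a b : E3) : ‖cross a b‖ ≤ ‖a‖ * ‖b‖ := by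
  refine le_of_sq_le_sq ?_ (by positivity)
  rw [mul_pow]
  simp only [EuclideanSpace.norm_sq_eq, Fin.sum_univ_three, Real.norm_eq_abs, sq_abs, cross]
  simp
  -- Lagrange's identity: the deficit is the square of the inner product of `a` and `b`.
  nlinarith [sq_nonneg (a 0 * b 0 + a 1 * b 1 + a 2 * b 2)]

/-- Separates the constant skew maps `e_j ∧ ·` from the derivatives. The former act pointwise and
commute with translations, so only the partial derivatives need an analytic argument. -/
theorem curl_eq_sum (u : E3 → E3) (x : E3) :
    curl u x = ∑ j, crossL (basisVec j) (fderiv ℝ u x (basisVec j)) := by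
  ext i
  fin_cases i <;> simp [curl, partialDeriv, crossL_apply, cross, Fin.sum_univ_three] <;> ring

theorem IsTestField.map {g : E3 → E3} (hg : IsTestField g) (L : E3 →L[ℝ] E3) :
    IsTestField fun x => L (g x) :=
  ⟨L.contDiff.comp hg.contDiff, hg.hasCompactSupport.comp_left (map_zero L)⟩

theorem IsTestField.sum {ι : Type*} (s : Finset ι) {g : ι → E3 → E3} (hg : ∀ i, IsTestField (g i)) :
    IsTestField fun x => ∑ i ∈ s, g i x := by
  classical
  induction s using Finset.induction_on with
  | empty => exact ⟨by simpa using contDiff_const, by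
      simp only [Finset.sum_empty]
      exact HasCompactSupport.zero⟩
  | insert a s ha ih =>
    simp only [Finset.sum_insert ha]
    exact ⟨(hg a).1.add ih.1, (hg a).2.add ih.2⟩

theorem IsTestField.curl {g : E3 → E3} (hg : IsTestField g) : IsTestField (curl g) := by
  have e : MaxwellLorentz.curl g = fun x => ∑ j, crossL (basisVec j) (fderiv ℝ g x (basisVec j)) :=
    funext (curl_eq_sum g)
  rw [e]
  exact IsTestField.sum _ fun j => (hg.fderiv_apply _).map _

theorem IsTestField.integrable_inner {g : E3 → E3} (hg : IsTestField g) (f : L2w w) :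
    Integrable fun x => inner ℝ ((f : E3 → E3) x) (g x) := by
  have h := MaxwellLorentz.integrable_inner (ofFun w fun x => (w x)⁻¹ • g x) f
  refine h.congr ?_
  have h1 := coeFn_ofFun (w := w) (memLp_smul_translate w.continuous_inv hg.1.continuous hg.2 0)
  simp only [sub_zero] at h1
  filter_upwards [h1] with x hx
  rw [hx, real_inner_smul_left, real_inner_comm, ← mul_assoc, mul_inv_cancel₀ (w.pos x).ne',
    one_mul]

theorem pair_sum {ι : Type*} (s : Finset ι) {g : ι → E3 → E3} (hg : ∀ i, IsTestField (g i))
    (f : L2w w) : pair w (fun x => ∑ i ∈ s, g i x) f = ∑ i ∈ s, pair w (g i) f := by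
  rw [pair_apply (IsTestField.sum s hg).1.continuous (IsTestField.sum s hg).2]
  simp only [inner_sum]
  rw [integral_finsetSum _ fun i _ => (hg i).integrable_inner f]
  exact Finset.sum_congr rfl fun i _ => (pair_apply (hg i).1.continuous (hg i).2 f).symm

theorem pair_lift {g : E3 → E3} (hg : IsTestField g) {L L' : E3 →L[ℝ] E3}
    (h : ∀ a b, inner ℝ (L a) b = inner ℝ a (L' b)) (f : L2w w) :
    pair w g (lift w L f) = pair w (fun x => L' (g x)) f := by
  rw [pair_apply hg.1.continuous hg.2, pair_apply (hg.map L').1.continuous (hg.map L').2]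
  refine integral_congr_ae ?_
  filter_upwards [coeFn_lift L f] with x hx
  rw [hx, h]

theorem pair_curl {ψ : E3 → E3} (hψ : IsTestField ψ) (f : L2w w) :
    pair w (curl ψ) f = -∑ j, pair w (fun x => fderiv ℝ ψ x (basisVec j))
      (lift w (crossL (basisVec j)) f) := by
  have e : MaxwellLorentz.curl ψ = fun x => ∑ j, crossL (basisVec j) (fderiv ℝ ψ x (basisVec j)) :=
    funext (curl_eq_sum ψ)
  rw [e, pair_sum _ fun j => (hψ.fderiv_apply _).map _, ← Finset.sum_neg_distrib]
  refine Finset.sum_congr rfl fun j _ => ?_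
  rw [pair_lift (hψ.fderiv_apply (basisVec j)) (L' := -crossL (basisVec j))
      (fun a b => inner_crossL (basisVec j) a b),
    pair_apply ((hψ.fderiv_apply _).map _).1.continuous ((hψ.fderiv_apply _).map _).2,
    pair_apply ((hψ.fderiv_apply _).map _).1.continuous ((hψ.fderiv_apply _).map _).2,
    ← integral_neg]
  simp [inner_neg_right]

/-- The graph of the distributional curl on `L²_w`. -/
noncomputable def curlGraph (w : Weight) : Submodule ℝ (L2w w × L2w w) where
  carrier := {p | ∀ ψ, IsTestField ψ → pair w (curl ψ) p.1 = pair w ψ p.2}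
  add_mem' := fun h h' ψ hψ => by
    simp only [Prod.fst_add, Prod.snd_add, map_add, h ψ hψ, h' ψ hψ]
  zero_mem' := fun ψ _ => by simp
  smul_mem' := fun c p h ψ hψ => by
    simp only [Prod.smul_fst, Prod.smul_snd, map_smul, h ψ hψ]

theorem mem_curlGraph {f g : L2w w} :
    (f, g) ∈ curlGraph w ↔ ∀ ψ, IsTestField ψ → pair w (curl ψ) f = pair w ψ g := Iff.rfl

theorem mem_curlGraph_iff {f g : L2w w} : (f, g) ∈ curlGraph w ↔ IsWeakCurl f g := by
  rw [mem_curlGraph]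
  refine forall_congr' fun ψ => ⟨fun h h1 h2 => ?_, fun h hψ => ?_⟩
  · have hψ : IsTestField ψ := ⟨h1, h2⟩
    rw [← pair_apply hψ.curl.1.continuous hψ.curl.2, h hψ, pair_apply h1.continuous h2]
  · rw [pair_apply hψ.curl.1.continuous hψ.curl.2, h hψ.1 hψ.2,
      pair_apply hψ.1.continuous hψ.2]

theorem isClosed_curlGraph (w : Weight) : IsClosed (curlGraph w : Set (L2w w × L2w w)) := by
  have e : (curlGraph w : Set (L2w w × L2w w)) =
      ⋂ ψ : {ψ // IsTestField ψ}, {p | pair w (curl ψ) p.1 = pair w ψ p.2} := by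
    ext p
    simp only [mem_iInter, Subtype.forall]
    rfl
  rw [e]
  exact isClosed_iInter fun ψ => isClosed_eq ((pair w _).continuous.comp continuous_fst)
    ((pair w _).continuous.comp continuous_snd)

theorem curlGraph_unique {f g g' : L2w w} (h : (f, g) ∈ curlGraph w) (h' : (f, g') ∈ curlGraph w) :
    g = g' :=
  IsWeakCurl.unique (mem_curlGraph_iff.1 h) (mem_curlGraph_iff.1 h')

theorem pair_trans_eq {ψ : E3 → E3} (hψ : IsTestField ψ) (z : E3) (f : L2w w) :
    pair w ψ (trans w z f) = pair w (fun x => ψ (x + z)) f := by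
  rw [pair_trans hψ]
  simp only [translate, sub_neg_eq_add]
  rfl

theorem IsTestField.comp_add {ψ : E3 → E3} (hψ : IsTestField ψ) (z : E3) :
    IsTestField fun x => ψ (x + z) :=
  ⟨hψ.1.comp (contDiff_id.add contDiff_const), hψ.2.comp_homeomorph (Homeomorph.addRight z)⟩

theorem trans_mem_curlGraph (f g : L2w w) (z : E3) (h : (f, g) ∈ curlGraph w) :
    (trans w z f, trans w z g) ∈ curlGraph w := by
  intro ψ hψ
  have e : curl (fun x => ψ (x + z)) = fun x => curl ψ (x + z) := by
    funext x
    simp only [curl_eq_sum, fderiv_comp_add_right]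
  rw [pair_trans_eq hψ.curl, pair_trans_eq hψ, ← e]
  exact h _ (hψ.comp_add z)

/-- Integration by parts for vector fields. -/
theorem integral_inner_fderiv {f g : E3 → E3} (hf : IsTestField f) (hg : IsTestField g) (v : E3) :
    ∫ x, inner ℝ (f x) (fderiv ℝ g x v) = -∫ x, inner ℝ (fderiv ℝ f x v) (g x) := by
  have hi : ∀ {f g : E3 → E3}, IsTestField f → IsTestField g →
      Integrable fun x => inner ℝ (f x) (g x) := fun hf hg =>
    (hf.1.continuous.inner hg.1.continuous).integrable_of_hasCompactSupport
      (hg.2.mono fun x hx h => hx (by simp only [h, inner_zero_right]))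
  exact integral_bilinear_fderiv_right_eq_neg_left_of_integrable (B := innerSL ℝ)
    (hi (hf.fderiv_apply v) hg) (hi hf (hg.fderiv_apply v)) (hi hf hg)
    (fun x _ => (hf.1.differentiable (by simp)) x) (fun x _ => (hg.1.differentiable (by simp)) x)

theorem integral_inner_curl {f g : E3 → E3} (hf : IsTestField f) (hg : IsTestField g) :
    ∫ x, inner ℝ (f x) (curl g x) = ∫ x, inner ℝ (curl f x) (g x) := by
  have hi : ∀ {f g : E3 → E3}, IsTestField f → IsTestField g →
      Integrable fun x => inner ℝ (f x) (g x) := fun hf hg =>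
    (hf.1.continuous.inner hg.1.continuous).integrable_of_hasCompactSupport
      (hg.2.mono fun x hx h => hx (by simp only [h, inner_zero_right]))
  simp only [curl_eq_sum, inner_sum, sum_inner]
  rw [integral_finsetSum _ fun j _ => hi hf ((hg.fderiv_apply _).map _),
    integral_finsetSum _ fun j _ => hi ((hf.fderiv_apply _).map _) hg]
  refine Finset.sum_congr rfl fun j _ => ?_
  have h1 := integral_inner_fderiv (hf.map (crossL (basisVec j))) hg (basisVec j)
  have h2 : ∀ x, fderiv ℝ (fun x => crossL (basisVec j) (f x)) x (basisVec j) =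
      crossL (basisVec j) (fderiv ℝ f x (basisVec j)) := fun x => by
    have h3 : HasFDerivAt (fun x => crossL (basisVec j) (f x)) _ x :=
      (crossL (basisVec j)).hasFDerivAt.comp x ((hf.1.differentiable (by simp)) x).hasFDerivAt
    rw [h3.fderiv]
    rfl
  simp only [h2] at h1
  simp only [inner_crossL, inner_neg_right, integral_neg] at h1 ⊢
  linarith

/-- Integration by parts gives this for an unshifted test field, and the curl graph is translation
invariant. -/
theorem translate_mem_curlGraph {g : E3 → E3} (hg : IsTestField g) (q : E3) :
    (translate w (fun _ => 1) g q, translate w (fun _ => 1) (curl g) q) ∈ curlGraph w := by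
  rw [← trans_translate_one hg, ← trans_translate_one hg.curl]
  refine trans_mem_curlGraph _ _ q fun ψ hψ => ?_
  rw [pair_apply hψ.curl.1.continuous hψ.curl.2, pair_apply hψ.1.continuous hψ.2]
  have h1 := coeFn_translate (w := w) (a := fun _ => 1) continuous_const hg 0
  have h2 := coeFn_translate (w := w) (a := fun _ => 1) continuous_const hg.curl 0
  refine Eq.trans ?_ ((integral_inner_curl hg hψ).trans ?_)
  · refine integral_congr_ae ?_
    filter_upwards [h1] with x hx
    rw [hx, sub_zero, one_smul]
  · refine integral_congr_ae ?_
    filter_upwards [h2] with x hx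
    rw [hx, sub_zero, one_smul]

end Curl

end MaxwellLorentz

namespace MaxwellLorentz

open Filter Topology Set

/-! ### Mollified curl operators -/

section Mollifier

variable {w : Weight}

/-- A smooth bump function supported in the unit ball. -/
noncomputable def unitBump : ContDiffBump (0 : E3) := ⟨1 / 2, 1, by norm_num, by norm_num⟩

/-- An even mollifier supported in the unit ball. -/
noncomputable def moll : E3 → ℝ := unitBump.normed volume

theorem contDiff_moll : ContDiff ℝ ∞ moll := unitBump.contDiff_normed

theorem hasCompactSupport_moll : HasCompactSupport moll := unitBump.hasCompactSupport_normed

theorem integral_moll : ∫ z, moll z = 1 := unitBump.integral_normed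

theorem moll_neg (z : E3) : moll (-z) = moll z := unitBump.normed_neg z

/-- The partial derivatives of the mollifier. -/
noncomputable def dmoll (j : Fin 3) (z : E3) : ℝ := fderiv ℝ moll z (basisVec j)

theorem continuous_dmoll (j : Fin 3) : Continuous (dmoll j) :=
  (contDiff_moll.continuous_fderiv (by simp)).clm_apply continuous_const

theorem hasCompactSupport_dmoll (j : Fin 3) : HasCompactSupport (dmoll j) :=
  hasCompactSupport_moll.fderiv_apply ℝ _

theorem dmoll_neg (j : Fin 3) (z : E3) : dmoll j (-z) = -dmoll j z := by
  have h1 : HasFDerivAt moll (fderiv ℝ moll (-z)) (-z) :=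
    ((contDiff_moll.differentiable (by simp)) _).hasFDerivAt
  have h2 := h1.comp z (hasFDerivAt_id z).neg
  have e : moll ∘ Neg.neg = moll := funext moll_neg
  have h3 : HasFDerivAt moll _ z := e ▸ h2
  rw [dmoll, dmoll, h3.fderiv]
  simp

theorem dmoll_eq_zero (j : Fin 3) {z : E3} (hz : 1 < ‖z‖) : dmoll j z = 0 := by
  have h : z ∉ tsupport moll := by
    rw [moll, unitBump.tsupport_normed_eq, mem_closedBall_zero_iff]
    exact not_le.2 hz
  rw [dmoll, image_eq_zero_of_notMem_tsupport fun hc => h (tsupport_fderiv_subset ℝ hc)]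
  rfl

/-- Mollification at scale `ε`. -/
noncomputable def mollify (w : Weight) (ε : ℝ) : L2w w →L[ℝ] L2w w :=
  kernelOp w contDiff_moll.continuous hasCompactSupport_moll ε

/-- The curl of the mollification at scale `ε`, a bounded operator. -/
noncomputable def mollCurl (w : Weight) (ε : ℝ) : L2w w →L[ℝ] L2w w :=
  ε⁻¹ • ∑ j, (lift w (crossL (basisVec j))).comp
    (kernelOp w (continuous_dmoll j) (hasCompactSupport_dmoll j) ε)

theorem mollCurl_apply (ε : ℝ) (f : L2w w) : mollCurl w ε f =
    ε⁻¹ • ∑ j, lift w (crossL (basisVec j))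
      (kernelOp w (continuous_dmoll j) (hasCompactSupport_dmoll j) ε f) := by
  simp [mollCurl]

/-- Differentiating the pairing in the averaging variable `z` produces `ε` times the derivative of
`ψ`. Integration by parts in `z` then moves that derivative onto the mollifier, at the price `ε⁻¹`.
-/
theorem integral_moll_mul_pair {ψ : E3 → E3} (hψ : IsTestField ψ) (j : Fin 3) {ε : ℝ} (hε : ε ≠ 0)
    (f : L2w w) :
    pair w (fun x => fderiv ℝ ψ x (basisVec j)) (mollify w ε f) =
      -(ε⁻¹ * pair w ψ (kernelOp w (continuous_dmoll j) (hasCompactSupport_dmoll j) ε f)) := by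
  have hd : ∀ z, HasFDerivAt (fun z => pair w ψ (trans w (ε • z) f))
      (fderiv ℝ (fun z => pair w ψ (trans w (ε • z) f)) z) z ∧
      fderiv ℝ (fun z => pair w ψ (trans w (ε • z) f)) z (basisVec j) =
        ε * pair w (fun x => fderiv ℝ ψ x (basisVec j)) (trans w (ε • z) f) := by
    intro z
    obtain ⟨D, hD, hDa⟩ := hasFDerivAt_pair_trans hψ f (ε • z)
    have h1 : HasFDerivAt (fun z : E3 => ε • z) (ε • ContinuousLinearMap.id ℝ E3) z :=
      (hasFDerivAt_id z).const_smul ε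
    have h2 : HasFDerivAt (fun z => pair w ψ (trans w (ε • z) f)) _ z := hD.comp z h1
    refine ⟨h2.differentiableAt.hasFDerivAt, ?_⟩
    rw [h2.fderiv]
    simp [hDa]
  have hcont : Continuous fun z => pair w ψ (trans w (ε • z) f) :=
    continuous_iff_continuousAt.2 fun z => (hd z).1.continuousAt
  have hcont' : Continuous fun z => fderiv ℝ (fun z => pair w ψ (trans w (ε • z) f)) z
      (basisVec j) := by
    simp only [(hd _).2]
    exact continuous_const.mul ((pair w _).continuous.comp
      ((continuous_trans f).comp (continuous_const_smul ε)))
  have h1 := integral_mul_fderiv_eq_neg_fderiv_mul_of_integrable (μ := volume)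
    (f := moll) (g := fun z => pair w ψ (trans w (ε • z) f)) (v := basisVec j)
    (((continuous_dmoll j).mul hcont).integrable_of_hasCompactSupport
      (hasCompactSupport_dmoll j).mul_right)
    ((contDiff_moll.continuous.mul hcont').integrable_of_hasCompactSupport
      hasCompactSupport_moll.mul_right)
    ((contDiff_moll.continuous.mul hcont).integrable_of_hasCompactSupport
      hasCompactSupport_moll.mul_right)
    (fun z _ => (contDiff_moll.differentiable (by simp)) z)
    (fun z _ => (hd z).1.differentiableAt)
  simp only [(hd _).2] at h1
  have e : ∀ z, moll z * (ε * pair w (fun x => fderiv ℝ ψ x (basisVec j)) (trans w (ε • z) f)) =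
      ε * (moll z * pair w (fun x => fderiv ℝ ψ x (basisVec j)) (trans w (ε • z) f)) :=
    fun z => by ring
  simp only [e, integral_const_mul] at h1
  rw [mollify, map_kernelOp, map_kernelOp]
  simp only [smul_eq_mul]
  change ε * _ = -∫ z, dmoll j z * pair w ψ (trans w (ε • z) f) at h1
  rw [← mul_neg, ← h1, inv_mul_cancel_left₀ hε]

theorem mollify_mollCurl_mem {ε : ℝ} (hε : ε ≠ 0) (f : L2w w) :
    (mollify w ε f, mollCurl w ε f) ∈ curlGraph w := by
  intro ψ hψ
  simp only
  rw [pair_curl hψ, mollCurl_apply, map_smul, map_sum, smul_eq_mul, Finset.mul_sum,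
    ← Finset.sum_neg_distrib]
  refine Finset.sum_congr rfl fun j _ => ?_
  rw [mollify, ← kernelOp_lift, ← kernelOp_lift]
  exact (congrArg Neg.neg (integral_moll_mul_pair hψ j hε _)).trans (neg_neg _)

theorem mollify_mem {ε : ℝ} {f g : L2w w} (h : (f, g) ∈ curlGraph w) :
    (mollify w ε f, mollify w ε g) ∈ curlGraph w :=
  kernelOp_mem (isClosed_curlGraph w) trans_mem_curlGraph _ _ ε h

/-- Mollification commutes with curl, and distributional curls are unique. -/
theorem mollCurl_eq {ε : ℝ} (hε : ε ≠ 0) {f g : L2w w} (h : (f, g) ∈ curlGraph w) :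
    mollCurl w ε f = mollify w ε g :=
  curlGraph_unique (mollify_mollCurl_mem hε f) (mollify_mem h)

theorem mollCurl_mem {ε : ℝ} (hε : ε ≠ 0) {f g : L2w w} (h : (f, g) ∈ curlGraph w) :
    (mollCurl w ε f, mollCurl w ε g) ∈ curlGraph w := by
  rw [mollCurl_eq hε h]
  exact mollify_mollCurl_mem hε g

theorem mollCurl_comm {ε δ : ℝ} (hε : ε ≠ 0) (hδ : δ ≠ 0) (f : L2w w) :
    mollCurl w ε (mollCurl w δ f) = mollCurl w δ (mollCurl w ε f) := by
  have hT : ∀ h, mollify w ε (mollify w δ h) = mollify w δ (mollify w ε h) :=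
    kernelOp_comm _ _ _ _ _ _
  -- Both sides are the curl of the double mollification of `f`. Taking curls once more then
  -- compares the two products of mollified curls, for every `f` in `L²_w`.
  have h1 : mollify w ε (mollCurl w δ f) = mollify w δ (mollCurl w ε f) := by
    rw [← mollCurl_eq hε (mollify_mollCurl_mem hδ f), ← mollCurl_eq hδ (mollify_mollCurl_mem hε f)]
    refine curlGraph_unique (mollify_mollCurl_mem hε (mollify w δ f)) ?_
    rw [hT]
    exact mollify_mollCurl_mem hδ (mollify w ε f)
  have h2 := mollify_mollCurl_mem hε (mollCurl w δ f)
  rw [h1] at h2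
  exact curlGraph_unique h2 (mollify_mollCurl_mem hδ (mollCurl w ε f))

theorem tendsto_mollify (f : L2w w) {ε : ℕ → ℝ} (hε : Tendsto ε atTop (𝓝 0)) :
    Tendsto (fun n => mollify w (ε n) f) atTop (𝓝 f) :=
  tendsto_kernelOp _ _ integral_moll f hε

theorem norm_crossL_basisVec_le (j : Fin 3) (a : E3) : ‖crossL (basisVec j) a‖ ≤ 1 * ‖a‖ := by
  have h := norm_cross_le (basisVec j) a
  rwa [PiLp.norm_single, norm_one] at h

/-- Mollified curls are symmetric up to an error bounded uniformly in `ε`. -/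
theorem exists_inner_mollCurl_sub_le (hw : w.MemClass 1) :
    ∃ C : ℝ, 0 ≤ C ∧ ∀ ε : ℝ, 0 < ε → ε ≤ 1 → ∀ f g : L2w w,
      |inner ℝ (mollCurl w ε f) g - inner ℝ (mollCurl w ε g) f| ≤ C * ‖f‖ * ‖g‖ := by
  obtain ⟨C, hC0, hC⟩ := exists_inner_trans_sub_le hw
  refine ⟨∑ j, (∫ z, ‖dmoll j z‖) * C, Finset.sum_nonneg fun j _ =>
    mul_nonneg (integral_nonneg fun z => norm_nonneg _) hC0, fun ε hε hε1 f g => ?_⟩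
  have hi : ∀ (j : Fin 3) (f g : L2w w),
      Integrable fun z => dmoll j z * inner ℝ (trans w (ε • z) f) g := fun j f g =>
    ((continuous_dmoll j).mul (((continuous_trans f).comp
      (continuous_const_smul ε)).inner continuous_const)).integrable_of_hasCompactSupport
      (hasCompactSupport_dmoll j).mul_right
  have hi' : ∀ (j : Fin 3) (f g : L2w w),
      Integrable fun z => dmoll j z * inner ℝ f (trans w (-(ε • z)) g) := fun j f g =>
    ((continuous_dmoll j).mul (continuous_const.inner ((continuous_trans g).comp
      (continuous_const_smul ε).neg))).integrable_of_hasCompactSupport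
      (hasCompactSupport_dmoll j).mul_right
  have hK : ∀ (j : Fin 3) (f g : L2w w),
      inner ℝ (kernelOp w (continuous_dmoll j) (hasCompactSupport_dmoll j) ε f) g =
        ∫ z, dmoll j z * inner ℝ (trans w (ε • z) f) g := by
    intro j f g
    rw [real_inner_comm]
    have h := map_kernelOp (continuous_dmoll j) (hasCompactSupport_dmoll j) ε f (innerSL ℝ g)
    simp only [innerSL_apply_apply, smul_eq_mul] at h
    rw [h]
    simp only [real_inner_comm]
  -- The derivative of the even mollifier is odd and `e_j ∧ ·` is skew. The two signs combine so
  -- that only the failure of translations to be unitary remains. This failure is `O(ε)` on the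
  -- support of `dmoll`, which pays for the prefactor `ε⁻¹`.
  have hS : ∀ j, inner ℝ (lift w (crossL (basisVec j))
        (kernelOp w (continuous_dmoll j) (hasCompactSupport_dmoll j) ε f)) g -
      inner ℝ (lift w (crossL (basisVec j))
        (kernelOp w (continuous_dmoll j) (hasCompactSupport_dmoll j) ε g)) f =
      ∫ z, dmoll j z * (inner ℝ (trans w (ε • z) f) (lift w (-crossL (basisVec j)) g) -
        inner ℝ f (trans w (-(ε • z)) (lift w (-crossL (basisVec j)) g))) := by
    intro j
    have e : lift w (-crossL (basisVec j)) g = -lift w (crossL (basisVec j)) g := by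
      refine L2w_ext ?_
      filter_upwards [coeFn_lift (-crossL (basisVec j)) g, coeFn_lift (crossL (basisVec j)) g,
        ae_measure_iff.1 (Lp.coeFn_neg (lift w (crossL (basisVec j)) g))] with x h1 h2 h3
      rw [h1, h3, Pi.neg_apply, h2, neg_apply]
    simp only [mul_sub]
    rw [integral_sub (hi j _ _) (hi' j _ _),
      inner_lift (L' := -crossL (basisVec j)) (fun a b => inner_crossL (basisVec j) a b) _ g, hK,
      ← kernelOp_lift, hK, ← integral_neg_eq_self (fun z => dmoll j z * inner ℝ (trans w (ε • z)
        (lift w (crossL (basisVec j)) g)) f)]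
    congr 1
    refine integral_congr_ae (Eventually.of_forall fun z => ?_)
    simp only
    rw [dmoll_neg, e, map_neg, inner_neg_right, real_inner_comm, smul_neg, neg_mul_comm]
  rw [mollCurl_apply, mollCurl_apply, real_inner_smul_left, real_inner_smul_left, ← mul_sub,
    sum_inner, sum_inner, ← Finset.sum_sub_distrib]
  simp only [hS]
  rw [abs_mul, abs_of_pos (inv_pos.2 hε), inv_mul_le_iff₀ hε]
  refine (Finset.abs_sum_le_sum_abs _ _).trans ?_
  rw [Finset.sum_mul, Finset.sum_mul, Finset.mul_sum]
  refine Finset.sum_le_sum fun j _ => ?_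
  rw [← Real.norm_eq_abs]
  have hb : ∀ z, ‖dmoll j z * (inner ℝ (trans w (ε • z) f) (lift w (-crossL (basisVec j)) g) -
        inner ℝ f (trans w (-(ε • z)) (lift w (-crossL (basisVec j)) g)))‖ ≤
      ‖dmoll j z‖ * (C * ε * ‖f‖ * ‖g‖) := by
    intro z
    rw [norm_mul]
    by_cases hz : 1 < ‖z‖
    · rw [dmoll_eq_zero j hz]
      simp
    · have h1 : ‖ε • z‖ ≤ ε := by
        rw [norm_smul, Real.norm_of_nonneg hε.le]
        exact mul_le_of_le_one_right hε.le (not_lt.1 hz)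
      have h2 := hC f (lift w (-crossL (basisVec j)) g) (ε • z) (h1.trans hε1)
      have h3 : ‖lift w (-crossL (basisVec j)) g‖ ≤ 1 * ‖g‖ :=
        norm_lift_le (fun a => by rw [neg_apply, norm_neg]; exact norm_crossL_basisVec_le j a) g
      rw [one_mul] at h3
      refine mul_le_mul_of_nonneg_left (h2.trans ?_) (norm_nonneg _)
      gcongr
  refine (norm_integral_le_of_norm_le (Integrable.mul_const
    ((continuous_dmoll j).norm.integrable_of_hasCompactSupport (hasCompactSupport_dmoll j).norm) _)
    (Eventually.of_forall hb)).trans_eq ?_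
  rw [integral_mul_const]
  ring

end Mollifier

end MaxwellLorentz

namespace MaxwellLorentz

open Filter Topology Set

/-! ### The Maxwell operator on the phase space -/

section Phase

variable {w : Weight} {N : ℕ}

section mk

variable (q p : Fin N → E3) (E B : Fin N → L2w w) (i : Fin N)

theorem q_mk : PhaseSpace.q (PhaseSpace.mk q p E B) i = q i := rfl
theorem p_mk : PhaseSpace.p (PhaseSpace.mk q p E B) i = p i := rfl
theorem E_mk : PhaseSpace.E (PhaseSpace.mk q p E B) i = E i := rfl
theorem B_mk : PhaseSpace.B (PhaseSpace.mk q p E B) i = B i := rfl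

end mk

theorem mk_eta (φ : PhaseSpace w N) : PhaseSpace.mk (PhaseSpace.q φ) (PhaseSpace.p φ)
    (PhaseSpace.E φ) (PhaseSpace.B φ) = φ := rfl

theorem phase_ext {φ ψ : PhaseSpace w N} (hq : ∀ i, PhaseSpace.q φ i = PhaseSpace.q ψ i)
    (hp : ∀ i, PhaseSpace.p φ i = PhaseSpace.p ψ i) (hE : ∀ i, PhaseSpace.E φ i = PhaseSpace.E ψ i)
    (hB : ∀ i, PhaseSpace.B φ i = PhaseSpace.B ψ i) : φ = ψ := by
  rw [← mk_eta φ, ← mk_eta ψ, funext hq, funext hp, funext hE, funext hB]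

theorem inner_phase (φ ψ : PhaseSpace w N) : inner ℝ φ ψ =
    ∑ i, ((inner ℝ (PhaseSpace.q φ i) (PhaseSpace.q ψ i) +
      inner ℝ (PhaseSpace.p φ i) (PhaseSpace.p ψ i)) +
      (inner ℝ (PhaseSpace.E φ i) (PhaseSpace.E ψ i) +
      inner ℝ (PhaseSpace.B φ i) (PhaseSpace.B ψ i))) := by
  rw [PiLp.inner_apply]
  simp only [WithLp.prod_inner_apply]
  rfl

theorem norm_sq_phase (φ : PhaseSpace w N) : ‖φ‖ ^ 2 =
    ∑ i, ((‖PhaseSpace.q φ i‖ ^ 2 + ‖PhaseSpace.p φ i‖ ^ 2) +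
      (‖PhaseSpace.E φ i‖ ^ 2 + ‖PhaseSpace.B φ i‖ ^ 2)) := by
  rw [← real_inner_self_eq_norm_sq, inner_phase]
  simp only [real_inner_self_eq_norm_sq]

theorem norm_component_le (φ : PhaseSpace w N) (i : Fin N) :
    (‖PhaseSpace.q φ i‖ ≤ ‖φ‖ ∧ ‖PhaseSpace.p φ i‖ ≤ ‖φ‖) ∧
      ‖PhaseSpace.E φ i‖ ≤ ‖φ‖ ∧ ‖PhaseSpace.B φ i‖ ≤ ‖φ‖ := by
  have h := Finset.single_le_sum (f := fun i => (‖PhaseSpace.q φ i‖ ^ 2 + ‖PhaseSpace.p φ i‖ ^ 2) +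
      (‖PhaseSpace.E φ i‖ ^ 2 + ‖PhaseSpace.B φ i‖ ^ 2)) (fun i _ => by positivity)
      (Finset.mem_univ i)
  rw [← norm_sq_phase] at h
  have h1 := sq_nonneg ‖PhaseSpace.q φ i‖
  have h2 := sq_nonneg ‖PhaseSpace.p φ i‖
  have h3 := sq_nonneg ‖PhaseSpace.E φ i‖
  have h4 := sq_nonneg ‖PhaseSpace.B φ i‖
  refine ⟨⟨?_, ?_⟩, ?_, ?_⟩ <;> refine le_of_sq_le_sq ?_ (norm_nonneg φ) <;> linarith

/-- Position as a continuous linear map. -/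
noncomputable def qL (w : Weight) {N : ℕ} (i : Fin N) : PhaseSpace w N →L[ℝ] E3 :=
  LinearMap.mkContinuous ⟨⟨fun φ => PhaseSpace.q φ i, fun _ _ => rfl⟩, fun _ _ => rfl⟩ 1
    fun φ => (norm_component_le φ i).1.1.trans_eq (one_mul _).symm

/-- Momentum as a continuous linear map. -/
noncomputable def pL (w : Weight) {N : ℕ} (i : Fin N) : PhaseSpace w N →L[ℝ] E3 :=
  LinearMap.mkContinuous ⟨⟨fun φ => PhaseSpace.p φ i, fun _ _ => rfl⟩, fun _ _ => rfl⟩ 1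
    fun φ => (norm_component_le φ i).1.2.trans_eq (one_mul _).symm

/-- The electric field as a continuous linear map. -/
noncomputable def EL (w : Weight) {N : ℕ} (i : Fin N) : PhaseSpace w N →L[ℝ] L2w w :=
  LinearMap.mkContinuous ⟨⟨fun φ => PhaseSpace.E φ i, fun _ _ => rfl⟩, fun _ _ => rfl⟩ 1
    fun φ => (norm_component_le φ i).2.1.trans_eq (one_mul _).symm

/-- The magnetic field as a continuous linear map. -/
noncomputable def BL (w : Weight) {N : ℕ} (i : Fin N) : PhaseSpace w N →L[ℝ] L2w w :=
  LinearMap.mkContinuous ⟨⟨fun φ => PhaseSpace.B φ i, fun _ _ => rfl⟩, fun _ _ => rfl⟩ 1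
    fun φ => (norm_component_le φ i).2.2.trans_eq (one_mul _).symm

theorem qL_apply (i : Fin N) (φ : PhaseSpace w N) : qL w i φ = PhaseSpace.q φ i := rfl
theorem EL_apply (i : Fin N) (φ : PhaseSpace w N) : EL w i φ = PhaseSpace.E φ i := rfl
theorem BL_apply (i : Fin N) (φ : PhaseSpace w N) : BL w i φ = PhaseSpace.B φ i := rfl

/-- The phase space point with the given components, as a continuous linear map. -/
noncomputable def assemble (w : Weight) (N : ℕ) :
    (Fin N → (E3 × E3) × (L2w w × L2w w)) →L[ℝ] PhaseSpace w N where
  toFun x := PhaseSpace.mk (fun i => (x i).1.1) (fun i => (x i).1.2) (fun i => (x i).2.1)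
    (fun i => (x i).2.2)
  map_add' _ _ := rfl
  map_smul' _ _ := rfl
  cont := by
    refine (PiLp.continuous_toLp 2 _).comp (continuous_pi fun i => ?_)
    refine (WithLp.prod_continuous_toLp 2 _ _).comp (Continuous.prodMk ?_ ?_)
    · exact (WithLp.prod_continuous_toLp 2 _ _).comp (by fun_prop)
    · exact (WithLp.prod_continuous_toLp 2 _ _).comp (by fun_prop)

/-- The graph of `A`. -/
noncomputable def opGraph (w : Weight) (N : ℕ) : Submodule ℝ (PhaseSpace w N × PhaseSpace w N) :=
  ⨅ i, ((((qL w i).comp (ContinuousLinearMap.snd ℝ _ _)).toLinearMap.ker ⊓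
    ((pL w i).comp (ContinuousLinearMap.snd ℝ _ _)).toLinearMap.ker) ⊓
    ((curlGraph w).comap (((BL w i).comp (ContinuousLinearMap.fst ℝ _ _)).prod
      ((EL w i).comp (ContinuousLinearMap.snd ℝ _ _))).toLinearMap ⊓
    (curlGraph w).comap (((EL w i).comp (ContinuousLinearMap.fst ℝ _ _)).prod
      (-(BL w i).comp (ContinuousLinearMap.snd ℝ _ _))).toLinearMap))

theorem mem_opGraph {φ ψ : PhaseSpace w N} : (φ, ψ) ∈ opGraph w N ↔
    ∀ i, PhaseSpace.q ψ i = 0 ∧ PhaseSpace.p ψ i = 0 ∧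
      (PhaseSpace.B φ i, PhaseSpace.E ψ i) ∈ curlGraph w ∧
      (PhaseSpace.E φ i, -PhaseSpace.B ψ i) ∈ curlGraph w := by
  rw [opGraph, Submodule.mem_iInf]
  exact forall_congr' fun i => and_assoc

theorem isClosed_opGraph (w : Weight) (N : ℕ) :
    IsClosed (opGraph w N : Set (PhaseSpace w N × PhaseSpace w N)) := by
  rw [opGraph, Submodule.coe_iInf]
  exact isClosed_iInter fun i =>
    ((ContinuousLinearMap.isClosed_ker _).inter (ContinuousLinearMap.isClosed_ker _)).inter
    (((isClosed_curlGraph w).preimage (ContinuousLinearMap.continuous _)).inter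
      ((isClosed_curlGraph w).preimage (ContinuousLinearMap.continuous _)))

theorem mem_Hcurl_iff {f : L2w w} : f ∈ Hcurl w ↔ ∃ g, (f, g) ∈ curlGraph w := by
  simp only [mem_curlGraph_iff]
  rfl

theorem weakCurl_mem {f : L2w w} (h : f ∈ Hcurl w) : (f, weakCurl f) ∈ curlGraph w :=
  mem_curlGraph_iff.2 (isWeakCurl_weakCurl h)

theorem opA_mem {φ : PhaseSpace w N} (h : φ ∈ domA w N) : (φ, opA φ) ∈ opGraph w N := by
  refine mem_opGraph.2 fun i => ⟨rfl, rfl, weakCurl_mem (h i).2, ?_⟩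
  rw [opA, B_mk, neg_neg]
  exact weakCurl_mem (h i).1

theorem mem_domA_of_mem {φ ψ : PhaseSpace w N} (h : (φ, ψ) ∈ opGraph w N) : φ ∈ domA w N :=
  fun i => ⟨mem_Hcurl_iff.2 ⟨_, (mem_opGraph.1 h i).2.2.2⟩,
    mem_Hcurl_iff.2 ⟨_, (mem_opGraph.1 h i).2.2.1⟩⟩

/-- Uniqueness of the distributional curl makes the graph single-valued, so arguments about closed
graphs transfer to `opA`. -/
theorem opA_eq_of_mem {φ ψ : PhaseSpace w N} (h : (φ, ψ) ∈ opGraph w N) : opA φ = ψ := by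
  have h' := opA_mem (mem_domA_of_mem h)
  rw [mem_opGraph] at h h'
  refine phase_ext (fun i => (h' i).1.trans (h i).1.symm) (fun i => (h' i).2.1.trans (h i).2.1.symm)
    (fun i => curlGraph_unique (h' i).2.2.1 (h i).2.2.1) fun i => ?_
  exact neg_injective (curlGraph_unique (h' i).2.2.2 (h i).2.2.2)

/-- A chain in the graph forces each iterate of `opA` to be the genuine one, so the default value of
`weakCurl` outside `Hcurl` never enters. -/
theorem mem_domPow_of_chain {n : ℕ} {x : ℕ → PhaseSpace w N}
    (h : ∀ k < n, (x k, x (k + 1)) ∈ opGraph w N) : x 0 ∈ domPow w N n := by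
  have hk : ∀ k ≤ n, opA^[k] (x 0) = x k := by
    intro k
    induction k with
    | zero => intro _; rfl
    | succ k ih =>
      intro hk
      rw [Function.iterate_succ_apply', ih (by omega), opA_eq_of_mem (h k (by omega))]
  intro k hkn
  rw [hk k hkn.le]
  exact mem_domA_of_mem (h k hkn)

theorem chain_of_mem_domPow {n : ℕ} {φ : PhaseSpace w N} (h : φ ∈ domPow w N n) :
    ∀ k < n, (opA^[k] φ, opA^[k + 1] φ) ∈ opGraph w N := by
  intro k hk
  rw [Function.iterate_succ_apply']
  exact opA_mem (h k hk)

/-- Bounded approximations of `A`. -/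
noncomputable def mollA (w : Weight) (N : ℕ) (ε : ℝ) : PhaseSpace w N →L[ℝ] PhaseSpace w N :=
  (assemble w N).comp (ContinuousLinearMap.pi fun i =>
    (0 : PhaseSpace w N →L[ℝ] E3 × E3).prod
      (((mollCurl w ε).comp (BL w i)).prod (-(mollCurl w ε).comp (EL w i))))

theorem mollA_apply (ε : ℝ) (φ : PhaseSpace w N) : mollA w N ε φ =
    PhaseSpace.mk 0 0 (fun i => mollCurl w ε (PhaseSpace.B φ i))
      (fun i => -mollCurl w ε (PhaseSpace.E φ i)) := rfl

theorem mollA_comm {ε δ : ℝ} (hε : ε ≠ 0) (hδ : δ ≠ 0) : Commute (mollA w N ε) (mollA w N δ) := by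
  refine ContinuousLinearMap.ext fun φ => ?_
  rw [mul_apply_eq_comp, mul_apply_eq_comp]
  refine phase_ext (fun i => ?_) (fun i => ?_) (fun i => ?_) (fun i => ?_)
  · simp only [mollA_apply, q_mk]
  · simp only [mollA_apply, p_mk]
  · simp only [mollA_apply, E_mk, B_mk, map_neg, mollCurl_comm hε hδ]
  · simp only [mollA_apply, E_mk, B_mk, mollCurl_comm hε hδ]

theorem mollA_mem {ε : ℝ} (hε : ε ≠ 0) {φ ψ : PhaseSpace w N} (h : (φ, ψ) ∈ opGraph w N) :
    (mollA w N ε φ, mollA w N ε ψ) ∈ opGraph w N := by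
  rw [mem_opGraph] at h ⊢
  refine fun i => ⟨rfl, rfl, ?_, ?_⟩
  · have h1 := (curlGraph w).neg_mem (mollCurl_mem hε (h i).2.2.2)
    simpa only [mollA_apply, E_mk, B_mk, map_neg, neg_neg, Prod.neg_mk] using h1
  · simpa only [mollA_apply, E_mk, B_mk, neg_neg] using mollCurl_mem hε (h i).2.2.1

theorem tendsto_phase {φ : ℕ → PhaseSpace w N} {ψ : PhaseSpace w N}
    (hq : ∀ i, Tendsto (fun n => PhaseSpace.q (φ n) i) atTop (𝓝 (PhaseSpace.q ψ i)))
    (hp : ∀ i, Tendsto (fun n => PhaseSpace.p (φ n) i) atTop (𝓝 (PhaseSpace.p ψ i)))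
    (hE : ∀ i, Tendsto (fun n => PhaseSpace.E (φ n) i) atTop (𝓝 (PhaseSpace.E ψ i)))
    (hB : ∀ i, Tendsto (fun n => PhaseSpace.B (φ n) i) atTop (𝓝 (PhaseSpace.B ψ i))) :
    Tendsto φ atTop (𝓝 ψ) :=
  ((assemble w N).continuous.tendsto _).comp (tendsto_pi_nhds.2 fun i =>
    ((hq i).prodMk_nhds (hp i)).prodMk_nhds ((hE i).prodMk_nhds (hB i)))

theorem tendsto_mollA {ε : ℕ → ℝ} (hε0 : ∀ n, ε n ≠ 0) (hε : Tendsto ε atTop (𝓝 0))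
    {φ ψ : PhaseSpace w N} (h : (φ, ψ) ∈ opGraph w N) :
    Tendsto (fun n => mollA w N (ε n) φ) atTop (𝓝 ψ) := by
  rw [mem_opGraph] at h
  refine tendsto_phase (fun i => ?_) (fun i => ?_) (fun i => ?_) (fun i => ?_)
  · rw [(h i).1]
    exact tendsto_const_nhds
  · rw [(h i).2.1]
    exact tendsto_const_nhds
  · simp only [mollA_apply, E_mk, mollCurl_eq (hε0 _) (h i).2.2.1]
    exact tendsto_mollify _ hε
  · simp only [mollA_apply, B_mk, mollCurl_eq (hε0 _) (h i).2.2.2]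
    simpa using (tendsto_mollify (-PhaseSpace.B ψ i) hε).neg

/-- Mollifying the fields lands in the domain and converges to the given point. -/
theorem dense_domain (w : Weight) (N : ℕ) :
    Dense {φ : PhaseSpace w N | ∃ ψ, (φ, ψ) ∈ opGraph w N} := by
  intro φ
  have hε := tendsto_one_div_add_atTop_nhds_zero_nat (𝕜 := ℝ)
  refine mem_closure_of_tendsto (b := atTop) (f := fun n : ℕ => PhaseSpace.mk (PhaseSpace.q φ)
    (PhaseSpace.p φ) (fun i => mollify w (1 / ((n : ℝ) + 1)) (PhaseSpace.E φ i))
    (fun i => mollify w (1 / ((n : ℝ) + 1)) (PhaseSpace.B φ i)))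
    (tendsto_phase (fun i => tendsto_const_nhds) (fun i => tendsto_const_nhds)
      (fun i => tendsto_mollify _ hε) (fun i => tendsto_mollify _ hε))
    (Eventually.of_forall fun n => ?_)
  have hn : 1 / ((n : ℝ) + 1) ≠ 0 := by positivity
  refine ⟨PhaseSpace.mk 0 0 (fun i => mollCurl w (1 / ((n : ℝ) + 1)) (PhaseSpace.B φ i))
    (fun i => -mollCurl w (1 / ((n : ℝ) + 1)) (PhaseSpace.E φ i)), mem_opGraph.2 fun i =>
    ⟨rfl, rfl, mollify_mollCurl_mem hn _, ?_⟩⟩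
  rw [B_mk, neg_neg]
  exact mollify_mollCurl_mem hn _

/-- For each charge the inner product is `⟨E, curl B⟩ - ⟨B, curl E⟩` with mollified curls, which is
at most `C ‖E‖ ‖B‖` by their approximate symmetry. -/
theorem exists_mollA_skew (hw : w.MemClass 1) (N : ℕ) :
    ∃ γ : ℝ, 0 ≤ γ ∧ ∀ ε : ℝ, 0 < ε → ε ≤ 1 → ∀ φ : PhaseSpace w N,
      |inner ℝ φ (mollA w N ε φ)| ≤ γ * ‖φ‖ ^ 2 := by
  obtain ⟨C, hC0, hC⟩ := exists_inner_mollCurl_sub_le hw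
  refine ⟨C, hC0, fun ε hε hε1 φ => ?_⟩
  rw [inner_phase, norm_sq_phase, Finset.mul_sum]
  refine (Finset.abs_sum_le_sum_abs _ _).trans (Finset.sum_le_sum fun i _ => ?_)
  simp only [mollA_apply, q_mk, p_mk, E_mk, B_mk, Pi.zero_apply, inner_zero_right, inner_neg_right]
  rw [real_inner_comm (mollCurl w ε (PhaseSpace.B φ i)),
    real_inner_comm (mollCurl w ε (PhaseSpace.E φ i)), add_zero, zero_add, ← sub_eq_add_neg]
  refine (hC ε hε hε1 _ _).trans ?_
  rw [mul_assoc]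
  gcongr
  nlinarith [sq_nonneg (‖PhaseSpace.B φ i‖ - ‖PhaseSpace.E φ i‖), sq_nonneg ‖PhaseSpace.q φ i‖,
    sq_nonneg ‖PhaseSpace.p φ i‖, sq_nonneg (‖PhaseSpace.B φ i‖ + ‖PhaseSpace.E φ i‖)]

/-- `A` is quasi-skew and generates a strongly continuous group. -/
theorem exists_group (hw : w.MemClass 1) (N : ℕ) :
    ∃ γ : ℝ, 0 ≤ γ ∧ Evolution.QuasiSkew (opGraph w N) γ ∧
      ∃ W : Evolution.C0Group (PhaseSpace w N) γ, W.Generates (opGraph w N) := by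
  obtain ⟨γ, hγ0, hγ⟩ := exists_mollA_skew hw N
  let ε : ℕ → ℝ := fun n => 1 / ((n : ℝ) + 1)
  have hε : Tendsto ε atTop (𝓝 0) := tendsto_one_div_add_atTop_nhds_zero_nat
  have hε0 : ∀ n, 0 < ε n := fun n => by positivity
  have hε1 : ∀ n, ε n ≤ 1 := fun n => by
    rw [div_le_one (by positivity)]
    exact le_add_of_nonneg_left (Nat.cast_nonneg n)
  have hlim : ∀ φ ψ, (φ, ψ) ∈ opGraph w N → Tendsto (fun n => mollA w N (ε n) φ) atTop (𝓝 ψ) :=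
    fun φ ψ h => tendsto_mollA (fun n => (hε0 n).ne') hε h
  refine ⟨γ, hγ0, fun φ ψ h => ?_, Evolution.exists_c0Group (A := fun n => mollA w N (ε n)) hγ0
    (isClosed_opGraph w N) (dense_domain w N) (fun m n => mollA_comm (hε0 m).ne' (hε0 n).ne')
    (fun n φ => hγ _ (hε0 n) (hε1 n) φ) (fun n φ ψ h => mollA_mem (hε0 n).ne' h) hlim⟩
  exact le_of_tendsto (tendsto_const_nhds.inner (hlim φ ψ h)).abs
    (Eventually.of_forall fun n => hγ _ (hε0 n) (hε1 n) φ)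

end Phase

end MaxwellLorentz

namespace MaxwellLorentz

open Filter Topology Set

/-! ### Smooth maps that are Lipschitz on balls -/

section Tame

variable {X Y Z V : Type*} [NormedAddCommGroup X] [NormedSpace ℝ X] [NormedAddCommGroup Y]
  [NormedSpace ℝ Y] [NormedAddCommGroup Z] [NormedSpace ℝ Z] [NormedAddCommGroup V]
  [NormedSpace ℝ V]

/-- Smooth maps that are Lipschitz on all balls around the origin. -/
structure Tame (F : X → Y) : Prop where
  contDiff : ContDiff ℝ ∞ F
  lipschitz : ∀ R : ℝ, ∃ L, LipschitzOnWith L F (Metric.closedBall 0 R)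

theorem Tame.exists_bound {F : X → Y} (hF : Tame F) (R : ℝ) :
    ∃ M : ℝ≥0, ∀ x ∈ Metric.closedBall (0 : X) R, ‖F x‖ ≤ M := by
  obtain ⟨L, hL⟩ := hF.lipschitz R
  refine ⟨‖F 0‖₊ + L * R.toNNReal, fun x hx => ?_⟩
  have hx' := mem_closedBall_zero_iff.1 hx
  have hR : 0 ≤ R := (norm_nonneg x).trans hx'
  have h1 := hL.norm_sub_le hx (Metric.mem_closedBall_self hR)
  have h2 := norm_sub_norm_le (F x) (F 0)
  push_cast
  rw [Real.coe_toNNReal _ hR]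
  rw [sub_zero] at h1
  have h3 : (L : ℝ) * ‖x‖ ≤ L * R := by gcongr
  linarith

theorem Tame.const (y : Y) : Tame fun _ : X => y :=
  ⟨contDiff_const, fun _ => ⟨0, (LipschitzWith.const y).lipschitzOnWith⟩⟩

theorem ContinuousLinearMap.tame (L : X →L[ℝ] Y) : Tame L :=
  ⟨L.contDiff, fun _ => ⟨_, L.lipschitz.lipschitzOnWith⟩⟩

theorem Tame.clm_comp {F : X → Y} (hF : Tame F) (L : Y →L[ℝ] Z) : Tame fun x => L (F x) :=
  ⟨L.contDiff.comp hF.contDiff, fun R => by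
    obtain ⟨K, hK⟩ := hF.lipschitz R
    exact ⟨_, L.lipschitz.comp_lipschitzOnWith hK⟩⟩

theorem Tame.prodMk {F : X → Y} {G : X → Z} (hF : Tame F) (hG : Tame G) :
    Tame fun x => (F x, G x) :=
  ⟨hF.contDiff.prodMk hG.contDiff, fun R => by
    obtain ⟨K, hK⟩ := hF.lipschitz R
    obtain ⟨L, hL⟩ := hG.lipschitz R
    exact ⟨_, hK.prodMk hL⟩⟩

theorem Tame.pi {ι : Type*} [Fintype ι] {F : ι → X → Y} (hF : ∀ i, Tame (F i)) :
    Tame fun x i => F i x :=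
  ⟨contDiff_pi' fun i => (hF i).contDiff, fun R => by
    choose K hK using fun i => (hF i).lipschitz R
    refine ⟨∑ i, K i, LipschitzOnWith.of_dist_le_mul fun x hx y hy => ?_⟩
    refine (dist_pi_le_iff (by positivity)).2 fun i => ((hK i).dist_le_mul x hx y hy).trans ?_
    gcongr
    exact_mod_cast Finset.single_le_sum (f := K) (fun _ _ => zero_le) (Finset.mem_univ i)⟩

theorem Tame.add {F G : X → Y} (hF : Tame F) (hG : Tame G) : Tame fun x => F x + G x :=
  ⟨hF.contDiff.add hG.contDiff, fun R => by
    obtain ⟨K, hK⟩ := hF.lipschitz R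
    obtain ⟨L, hL⟩ := hG.lipschitz R
    exact ⟨_, hK.add hL⟩⟩

theorem Tame.sum {ι : Type*} (s : Finset ι) {F : ι → X → Y} (hF : ∀ i, Tame (F i)) :
    Tame fun x => ∑ i ∈ s, F i x := by
  classical
  induction s using Finset.induction_on with
  | empty =>
    simp only [Finset.sum_empty]
    exact Tame.const 0
  | insert a s ha ih =>
    simp only [Finset.sum_insert ha]
    exact (hF a).add ih

theorem Tame.bilin {F : X → Y} {G : X → Z} (hF : Tame F) (hG : Tame G) (B : Y →L[ℝ] Z →L[ℝ] V) :
    Tame fun x => B (F x) (G x) :=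
  ⟨(B.contDiff.comp hF.contDiff).clm_apply hG.contDiff, fun R => by
    obtain ⟨K, hK⟩ := hF.lipschitz R
    obtain ⟨L, hL⟩ := hG.lipschitz R
    obtain ⟨M, hM⟩ := hF.exists_bound R
    obtain ⟨M', hM'⟩ := hG.exists_bound R
    refine ⟨‖B‖₊ * (K * M' + M * L), LipschitzOnWith.of_dist_le_mul fun x hx y hy => ?_⟩
    rw [dist_eq_norm, dist_eq_norm]
    have e : B (F x) (G x) - B (F y) (G y) = B (F x - F y) (G x) + B (F y) (G x - G y) := by
      simp only [map_sub, sub_apply]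
      abel
    have h1 := hK.norm_sub_le hx hy
    have h2 := hL.norm_sub_le hx hy
    rw [e]
    push_cast
    calc _ ≤ ‖B‖ * ‖F x - F y‖ * ‖G x‖ + ‖B‖ * ‖F y‖ * ‖G x - G y‖ :=
          (norm_add_le _ _).trans (add_le_add (B.le_opNorm₂ _ _) (B.le_opNorm₂ _ _))
      _ ≤ ‖B‖ * (K * ‖x - y‖) * M' + ‖B‖ * M * (L * ‖x - y‖) := by
          gcongr
          · exact hM' x hx
          · exact hM y hy
      _ = _ := by ring⟩

theorem Tame.smul {F : X → ℝ} {G : X → Y} (hF : Tame F) (hG : Tame G) : Tame fun x => F x • G x :=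
  hF.bilin hG (ContinuousLinearMap.lsmul ℝ ℝ)

/-- Balls of a general Hilbert space are not compact, so smoothness there gives no Lipschitz
constant on them and the two properties are carried together. Here the intermediate space is
finite-dimensional and compactness supplies the constant. Positions and momenta enter the
nonlinearity this way; the fields enter through bounded bilinear maps. -/
theorem Tame.comp_contDiff [FiniteDimensional ℝ Y] {F : X → Y} (hF : Tame F) {f : Y → Z}
    (hf : ContDiff ℝ ∞ f) : Tame fun x => f (F x) :=
  ⟨hf.comp hF.contDiff, fun R => by
    have : ProperSpace Y := FiniteDimensional.proper ℝ Y
    obtain ⟨K, hK⟩ := hF.lipschitz R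
    obtain ⟨M, hM⟩ := hF.exists_bound R
    obtain ⟨L, hL⟩ := hf.contDiffOn.exists_lipschitzOnWith (by simp)
      (convex_closedBall (0 : Y) M) (isCompact_closedBall (0 : Y) M)
    exact ⟨_, hL.comp hK fun x hx => mem_closedBall_zero_iff.2 (hM x hx)⟩⟩

end Tame

/-! ### The nonlinearity and its images under powers of `A` -/

section Nonlinearity

variable {w : Weight} {N : ℕ}

theorem IsTestField.smul_basisVec (ρ : ChargeDensity) (c : ℝ) (l : Fin 3) :
    IsTestField fun x => (c * ρ x) • basisVec l :=
  ⟨(contDiff_const.mul ρ.contDiff).smul contDiff_const,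
    (ρ.hasCompactSupport.mul_left (f := fun _ => c)).smul_right⟩

theorem contDiff_velocity {m : ℝ} (hm : m ≠ 0) : ContDiff ℝ ∞ (velocity m) := by
  have hpos : ∀ p : E3, 0 < m ^ 2 + ‖p‖ ^ 2 := fun p => by positivity
  have h1 : ContDiff ℝ ∞ fun p : E3 => m ^ 2 + ‖p‖ ^ 2 := contDiff_const.add (contDiff_norm_sq ℝ)
  exact (contDiff_const.div (h1.sqrt fun p => (hpos p).ne') fun p =>
    (Real.sqrt_pos.2 (hpos p)).ne').smul contDiff_id

theorem sum_smul_basisVec (v : E3) : ∑ l, v l • basisVec l = v := by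
  ext i
  fin_cases i <;> simp [Fin.sum_univ_three]

theorem inner_basisVec (v : E3) (l : Fin 3) : inner ℝ v (basisVec l) = v l := by
  simp [EuclideanSpace.inner_single_right]

/-- The smearing `f ↦ ∫ ϱ(x - q) f(x) dx`. -/
noncomputable def smear (w : Weight) (ρ : ChargeDensity) (q : E3) (f : L2w w) : E3 :=
  ∑ l, inner ℝ (translate w (fun x => (w x)⁻¹) (fun x => (1 * ρ x) • basisVec l) q) f • basisVec l

theorem integrable_smear (ρ : ChargeDensity) (q : E3) (f : L2w w) :
    Integrable fun x => ρ (x - q) • (f : E3 → E3) x := by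
  refine (locallyIntegrable_L2w f).integrable_smul_left_of_hasCompactSupport ?_ ?_
  · exact ρ.contDiff.continuous.comp (continuous_id.sub continuous_const)
  · exact ρ.hasCompactSupport.comp_homeomorph (Homeomorph.subRight q)

/-- Identifies the smearing integral with inner products against the vectors `w⁻¹ ϱ(· - q) e_l`,
whose dependence on `q` is smooth. -/
theorem smear_eq (ρ : ChargeDensity) (q : E3) (f : L2w w) :
    smear w ρ q f = ∫ x, ρ (x - q) • (f : E3 → E3) x := by
  rw [← sum_smul_basisVec (∫ x, ρ (x - q) • (f : E3 → E3) x), smear]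
  refine Finset.sum_congr rfl fun l _ => ?_
  congr 1
  have ht := IsTestField.smul_basisVec ρ 1 l
  rw [translate, inner_ofFun_inv ht.1.continuous ht.2, ← inner_basisVec, real_inner_comm,
    ← integral_inner (integrable_smear ρ q f)]
  refine integral_congr_ae (Eventually.of_forall fun x => ?_)
  simp only [one_mul, real_inner_smul_right]
  rw [real_inner_comm]

theorem lorentzForce_eq (m : Fin N → ℝ) (e : Fin N → Fin N → ℝ) (ρ : Fin N → ChargeDensity)
    (φ : PhaseSpace w N) (i : Fin N) : lorentzForce m e ρ φ i =
      ∑ j, e i j • (smear w (ρ i) (PhaseSpace.q φ i) (PhaseSpace.E φ j) +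
        crossL (velocity (m i) (PhaseSpace.p φ i))
          (smear w (ρ i) (PhaseSpace.q φ i) (PhaseSpace.B φ j))) := by
  refine Finset.sum_congr rfl fun j _ => ?_
  congr 1
  have h1 := integrable_smear (ρ i) (PhaseSpace.q φ i) (PhaseSpace.E φ j)
  have h2 := integrable_smear (ρ i) (PhaseSpace.q φ i) (PhaseSpace.B φ j)
  rw [smear_eq, smear_eq, ← (crossL _).integral_comp_comm h2,
    ← integral_add h1 ((crossL _).integrable_comp h2)]
  simp only [smul_add, map_smul, crossL_apply]

/-- The field `x ↦ ∑ₗ vₗ gₗ(x - q)`. -/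
noncomputable def moving (w : Weight) (g : Fin 3 → E3 → E3) (q v : E3) : L2w w :=
  ∑ l, v l • translate w (fun _ => 1) (g l) q

theorem current_eq (ρ : ChargeDensity) (q v : E3) : current w ρ q v =
    moving w (fun l x => (-(4 * Real.pi) * ρ x) • basisVec l) q v := by
  have h : ∀ l, translate w (fun _ => 1) (fun x => (-(4 * Real.pi) * ρ x) • basisVec l) q =
      current w ρ q (basisVec l) := by
    intro l
    refine L2w_ext ?_
    filter_upwards [coeFn_translate (w := w) (a := fun _ => 1) continuous_const
      (IsTestField.smul_basisVec ρ (-(4 * Real.pi)) l) q,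
      ae_measure_iff.1 (memLp_current w ρ q (basisVec l)).coeFn_toLp] with x h1 h2
    rw [h1, one_smul, current, h2]
  simp only [moving, h, current]
  simp only [← MemLp.toLp_const_smul, Fin.sum_univ_three, ← MemLp.toLp_add]
  congr 1
  funext x
  conv_lhs => rw [← sum_smul_basisVec v]
  simp only [Fin.sum_univ_three, Pi.add_apply, Pi.smul_apply, smul_add]
  rw [smul_comm _ (v 0), smul_comm _ (v 1), smul_comm _ (v 2)]

theorem moving_mem {g : Fin 3 → E3 → E3} (hg : ∀ l, IsTestField (g l)) (q v : E3) :
    (moving w g q v, moving w (fun l => curl (g l)) q v) ∈ curlGraph w := by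
  have h := (curlGraph w).sum_mem (t := Finset.univ) fun (l : Fin 3) _ =>
    (curlGraph w).smul_mem (v l) (translate_mem_curlGraph (w := w) (hg l) q)
  simp only [Prod.smul_mk] at h
  convert! h using 1

theorem moving_neg {g : Fin 3 → E3 → E3} (hg : ∀ l, IsTestField (g l)) (q v : E3) :
    moving w (fun l x => -g l x) q v = -moving w g q v := by
  have h : ∀ l, translate w (fun _ => 1) (fun x => -g l x) q =
      -translate w (fun _ => 1) (g l) q := fun l => by
    have := translate_smul (w := w) (a := fun _ => 1) continuous_const (hg l) (-1) q
    simpa using this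
  simp only [moving, h, smul_neg, Finset.sum_neg_distrib]

theorem tame_moving {X : Type*} [NormedAddCommGroup X] [NormedSpace ℝ X] {Q v : X → E3}
    (hQ : Tame Q) (hv : Tame v) {g : Fin 3 → E3 → E3} (hg : ∀ l, IsTestField (g l)) :
    Tame fun x => moving w g (Q x) (v x) :=
  Tame.sum _ fun l => (hv.clm_comp (EuclideanSpace.proj (𝕜 := ℝ) l)).smul
    (hQ.comp_contDiff (contDiff_translate continuous_const (hg l)))

theorem tame_smear {X : Type*} [NormedAddCommGroup X] [NormedSpace ℝ X] {Q : X → E3} {f : X → L2w w}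
    (hQ : Tame Q) (hf : Tame f) (ρ : ChargeDensity) : Tame fun x => smear w ρ (Q x) (f x) :=
  Tame.sum _ fun l => ((hQ.comp_contDiff (contDiff_translate w.continuous_inv
    (IsTestField.smul_basisVec ρ 1 l))).bilin hf (innerSL ℝ)).smul (Tame.const _)

/-- The profiles of the electric and magnetic components of `Aᵏ J`. -/
noncomputable def profile (ρ : ChargeDensity) : ℕ → (Fin 3 → E3 → E3) × (Fin 3 → E3 → E3)
  | 0 => (fun l x => (-(4 * Real.pi) * ρ x) • basisVec l, fun _ _ => 0)
  | k + 1 => (fun l => curl ((profile ρ k).2 l), fun l x => -curl ((profile ρ k).1 l) x)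

theorem IsTestField.neg {g : E3 → E3} (hg : IsTestField g) : IsTestField fun x => -g x :=
  ⟨hg.1.neg, hg.2.neg⟩

theorem isTestField_profile (ρ : ChargeDensity) (k : ℕ) (l : Fin 3) :
    IsTestField ((profile ρ k).1 l) ∧ IsTestField ((profile ρ k).2 l) := by
  induction k with
  | zero => exact ⟨IsTestField.smul_basisVec ρ _ l, contDiff_const, HasCompactSupport.zero⟩
  | succ k ih => exact ⟨ih.2.curl, ih.1.curl.neg⟩

/-- The composition `Aᵏ J`. -/
noncomputable def powJ (m : Fin N → ℝ) (e : Fin N → Fin N → ℝ) (ρ : Fin N → ChargeDensity) (k : ℕ)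
    (φ : PhaseSpace w N) : PhaseSpace w N :=
  PhaseSpace.mk (fun i => if k = 0 then velocity (m i) (PhaseSpace.p φ i) else 0)
    (fun i => if k = 0 then lorentzForce m e ρ φ i else 0)
    (fun i => moving w (profile (ρ i) k).1 (PhaseSpace.q φ i)
      (velocity (m i) (PhaseSpace.p φ i)))
    (fun i => moving w (profile (ρ i) k).2 (PhaseSpace.q φ i)
      (velocity (m i) (PhaseSpace.p φ i)))

theorem powJ_zero (m : Fin N → ℝ) (e : Fin N → Fin N → ℝ) (ρ : Fin N → ChargeDensity) :
    powJ (w := w) m e ρ 0 = opJ m e ρ := by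
  funext φ
  refine phase_ext (fun i => ?_) (fun i => ?_) (fun i => ?_) (fun i => ?_)
  · simp only [powJ, opJ, q_mk, if_true]
  · simp only [powJ, opJ, p_mk, if_true]
  · simp only [powJ, opJ, E_mk, current_eq, profile]
  · have h : translate w (fun _ => 1) (fun _ => 0) (PhaseSpace.q φ i) = 0 := by
      have := translate_smul (w := w) (a := fun _ => 1) (g := fun _ => 0) continuous_const
        ⟨contDiff_const, HasCompactSupport.zero⟩ 0 (PhaseSpace.q φ i)
      simpa using this
    simp only [powJ, opJ, B_mk, profile, moving, h, smul_zero, Finset.sum_const_zero, Pi.zero_apply]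

/-- Curl acts only on the profiles of the moving fields, and these remain test fields. `A` exchanges
the electric and magnetic slots and annihilates the particle slots, so those are nonzero at most for
`k = 0`. -/
theorem powJ_mem (m : Fin N → ℝ) (e : Fin N → Fin N → ℝ) (ρ : Fin N → ChargeDensity) (k : ℕ)
    (φ : PhaseSpace w N) : (powJ m e ρ k φ, powJ m e ρ (k + 1) φ) ∈ opGraph w N := by
  refine mem_opGraph.2 fun i => ⟨?_, ?_, ?_, ?_⟩
  · simp only [powJ, q_mk, Nat.add_eq_zero_iff, one_ne_zero, and_false, if_false]
  · simp only [powJ, p_mk, Nat.add_eq_zero_iff, one_ne_zero, and_false, if_false]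
  · exact moving_mem (fun l => (isTestField_profile (ρ i) k l).2) _ _
  · have h := moving_mem (w := w) (fun l => (isTestField_profile (ρ i) k l).1) (PhaseSpace.q φ i)
      (velocity (m i) (PhaseSpace.p φ i))
    simp only [powJ, E_mk, B_mk, profile]
    rwa [moving_neg fun l => (isTestField_profile (ρ i) k l).1.curl, neg_neg]

theorem tame_powJ {m : Fin N → ℝ} (hm : ∀ i, m i ≠ 0) (e : Fin N → Fin N → ℝ)
    (ρ : Fin N → ChargeDensity) (k : ℕ) : Tame (powJ (w := w) m e ρ k) := by
  have hq : ∀ i, Tame fun φ : PhaseSpace w N => PhaseSpace.q φ i := fun i =>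
    ContinuousLinearMap.tame (qL w i)
  have hv : ∀ i, Tame fun φ : PhaseSpace w N => velocity (m i) (PhaseSpace.p φ i) := fun i =>
    (ContinuousLinearMap.tame (pL w i)).comp_contDiff (contDiff_velocity (hm i))
  have hE : ∀ i, Tame fun φ : PhaseSpace w N => PhaseSpace.E φ i := fun i =>
    ContinuousLinearMap.tame (EL w i)
  have hB : ∀ i, Tame fun φ : PhaseSpace w N => PhaseSpace.B φ i := fun i =>
    ContinuousLinearMap.tame (BL w i)
  have hF : ∀ i, Tame fun φ : PhaseSpace w N => lorentzForce m e ρ φ i := fun i => by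
    simp only [lorentzForce_eq]
    exact Tame.sum _ fun j => (Tame.const (e i j)).smul
      ((tame_smear (hq i) (hE j) _).add ((hv i).bilin (tame_smear (hq i) (hB j) _) crossL))
  have h1 : ∀ i, Tame fun φ : PhaseSpace w N =>
      if k = 0 then velocity (m i) (PhaseSpace.p φ i) else 0 := fun i => by
    split_ifs
    exacts [hv i, Tame.const 0]
  have h2 : ∀ i, Tame fun φ : PhaseSpace w N =>
      if k = 0 then lorentzForce m e ρ φ i else 0 := fun i => by
    split_ifs
    exacts [hF i, Tame.const 0]
  refine Tame.clm_comp (Tame.pi fun i => ((h1 i).prodMk (h2 i)).prodMk (Tame.prodMk ?_ ?_))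
    (assemble w N)
  · exact tame_moving (hq i) (hv i) fun l => (isTestField_profile (ρ i) k l).1
  · exact tame_moving (hq i) (hv i) fun l => (isTestField_profile (ρ i) k l).2

end Nonlinearity

end MaxwellLorentz

namespace MaxwellLorentz

open Filter Topology Set

/-! ### Linear growth of the nonlinearity -/

section Growth

variable {w : Weight} {N : ℕ}

theorem abs_sign_le_one (m : ℝ) : |Real.sign m| ≤ 1 := by
  rcases Real.sign_apply_eq m with h | h | h <;> simp [h]

theorem norm_velocity_le_one {m : ℝ} (hm : m ≠ 0) (p : E3) : ‖velocity m p‖ ≤ 1 := by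
  have hs : 0 < √(m ^ 2 + ‖p‖ ^ 2) := Real.sqrt_pos.2 (by positivity)
  rw [velocity, norm_smul, norm_div, Real.norm_of_nonneg hs.le, div_mul_eq_mul_div, div_le_one hs]
  have h1 : ‖p‖ ≤ √(m ^ 2 + ‖p‖ ^ 2) := Real.le_sqrt_of_sq_le (by linarith [sq_nonneg m])
  exact (mul_le_of_le_one_left (norm_nonneg _) (abs_sign_le_one m)).trans h1

/-- The bound by one gives finite speed; this one, linear in `p`, is what lets `J` be estimated by a
multiple of `‖φ‖` without an additive constant. -/
theorem norm_velocity_le {m : ℝ} (hm : m ≠ 0) (p : E3) : ‖velocity m p‖ ≤ |m|⁻¹ * ‖p‖ := by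
  have hm' : 0 < |m| := abs_pos.2 hm
  have h1 : |m| ≤ √(m ^ 2 + ‖p‖ ^ 2) :=
    Real.le_sqrt_of_sq_le (by rw [sq_abs]; linarith [sq_nonneg ‖p‖])
  rw [velocity, norm_smul, norm_div, Real.norm_of_nonneg (Real.sqrt_nonneg _), ← one_div]
  gcongr
  exact abs_sign_le_one m

theorem Weight.sqrt_factor_mono (w : Weight) {r s : ℝ} (hr : 0 ≤ r) (h : r ≤ s) :
    √(w.factor r) ≤ √(w.factor s) := Real.sqrt_le_sqrt (w.factor_mono hr h)

theorem memLp_density (w : Weight) (ρ : ChargeDensity) : MemLp (ρ : E3 → ℝ) 2 w.measure :=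
  ρ.contDiff.continuous.memLp_of_hasCompactSupport ρ.hasCompactSupport

theorem norm_current_le (ρ : ChargeDensity) (q v : E3) :
    ‖current w ρ q v‖ ≤ 4 * Real.pi * ‖v‖ * (√(w.factor ‖q‖) * normL2w w ρ) := by
  have h1 : eLpNorm (fun x => (-(4 * Real.pi) * ρ (x - q)) • v) 2 w.measure ≤
      ENNReal.ofReal (4 * Real.pi * ‖v‖) * eLpNorm (fun x => ρ (x - q)) 2 w.measure := by
    refine eLpNorm_le_mul_eLpNorm_of_ae_le_mul (Eventually.of_forall fun x => ?_) 2
    rw [norm_smul, norm_mul, norm_neg, Real.norm_of_nonneg (by positivity)]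
    exact le_of_eq (by ring)
  have h2 := eLpNorm_translate_le (memLp_density w ρ).1 fun x => w.le_factor x q
  rw [current, Lp.norm_toLp]
  have hfin := (memLp_density w ρ).2.ne
  refine (ENNReal.toReal_mono ?_ (h1.trans (mul_le_mul_right h2 _))).trans_eq ?_
  · exact ENNReal.mul_ne_top ENNReal.ofReal_ne_top (ENNReal.mul_ne_top ENNReal.ofReal_ne_top hfin)
  · rw [ENNReal.toReal_mul, ENNReal.toReal_mul, ENNReal.toReal_ofReal (by positivity),
      ENNReal.toReal_ofReal (Real.sqrt_nonneg _)]
    rfl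

theorem memLp_inv_sqrt (w : Weight) (ρ : ChargeDensity) :
    MemLp (fun x => (√(w x))⁻¹ * ρ x) 2 (volume : Measure E3) := by
  refine Continuous.memLp_of_hasCompactSupport ?_ (ρ.hasCompactSupport.mul_left)
  exact (w.continuous.sqrt.inv₀ fun x => (Real.sqrt_pos.2 (w.pos x)).ne').mul
    ρ.contDiff.continuous

/-- Squaring, `w (w⁻¹)² = ((√w)⁻¹)²`. This is where the norm of `w^{-1/2} ϱ` in the growth bound
comes from. -/
theorem eLpNorm_inv_mul (w : Weight) (r : E3 → ℝ) :
    eLpNorm (fun x => (w x)⁻¹ * r x) 2 w.measure =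
      eLpNorm (fun x => (√(w x))⁻¹ * r x) 2 (volume : Measure E3) := by
  rw [eLpNorm_eq_lintegral_rpow_enorm_toReal (by norm_num) (by norm_num),
    eLpNorm_eq_lintegral_rpow_enorm_toReal (by norm_num) (by norm_num), Weight.measure,
    lintegral_withDensity_eq_lintegral_mul_non_measurable _
      w.continuous.measurable.ennreal_ofReal
      (Eventually.of_forall fun x => ENNReal.ofReal_lt_top)]
  congr 1
  refine lintegral_congr fun x => ?_
  have hw := w.pos x
  have hs := Real.sqrt_pos.2 hw
  simp only [Pi.mul_apply, ENNReal.toReal_ofNat, ENNReal.rpow_ofNat, ← ofReal_norm]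
  rw [← ENNReal.ofReal_pow (norm_nonneg _), ← ENNReal.ofReal_pow (norm_nonneg _),
    ← ENNReal.ofReal_mul hw.le]
  congr 1
  rw [norm_mul, norm_mul, mul_pow, mul_pow, Real.norm_of_nonneg (inv_pos.2 hw).le,
    Real.norm_of_nonneg (inv_pos.2 hs).le, inv_pow, inv_pow, Real.sq_sqrt hw.le]
  field_simp

theorem eLpNorm_inv_sqrt_translate_le (w : Weight) (ρ : ChargeDensity) (q : E3) :
    eLpNorm (fun x => (√(w x))⁻¹ * ρ (x - q)) 2 (volume : Measure E3) ≤
      ENNReal.ofReal (√(w.factor ‖q‖)) *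
        eLpNorm (fun x => (√(w x))⁻¹ * ρ x) 2 (volume : Measure E3) := by
  have h1 := eLpNorm_comp_measurePreserving (p := 2)
    (g := fun x => (√(w (x + q)))⁻¹ * ρ x) (f := fun x : E3 => x - q)
    (μ := volume) (ν := volume) (Continuous.aestronglyMeasurable (by
      have := w.continuous
      have := ρ.contDiff.continuous
      exact ((w.continuous.comp (continuous_id.add continuous_const)).sqrt.inv₀ fun x =>
        (Real.sqrt_pos.2 (w.pos _)).ne').mul ρ.contDiff.continuous))
    (measurePreserving_sub_right volume q)
  have e : (fun x => (√(w (x + q)))⁻¹ * ρ x) ∘ (fun x : E3 => x - q) =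
      fun x => (√(w x))⁻¹ * ρ (x - q) := by
    funext x
    simp only [Function.comp_apply, sub_add_cancel]
  rw [e] at h1
  rw [h1]
  refine eLpNorm_le_mul_eLpNorm_of_ae_le_mul (Eventually.of_forall fun x => ?_) 2
  have hw := Real.sqrt_pos.2 (w.pos x)
  have hw' := Real.sqrt_pos.2 (w.pos (x + q))
  rw [norm_mul, norm_mul, Real.norm_of_nonneg (inv_pos.2 hw).le,
    Real.norm_of_nonneg (inv_pos.2 hw').le, ← mul_assoc]
  gcongr
  have h2 := w.le_factor (x + q) (-q)
  rw [add_neg_cancel_right, norm_neg] at h2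
  have h3 := Real.sqrt_le_sqrt h2
  rw [Real.sqrt_mul (zero_le_one.trans (w.one_le_factor (norm_nonneg q)))] at h3
  rw [inv_le_iff_one_le_mul₀ hw', ← div_eq_mul_inv, div_mul_eq_mul_div, le_div_iff₀ hw, one_mul]
  exact h3

/-- Cauchy–Schwarz in `L²_w` for `w⁻¹ ϱ(· - q)` against `f`, followed by the growth condition on `w`
to undo the shift by `q`. -/
theorem norm_smear_le (ρ : ChargeDensity) (q : E3) (f : L2w w) :
    ‖smear w ρ q f‖ ≤ √(w.factor ‖q‖) * normInvSqrt w ρ * ‖f‖ := by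
  have hc : Continuous fun x => (w x)⁻¹ * ρ (x - q) := w.continuous_inv.mul
    (ρ.contDiff.continuous.comp (continuous_id.sub continuous_const))
  have hm : MemLp (fun x => (w x)⁻¹ * ρ (x - q)) 2 w.measure :=
    hc.memLp_of_hasCompactSupport
      (ρ.hasCompactSupport.comp_homeomorph (Homeomorph.subRight q)).mul_left
  have hf := (Lp.memLp f).norm
  have h1 : ‖smear w ρ q f‖ ≤ ∫ x, ‖(w x)⁻¹ * ρ (x - q)‖ * ‖(f : E3 → E3) x‖ ∂w.measure := by
    rw [smear_eq, integral_measure]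
    refine (norm_integral_le_integral_norm _).trans_eq (integral_congr_ae
      (Eventually.of_forall fun x => ?_))
    have hw := w.pos x
    simp only
    rw [norm_smul, norm_mul, Real.norm_of_nonneg (inv_pos.2 hw).le]
    field_simp
  have h2 := real_inner_le_norm (hm.norm.toLp _) (hf.toLp _)
  rw [Lp.norm_toLp, Lp.norm_toLp, eLpNorm_norm, eLpNorm_norm, L2.inner_def, eLpNorm_inv_mul] at h2
  have h3 : ∫ x, ‖(w x)⁻¹ * ρ (x - q)‖ * ‖(f : E3 → E3) x‖ ∂w.measure ≤
      (eLpNorm (fun x => (√(w x))⁻¹ * ρ (x - q)) 2 (volume : Measure E3)).toReal * ‖f‖ := by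
    refine le_trans (le_of_eq (integral_congr_ae ?_)) h2
    filter_upwards [hm.norm.coeFn_toLp, hf.coeFn_toLp] with x h4 h5
    rw [h4, h5]
    simp [mul_comm]
  refine h1.trans (h3.trans ?_)
  gcongr
  refine (ENNReal.toReal_mono (ENNReal.mul_ne_top ENNReal.ofReal_ne_top (memLp_inv_sqrt w ρ).2.ne)
    (eLpNorm_inv_sqrt_translate_le w ρ q)).trans_eq ?_
  rw [ENNReal.toReal_mul, ENNReal.toReal_ofReal (Real.sqrt_nonneg _)]
  rfl

theorem norm_mk_le (q p : Fin N → E3) (E B : Fin N → L2w w) :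
    ‖PhaseSpace.mk q p E B‖ ≤ ∑ i, (‖q i‖ + ‖p i‖ + ‖E i‖ + ‖B i‖) := by
  refine le_of_sq_le_sq ?_ (by positivity)
  rw [norm_sq_phase, sq, Finset.sum_mul]
  refine Finset.sum_le_sum fun i _ => ?_
  have h1 := Finset.single_le_sum (f := fun i => ‖q i‖ + ‖p i‖ + ‖E i‖ + ‖B i‖)
    (fun i _ => by positivity) (Finset.mem_univ i)
  simp only [q_mk, p_mk, E_mk, B_mk]
  refine le_trans ?_ (mul_le_mul_of_nonneg_left h1 (by positivity))
  have hq := norm_nonneg (q i)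
  have hp := norm_nonneg (p i)
  have hE := norm_nonneg (E i)
  have hB := norm_nonneg (B i)
  nlinarith [mul_nonneg hq hp, mul_nonneg hq hE, mul_nonneg hq hB, mul_nonneg hp hE,
    mul_nonneg hp hB, mul_nonneg hE hB]

/-- The positions of all particles. -/
noncomputable def positions (w : Weight) (N : ℕ) : PhaseSpace w N →L[ℝ] (Fin N → E3) :=
  ContinuousLinearMap.pi fun i => qL w i

theorem norm_positions_le (φ : PhaseSpace w N) : ‖positions w N φ‖ ≤ ‖φ‖ :=
  (pi_norm_le_iff_of_nonneg (norm_nonneg _)).2 fun i => (norm_component_le φ i).1.1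

theorem norm_q_le (φ : PhaseSpace w N) (i : Fin N) :
    ‖PhaseSpace.q φ i‖ ≤ max ‖positions w N φ‖ 0 :=
  (norm_le_pi_norm (positions w N φ) i).trans (le_max_left _ _)

/-- The growth factor of the nonlinearity in terms of a bound `r` on the positions and the norms
`a`, `b` of the charge densities. -/
noncomputable def growthFactor (w : Weight) (m : Fin N → ℝ) (e : Fin N → Fin N → ℝ)
    (r : ℝ) (a b : Fin N → ℝ≥0) : ℝ :=
  ∑ i, (|m i|⁻¹ + (∑ j, |e i j|) * (2 * (√(w.factor (max r 0)) * a i)) +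
    4 * Real.pi * |m i|⁻¹ * (√(w.factor (max r 0)) * b i))

theorem growthFactor_nonneg (m : Fin N → ℝ) (e : Fin N → Fin N → ℝ) (r : ℝ) (a b : Fin N → ℝ≥0) :
    0 ≤ growthFactor w m e r a b := by
  unfold growthFactor
  positivity

theorem growthFactor_mono (m : Fin N → ℝ) (e : Fin N → Fin N → ℝ) {r r' : ℝ}
    {a a' b b' : Fin N → ℝ≥0} (hr : r ≤ r') (ha : a ≤ a') (hb : b ≤ b') :
    growthFactor w m e r a b ≤ growthFactor w m e r' a' b' := by
  have h := w.sqrt_factor_mono (le_max_right r 0) (max_le_max_right 0 hr)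
  unfold growthFactor
  gcongr with i _ i
  · exact ha i
  · exact hb i

theorem continuous_growthFactor (w : Weight) (m : Fin N → ℝ) (e : Fin N → Fin N → ℝ) :
    Continuous fun x : ℝ × (Fin N → ℝ≥0) × (Fin N → ℝ≥0) =>
      growthFactor w m e x.1 x.2.1 x.2.2 := by
  have := w.continuous_factor
  unfold growthFactor
  fun_prop

theorem norm_lorentzForce_le {m : Fin N → ℝ} (hm : ∀ i, m i ≠ 0) (e : Fin N → Fin N → ℝ)
    (ρ : Fin N → ChargeDensity) (φ : PhaseSpace w N) (i : Fin N) :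
    ‖lorentzForce m e ρ φ i‖ ≤ (∑ j, |e i j|) *
      (2 * (√(w.factor (max ‖positions w N φ‖ 0)) * normInvSqrt w (ρ i))) * ‖φ‖ := by
  rw [lorentzForce_eq, Finset.sum_mul, Finset.sum_mul]
  refine norm_sum_le_of_le _ fun j _ => ?_
  rw [norm_smul, Real.norm_eq_abs, mul_assoc]
  gcongr
  have hs : ∀ f : L2w w, ‖f‖ ≤ ‖φ‖ → ‖smear w (ρ i) (PhaseSpace.q φ i) f‖ ≤
      √(w.factor (max ‖positions w N φ‖ 0)) * normInvSqrt w (ρ i) * ‖φ‖ := fun f hf =>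
    (norm_smear_le _ _ _).trans (by
      have := w.sqrt_factor_mono (norm_nonneg _) (norm_q_le φ i)
      gcongr)
  have h1 := hs _ (norm_component_le φ j).2.1
  have h2 := hs _ (norm_component_le φ j).2.2
  have h3 := norm_cross_le (velocity (m i) (PhaseSpace.p φ i))
    (smear w (ρ i) (PhaseSpace.q φ i) (PhaseSpace.B φ j))
  have h4 := mul_le_of_le_one_left (norm_nonneg (smear w (ρ i) (PhaseSpace.q φ i)
    (PhaseSpace.B φ j))) (norm_velocity_le_one (hm i) (PhaseSpace.p φ i))
  rw [crossL_apply]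
  refine (norm_add_le _ _).trans ?_
  linarith

/-- The three summands of the factor bound velocity, Lorentz force and current. The force is linear
in the fields once `‖v‖ ≤ 1` is used, with a factor two for its electric and magnetic parts;
velocity and current are linear in `p`. Truncating the radius at zero makes the factor nonnegative
and monotone on the whole real line. -/
theorem linearGrowth_opJ {m : Fin N → ℝ} (hm : ∀ i, m i ≠ 0) (e : Fin N → Fin N → ℝ)
    (ρ : Fin N → ChargeDensity) :
    Evolution.LinearGrowth (opJ (w := w) m e ρ) (positions w N) 1 fun r =>
      growthFactor w m e r (fun i => normInvSqrt w (ρ i)) (fun i => normL2w w (ρ i)) where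
  norm_proj_le φ := (pi_norm_le_iff_of_nonneg zero_le_one).2 fun i =>
    norm_velocity_le_one (hm i) (PhaseSpace.p φ i)
  monotone r r' h := growthFactor_mono m e h le_rfl le_rfl
  nonneg r := growthFactor_nonneg _ _ _ _ _
  norm_le φ := by
    refine (norm_mk_le _ _ _ _).trans ?_
    rw [growthFactor, Finset.sum_mul]
    refine Finset.sum_le_sum fun i _ => ?_
    have h1 : ‖velocity (m i) (PhaseSpace.p φ i)‖ ≤ |m i|⁻¹ * ‖φ‖ :=
      (norm_velocity_le (hm i) _).trans (by gcongr; exact (norm_component_le φ i).1.2)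
    have h2 := norm_lorentzForce_le hm e ρ φ i
    have h3 : ‖current w (ρ i) (PhaseSpace.q φ i) (velocity (m i) (PhaseSpace.p φ i))‖ ≤
        4 * Real.pi * (|m i|⁻¹ * ‖φ‖) *
          (√(w.factor (max ‖positions w N φ‖ 0)) * normL2w w (ρ i)) :=
      (norm_current_le _ _ _).trans (by
        have := w.sqrt_factor_mono (norm_nonneg _) (norm_q_le φ i)
        gcongr)
    rw [Pi.zero_apply, norm_zero, add_zero]
    refine (add_le_add (add_le_add h1 h2) h3).trans_eq ?_
    ring

end Growth

end MaxwellLorentz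

namespace MaxwellLorentz

open Filter Topology Set

/-! ### Existence, uniqueness and bounds for solutions -/

/-- A continuous monotone majorant of a sequence of nonnegative numbers. -/
theorem exists_continuous_monotone_majorant (L : ℕ → ℝ≥0) :
    ∃ g : ℝ → ℝ, Continuous g ∧ Monotone g ∧ (∀ x, 0 ≤ g x) ∧ ∀ x, (L ⌈x⌉₊ : ℝ) ≤ g x := by
  -- Partial sums make a monotone step function above the sequence. Averaging it over `[x, x + 1]`
  -- makes it continuous and, by monotonicity, keeps it above `F x`.
  let F : ℝ → ℝ := fun s => ∑ k ∈ Finset.range (⌈s⌉₊ + 1), (L k : ℝ)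
  have hF : Monotone F := fun s t h => Finset.sum_le_sum_of_subset_of_nonneg
    (Finset.range_subset_range.2 (by have := Nat.ceil_mono h; omega)) fun _ _ _ => (L _).2
  have hF0 : ∀ s, 0 ≤ F s := fun s => Finset.sum_nonneg fun _ _ => (L _).2
  have hint : ∀ a b, IntervalIntegrable F volume a b := fun a b => hF.intervalIntegrable
  have hg : ∀ x, ∫ s in x..x + 1, F s = ∫ s in (0 : ℝ)..1, F (s + x) := fun x => by
    rw [intervalIntegral.integral_comp_add_right, zero_add, add_comm]
  have hint' : ∀ x, IntervalIntegrable (fun s => F (s + x)) volume 0 1 := fun x =>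
    Monotone.intervalIntegrable fun s t h => hF (by linarith)
  refine ⟨fun x => ∫ s in x..x + 1, F s, ?_, fun x y h => ?_, fun x => ?_, fun x => ?_⟩
  · have h := intervalIntegral.continuous_primitive hint 0
    have e : (fun x => ∫ s in x..x + 1, F s) =
        fun x => (∫ s in (0 : ℝ)..x + 1, F s) - ∫ s in (0 : ℝ)..x, F s := funext fun x =>
      (intervalIntegral.integral_interval_sub_left (hint _ _) (hint _ _)).symm
    rw [e]
    exact (h.comp (continuous_id.add continuous_const)).sub h
  · simp only [hg]
    exact intervalIntegral.integral_mono_on zero_le_one (hint' x) (hint' y) fun s _ =>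
      hF (by linarith)
  · exact intervalIntegral.integral_nonneg (by linarith) fun s _ => hF0 s
  · have h1 : (L ⌈x⌉₊ : ℝ) ≤ F x :=
      Finset.single_le_sum (f := fun k => (L k : ℝ)) (fun _ _ => (L _).2)
        (Finset.mem_range.2 (Nat.lt_succ_self _))
    have h2 : ∫ s in x..x + 1, F x ≤ ∫ s in x..x + 1, F s :=
      intervalIntegral.integral_mono_on (by linarith) (by simp) (hint _ _) fun s hs => hF hs.1
    rw [intervalIntegral.integral_const, add_sub_cancel_left, one_smul] at h2
    exact h1.trans h2

section Solutions

variable {w : Weight} {N : ℕ} {m : Fin N → ℝ} {e : Fin N → Fin N → ℝ} {ρ : Fin N → ChargeDensity}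
  {Λ : Set ℝ} {φ ψ : ℝ → PhaseSpace w N}

theorem positions_eq_zero (x z : PhaseSpace w N) (h : (x, z) ∈ opGraph w N) :
    positions w N z = 0 :=
  funext fun i => (mem_opGraph.1 h i).1

theorem IsSolutionOn.isStrongSol (h : IsSolutionOn m e ρ Λ φ) :
    Evolution.IsStrongSol (opGraph w N) (opJ m e ρ) φ Λ :=
  fun t ht => ⟨opA (φ t), opA_mem (h.mem_domA t ht), h.hasDerivAt t ht⟩

theorem lipschitz_opJ (hm : ∀ i, m i ≠ 0) (e : Fin N → Fin N → ℝ) (ρ : Fin N → ChargeDensity)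
    (R : ℝ) : ∃ L, LipschitzOnWith L (opJ (w := w) m e ρ) (Metric.closedBall 0 R) := by
  have := (tame_powJ (w := w) hm e ρ 0).lipschitz R
  rwa [powJ_zero] at this

theorem IsSolutionOn.eq_of_eq (hm : ∀ i, m i ≠ 0) (hw : w.MemClass 1)
    (hφ : IsSolutionOn m e ρ Set.univ φ) (hΛ : Λ.OrdConnected) (hψ : IsSolutionOn m e ρ Λ ψ)
    {s t : ℝ} (hs : s ∈ Λ) (ht : t ∈ Λ) (h : ψ s = φ s) : φ t = ψ t := by
  obtain ⟨γ, -, hskew, -⟩ := exists_group hw N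
  exact (hφ.isStrongSol.mono (subset_univ _)).eq_of_eq (hψ.isStrongSol.mono (hΛ.uIcc_subset hs ht))
    hskew (lipschitz_opJ hm e ρ) h.symm

theorem exists_isSolutionOn (hm : ∀ i, m i ≠ 0) (hw : w.MemClass 1) (e : Fin N → Fin N → ℝ)
    (ρ : Fin N → ChargeDensity) {n : ℕ} (hn : 1 ≤ n) {φ₀ : PhaseSpace w N}
    (h0 : φ₀ ∈ domPow w N n) :
    ∃ φ : ℝ → PhaseSpace w N, ContDiff ℝ n φ ∧ φ 0 = φ₀ ∧ IsSolutionOn m e ρ Set.univ φ ∧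
      ∀ t : ℝ, ∀ j ≤ n, iteratedDeriv j φ t ∈ domPow w N (n - j) := by
  obtain ⟨γ, hγ, hskew, W, hW⟩ := exists_group hw N
  have hG := isClosed_opGraph w N
  have hx := chain_of_mem_domPow h0
  have ht := fun k => tame_powJ (w := w) hm e ρ k
  obtain ⟨φ, hφ0, hφ⟩ := Evolution.exists_isStrongSol hγ hW hG hskew positions_eq_zero
    (linearGrowth_opJ hm e ρ) (lipschitz_opJ hm e ρ) (ht 1).contDiff.continuous
    (fun x => by simpa only [powJ_zero] using powJ_mem m e ρ 0 x) (hx 0 hn)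
  rw [← powJ_zero] at hφ
  obtain ⟨Φ, hΦ0, hΦ, hsm⟩ := hφ.exists_chain hW hG hskew hn hx (fun k => (ht k).contDiff)
    (powJ_mem m e ρ) hφ0
  rw [powJ_zero] at hφ
  have hc : ContDiff ℝ n φ := hΦ0 ▸ hsm n 0 (by omega)
  refine ⟨φ, hc, hφ0, ⟨(hc.of_le (by exact_mod_cast hn)).contDiffOn, fun t _ => ?_, fun t _ => ?_⟩,
    fun t j hj => ?_⟩
  · obtain ⟨z, hz, -⟩ := hφ t (mem_univ t)
    exact mem_domA_of_mem hz
  · obtain ⟨z, hz, hd⟩ := hφ t (mem_univ t)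
    rwa [opA_eq_of_mem hz]
  -- The `j`-th time derivatives of the curves `Aᵏ φ` again form a chain in the graph.
  -- Differentiating `Φ k` and `Φ (k + 1)` `j` times leaves room for `n - j` links.
  · rw [← hΦ0]
    exact mem_domPow_of_chain (x := fun k => iteratedDeriv j (Φ k) t) fun k hk =>
      Evolution.iteratedDeriv_mem_graph hG j (hsm j k (by omega)) (hsm j (k + 1) (by omega))
        (hΦ k (by omega)) t

theorem exists_growth_bound (hm : ∀ i, m i ≠ 0) (e : Fin N → Fin N → ℝ) (hw : w.MemClass 1) :
    ∃ C : ℝ≥0 × ℝ≥0 × (Fin N → ℝ≥0) × (Fin N → ℝ≥0) → ℝ≥0, IsBound C ∧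
      ∀ (ρ : Fin N → ChargeDensity) (φ : ℝ → PhaseSpace w N),
        IsSolutionOn m e ρ Set.univ φ →
        ∀ T : ℝ≥0, 0 < T → ∀ t ∈ Set.Icc (-(T : ℝ)) T,
          ‖φ t‖ ≤ C (T, ‖φ 0‖₊, (fun i => normInvSqrt w (ρ i)), (fun i => normL2w w (ρ i))) *
            ‖φ 0‖ := by
  obtain ⟨γ, hγ, hskew, -⟩ := exists_group hw N
  -- The positions start within `‖φ 0‖` and travel at most `T`. The constant `γ` depends on `A`
  -- alone, so the densities enter through their two norms only.
  refine ⟨fun x => (Real.exp ((γ + growthFactor w m e (x.2.1 + x.1) x.2.2.1 x.2.2.2) *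
    x.1)).toNNReal, ⟨?_, ?_⟩, fun ρ φ hφ T _ t ht => ?_⟩
  · have h := (continuous_growthFactor w m e).comp (g := fun x => growthFactor w m e x.1 x.2.1 x.2.2)
      (f := fun x : ℝ≥0 × ℝ≥0 × (Fin N → ℝ≥0) × (Fin N → ℝ≥0) =>
        ((x.2.1 : ℝ) + x.1, x.2.2.1, x.2.2.2)) (by fun_prop)
    have h' : Continuous fun x : ℝ≥0 × ℝ≥0 × (Fin N → ℝ≥0) × (Fin N → ℝ≥0) =>
      growthFactor w m e (x.2.1 + x.1) x.2.2.1 x.2.2.2 := h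
    fun_prop
  · rintro x y ⟨h1, h2, h3, h4⟩
    have h1' : (x.1 : ℝ) ≤ y.1 := h1
    have h2' : (x.2.1 : ℝ) ≤ y.2.1 := h2
    have h5 := growthFactor_mono (w := w) m e (add_le_add h2' h1') h3 h4
    have h6 := growthFactor_nonneg (w := w) m e (y.2.1 + y.1) y.2.2.1 y.2.2.2
    dsimp only
    gcongr
  · have ht' : |t| ≤ T := abs_le.2 ht
    have h1 := (hφ.isStrongSol.mono (subset_univ (uIcc 0 t))).norm_le hskew positions_eq_zero
      (linearGrowth_opJ hm e ρ)
    rw [sub_zero] at h1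
    rw [Real.coe_toNNReal _ (Real.exp_pos _).le]
    refine h1.trans ?_
    have h2 : ‖positions w N (φ 0)‖ + 1 * |t| ≤ ‖φ 0‖ + T :=
      add_le_add (norm_positions_le _) (by rwa [one_mul])
    have h3 := growthFactor_mono (w := w) m e h2 (le_refl fun i => normInvSqrt w (ρ i))
      (le_refl fun i => normL2w w (ρ i))
    have h4 := growthFactor_nonneg (w := w) m e (‖φ 0‖ + T) (fun i => normInvSqrt w (ρ i))
      (fun i => normL2w w (ρ i))
    simp only [coe_nnnorm]
    gcongr

theorem exists_lipschitz_bound (hm : ∀ i, m i ≠ 0) (e : Fin N → Fin N → ℝ) (hw : w.MemClass 1)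
    (ρ : Fin N → ChargeDensity) :
    ∃ C : ℝ≥0 × ℝ≥0 × ℝ≥0 → ℝ≥0, IsBound C ∧
      ∀ φ : ℝ → PhaseSpace w N, IsSolutionOn m e ρ Set.univ φ →
      ∀ (Λ : Set ℝ) (ψ : ℝ → PhaseSpace w N), Λ.OrdConnected → IsSolutionOn m e ρ Λ ψ →
        ∀ T : ℝ≥0, ∀ t₀ ∈ Set.Icc (-(T : ℝ)) T ∩ Λ, ∀ t ∈ Set.Icc (-(T : ℝ)) T ∩ Λ,
          ‖φ t - ψ t‖ ≤ C (T, ‖φ t₀‖₊, ‖ψ t₀‖₊) * ‖φ t₀ - ψ t₀‖ := by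
  obtain ⟨γ, hγ, hskew, -⟩ := exists_group hw N
  choose L hL using fun n : ℕ => lipschitz_opJ (w := w) hm e ρ n
  obtain ⟨g, hgc, hgm, hg0, hgL⟩ := exists_continuous_monotone_majorant L
  have hlin := linearGrowth_opJ (w := w) hm e ρ
  set K : ℝ → ℝ := fun r =>
    growthFactor w m e r (fun i => normInvSqrt w (ρ i)) (fun i => normL2w w (ρ i)) with hK
  have hKc : Continuous K := (continuous_growthFactor w m e).comp
    (f := fun r => (r, (fun i => normInvSqrt w (ρ i)), (fun i => normL2w w (ρ i)))) (by fun_prop)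
  have hKm : Monotone K := hlin.monotone
  have hK0 : ∀ r, 0 ≤ K r := hlin.nonneg
  clear_value K
  -- A priori bound for an orbit that has norm `a` at `t₀`; two times in `[-T, T]` are at most `2 T`
  -- apart.
  let R : ℝ≥0 → ℝ≥0 → ℝ := fun T a => Real.exp ((γ + K (a + 2 * T)) * (2 * T)) * a
  have hRc : Continuous fun x : ℝ≥0 × ℝ≥0 => R x.1 x.2 := by fun_prop
  have hRm : ∀ {T T' a a' : ℝ≥0}, T ≤ T' → a ≤ a' → R T a ≤ R T' a' := by
    intro T T' a a' h1 h2
    have h1' : (T : ℝ) ≤ T' := h1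
    have h2' : (a : ℝ) ≤ a' := h2
    have h3 : K (a + 2 * T) ≤ K (a' + 2 * T') := hKm (by linarith)
    have h4 := hK0 (a' + 2 * T')
    dsimp only [R]
    gcongr
  have hbound : ∀ {χ : ℝ → PhaseSpace w N} {s r : ℝ} {T : ℝ≥0},
      Evolution.IsStrongSol (opGraph w N) (opJ m e ρ) χ (uIcc s r) → |r - s| ≤ 2 * T →
      ‖χ r‖ ≤ R T ‖χ s‖₊ := by
    intro χ s r T h hr
    refine (h.norm_le hskew positions_eq_zero hlin).trans ?_
    have h2 : K (‖positions w N (χ s)‖ + 1 * |r - s|) ≤ K (‖χ s‖ + 2 * T) :=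
      hKm (add_le_add (norm_positions_le _) (by rwa [one_mul]))
    have h4 := hK0 (‖χ s‖ + 2 * T)
    dsimp only [R]
    rw [coe_nnnorm]
    gcongr
  -- The Lipschitz constants of `J` on balls are chosen radius by radius and need not vary
  -- monotonically. The majorant `g` replaces them by a continuous monotone function of the radius,
  -- as a bounding function requires.
  refine ⟨fun x => (Real.exp ((γ + g (R x.1 (max x.2.1 x.2.2))) * (2 * x.1))).toNNReal,
    ⟨?_, ?_⟩, fun φ hφ Λ ψ hΛ hψ T t₀ ht₀ t ht => ?_⟩
  · have := hRc.comp (f := fun x : ℝ≥0 × ℝ≥0 × ℝ≥0 => (x.1, max x.2.1 x.2.2)) (by fun_prop)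
    have h' : Continuous fun x : ℝ≥0 × ℝ≥0 × ℝ≥0 => R x.1 (max x.2.1 x.2.2) := this
    clear_value R
    fun_prop
  · rintro x y ⟨h1, h2, h3⟩
    have h1' : (x.1 : ℝ) ≤ y.1 := h1
    have h4 := hgm (hRm h1 (max_le_max h2 h3))
    have h5 := hg0 (R y.1 (max y.2.1 y.2.2))
    dsimp only
    gcongr
  · have hsub : uIcc t₀ t ⊆ Λ := hΛ.uIcc_subset ht₀.2 ht.2
    have hd : |t - t₀| ≤ 2 * T := by
      rw [abs_le]
      constructor <;> linarith [ht.1.1, ht.1.2, ht₀.1.1, ht₀.1.2]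
    have hr : ∀ r ∈ uIcc t₀ t, |r - t₀| ≤ 2 * T := fun r hr =>
      (abs_sub_left_of_mem_uIcc hr).trans hd
    have hφ' := hφ.isStrongSol.mono (subset_univ (uIcc t₀ t))
    have hψ' := hψ.isStrongSol.mono hsub
    have h1 := hφ'.norm_sub_le hψ' hskew (hL ⌈R T (max ‖φ t₀‖₊ ‖ψ t₀‖₊)⌉₊)
      (fun r hr' => ((hbound (hφ'.mono (uIcc_subset_uIcc_left hr')) (hr r hr')).trans
        (hRm le_rfl (le_max_left _ _))).trans (Nat.le_ceil _))
      (fun r hr' => ((hbound (hψ'.mono (uIcc_subset_uIcc_left hr')) (hr r hr')).trans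
        (hRm le_rfl (le_max_right _ _))).trans (Nat.le_ceil _))
    rw [Real.coe_toNNReal _ (Real.exp_pos _).le]
    refine h1.trans ?_
    have h2 := hgL (R T (max ‖φ t₀‖₊ ‖ψ t₀‖₊))
    have h3 := hg0 (R T (max ‖φ t₀‖₊ ‖ψ t₀‖₊))
    dsimp only
    gcongr

end Solutions

end MaxwellLorentz

namespace MaxwellLorentz

open Filter Topology Set

/-! ### Persistence of the Maxwell constraints -/

section Gradient

variable {η : E3 → ℝ}

theorem gradient_coord (η : E3 → ℝ) (x : E3) (k : Fin 3) :
    gradient η x k = fderiv ℝ η x (basisVec k) := by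
  have h := inner_gradient_left (𝕜 := ℝ) (f := η) (x := x) (y := basisVec k)
  rw [EuclideanSpace.inner_single_right] at h
  simpa using h

theorem gradient_eq_sum (η : E3 → ℝ) (x : E3) :
    gradient η x = ∑ k, fderiv ℝ η x (basisVec k) • basisVec k := by
  conv_lhs => rw [← sum_smul_basisVec (gradient η x)]
  simp only [gradient_coord]

theorem IsTestField.gradient (hη : ContDiff ℝ ∞ η) (hc : HasCompactSupport η) :
    IsTestField (gradient η) := by
  have h : _root_.gradient η = fun x => ∑ k, fderiv ℝ η x (basisVec k) • basisVec k :=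
    funext (gradient_eq_sum η)
  rw [h]
  refine IsTestField.sum Finset.univ fun k => ⟨?_, ?_⟩
  · exact ((hη.fderiv_right (m := ∞) (by simp)).clm_apply contDiff_const).smul contDiff_const
  · exact (hc.fderiv_apply ℝ (basisVec k)).smul_right

/-- Symmetry of second derivatives. -/
theorem curl_gradient (hη : ContDiff ℝ ∞ η) (x : E3) : curl (gradient η) x = 0 := by
  have hd : Differentiable ℝ (fderiv ℝ η) :=
    (hη.fderiv_right (m := ∞) (by simp)).differentiable (by simp)
  have hs : IsSymmSndFDerivAt ℝ η x :=
    hη.contDiffAt.isSymmSndFDerivAt (by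
      rw [minSmoothness_of_isRCLikeNormedField]; exact WithTop.coe_le_coe.2 le_top)
  have hp : ∀ j k, partialDeriv (gradient η) j k x =
      fderiv ℝ (fderiv ℝ η) x (basisVec j) (basisVec k) := by
    intro j k
    have h1 : DifferentiableAt ℝ (gradient η) x := by
      rw [show gradient η = fun x => ∑ k, fderiv ℝ η x (basisVec k) • basisVec k from
        funext (gradient_eq_sum η)]
      fun_prop
    have h2 : HasFDerivAt (fun y => fderiv ℝ η y (basisVec k))
        ((EuclideanSpace.proj (𝕜 := ℝ) k).comp (fderiv ℝ (gradient η) x)) x := by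
      simp only [← gradient_coord]
      exact (EuclideanSpace.proj (𝕜 := ℝ) k).hasFDerivAt.comp x h1.hasFDerivAt
    have h3 := h2.unique ((hd x).hasFDerivAt.clm_apply (hasFDerivAt_const (basisVec k) x))
    simpa [partialDeriv] using DFunLike.congr_fun h3 (basisVec j)
  simp only [curl, hp]
  ext l
  fin_cases l <;> simp [hs.eq, sub_self]

end Gradient

/-! ### Moving charge and current against test functions -/

section Charge

variable {w : Weight}

/-- As a function of `q` the integral is the convolution of `η` with the reflected density, so the
derivative can be put on `η`. -/
theorem hasFDerivAt_charge (ρ : ChargeDensity) {η : E3 → ℝ} (hη : ContDiff ℝ ∞ η)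
    (hc : HasCompactSupport η) (q : E3) :
    ∃ D : E3 →L[ℝ] ℝ, HasFDerivAt (fun q => ∫ x, ρ (x - q) * η x) D q ∧
      ∀ v, D v = ∫ x, ρ (x - q) * fderiv ℝ η x v := by
  have hr : Continuous fun x => ρ (-x) := ρ.contDiff.continuous.comp continuous_neg
  have h := hc.hasFDerivAt_convolution_left (ContinuousLinearMap.mul ℝ ℝ)
    (hη.of_le (by exact_mod_cast le_top)) (hr.locallyIntegrable (μ := volume)) q
  refine ⟨convolution (fderiv ℝ η) (fun x => ρ (-x)) ((ContinuousLinearMap.mul ℝ ℝ).precompL E3) volume q, ?_, fun v => ?_⟩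
  · convert! h using 2 with q
    simp [convolution, mul_comm]
  · have hcv := hc.fderiv (𝕜 := ℝ)
    have hi := (hcv.convolutionExists_left
      ((ContinuousLinearMap.mul ℝ ℝ).precompL E3)
      (hη.continuous_fderiv (by simp)) (hr.locallyIntegrable (μ := volume)) q)
    rw [convolution, ContinuousLinearMap.integral_apply hi]
    simp [mul_comm]

/-- With the preceding derivative formula this is the continuity equation in weak form: the
divergence of the current balances the change of the moving charge. -/
theorem pair_current (ρ : ChargeDensity) (q v : E3) {η : E3 → ℝ} (hη : ContDiff ℝ ∞ η)
    (hc : HasCompactSupport η) :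
    pair w (gradient η) (current w ρ q v) =
      -(4 * Real.pi * ∫ x, ρ (x - q) * fderiv ℝ η x v) := by
  have ht := IsTestField.gradient hη hc
  rw [pair_apply ht.contDiff.continuous ht.hasCompactSupport, ← integral_const_mul,
    ← integral_neg]
  refine integral_congr_ae ?_
  filter_upwards [ae_measure_iff.1 (memLp_current w ρ q v).coeFn_toLp] with x hx
  rw [current, hx, real_inner_smul_left, inner_gradient_right, conj_trivial]
  simp
  ring

end Charge

/-! ### Conservation of the constraints -/

section Constraints

variable {w : Weight} {N : ℕ} {m : Fin N → ℝ} {e : Fin N → Fin N → ℝ} {ρ : Fin N → ChargeDensity}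
  {φ : ℝ → PhaseSpace w N} {η : E3 → ℝ}

theorem isWeakDiv_iff {f : L2w w} {r : E3 → ℝ} : IsWeakDiv f r ↔
    ∀ η : E3 → ℝ, ContDiff ℝ ∞ η → HasCompactSupport η →
      pair w (gradient η) f + ∫ x, r x * η x = 0 := by
  refine forall₃_congr fun η hη hc => ?_
  have ht := IsTestField.gradient hη hc
  rw [pair_apply ht.contDiff.continuous ht.hasCompactSupport, eq_neg_iff_add_eq_zero]

/-- The weak form of `div curl = 0`: `∇η` is an admissible test field for the curl and is curl-free.
-/
theorem pair_gradient_eq_zero {f g : L2w w} (h : (f, g) ∈ curlGraph w) (hη : ContDiff ℝ ∞ η)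
    (hc : HasCompactSupport η) : pair w (gradient η) g = 0 := by
  rw [← mem_curlGraph.1 h _ (IsTestField.gradient hη hc)]
  have e : curl (gradient η) = 0 := funext (curl_gradient hη)
  rw [e, pair_apply continuous_zero HasCompactSupport.zero]
  simp

theorem IsSolutionOn.pair_E_const (h : IsSolutionOn m e ρ univ φ) (i : Fin N)
    (hη : ContDiff ℝ ∞ η) (hc : HasCompactSupport η) (s t : ℝ) :
    pair w (gradient η) (PhaseSpace.E (φ s) i) +
        ∫ x, 4 * Real.pi * (ρ i) (x - PhaseSpace.q (φ s) i) * η x =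
      pair w (gradient η) (PhaseSpace.E (φ t) i) +
        ∫ x, 4 * Real.pi * (ρ i) (x - PhaseSpace.q (φ t) i) * η x := by
  simp only [mul_assoc (4 * Real.pi), integral_const_mul]
  have hd : ∀ r, HasDerivAt (fun r => pair w (gradient η) (PhaseSpace.E (φ r) i) +
      4 * Real.pi * ∫ x, (ρ i) (x - PhaseSpace.q (φ r) i) * η x) 0 r := by
    intro r
    have h1 := h.hasDerivAt r (mem_univ r)
    have hg := mem_opGraph.1 (opA_mem (h.mem_domA r (mem_univ r))) i
    obtain ⟨D, hD, hDv⟩ := hasFDerivAt_charge (ρ i) hη hc (PhaseSpace.q (φ r) i)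
    have hE := ((pair w (gradient η)).comp (EL w i)).hasFDerivAt.comp_hasDerivAt r h1
    have hq := HasFDerivAt.comp_hasDerivAt (f := fun r => PhaseSpace.q (φ r) i) r hD
      ((qL w i).hasFDerivAt.comp_hasDerivAt r h1)
    -- The curl of `B` pairs to zero with `∇η`, and since `q' = v` the current term cancels the
    -- derivative of the charge term.
    refine (hE.add (hq.const_mul (4 * Real.pi))).congr_deriv ?_
    rw [map_add, map_add, ContinuousLinearMap.comp_apply, ContinuousLinearMap.comp_apply,
      EL_apply, EL_apply, qL_apply, qL_apply, hg.1, zero_add, hDv,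
      pair_gradient_eq_zero hg.2.2.1 hη hc, opJ, E_mk, q_mk, pair_current _ _ _ hη hc]
    ring
  exact is_const_of_deriv_eq_zero (fun r => (hd r).differentiableAt) (fun r => (hd r).deriv) s t

theorem IsSolutionOn.pair_B_const (h : IsSolutionOn m e ρ univ φ) (i : Fin N)
    (hη : ContDiff ℝ ∞ η) (hc : HasCompactSupport η) (s t : ℝ) :
    pair w (gradient η) (PhaseSpace.B (φ s) i) = pair w (gradient η) (PhaseSpace.B (φ t) i) := by
  have hd : ∀ r, HasDerivAt (fun r => pair w (gradient η) (PhaseSpace.B (φ r) i)) 0 r := by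
    intro r
    have h1 := h.hasDerivAt r (mem_univ r)
    have hg := mem_opGraph.1 (opA_mem (h.mem_domA r (mem_univ r))) i
    refine (((pair w (gradient η)).comp (BL w i)).hasFDerivAt.comp_hasDerivAt r h1).congr_deriv ?_
    have h2 := pair_gradient_eq_zero hg.2.2.2 hη hc
    rw [map_neg, neg_eq_zero] at h2
    rw [map_add, ContinuousLinearMap.comp_apply, ContinuousLinearMap.comp_apply,
      BL_apply, BL_apply, h2, opJ, B_mk, Pi.zero_apply, map_zero, add_zero]
  exact is_const_of_deriv_eq_zero (fun r => (hd r).differentiableAt) (fun r => (hd r).deriv) s t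

theorem IsSolutionOn.maxwellConstraints (h : IsSolutionOn m e ρ univ φ) {s : ℝ}
    (hs : MaxwellConstraints ρ (φ s)) (t : ℝ) : MaxwellConstraints ρ (φ t) := by
  refine fun i => ⟨isWeakDiv_iff.2 fun η hη hc => ?_, isWeakDiv_iff.2 fun η hη hc => ?_⟩
  · rw [h.pair_E_const i hη hc t s]
    exact isWeakDiv_iff.1 (hs i).1 η hη hc
  · rw [h.pair_B_const i hη hc t s]
    exact isWeakDiv_iff.1 (hs i).2 η hη hc

end Constraints

end MaxwellLorentz

theorem mainTheorem1 {N : ℕ} (m : Fin N → ℝ) (hm : ∀ i, m i ≠ 0) (e : Fin N → Fin N → ℝ)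
    (w : Weight) (hw : w.MemClass 1) :
    -- global existence, uniqueness and persistence of the constraints
    (∀ (ρ : Fin N → ChargeDensity) (n : ℕ), 1 ≤ n → ∀ φ₀ ∈ domPow w N n,
      ∃ φ : ℝ → PhaseSpace w N,
        ContDiff ℝ n φ ∧ φ 0 = φ₀ ∧ IsSolutionOn m e ρ Set.univ φ ∧
        (∀ t : ℝ, ∀ j ≤ n, iteratedDeriv j φ t ∈ domPow w N (n - j)) ∧
        (∀ (Λ : Set ℝ) (ψ : ℝ → PhaseSpace w N), IsOpen Λ → Λ.OrdConnected →
          IsSolutionOn m e ρ Λ ψ → (∃ t ∈ Λ, ψ t = φ t) → ∀ t ∈ Λ, φ t = ψ t) ∧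
        ((∃ t : ℝ, MaxwellConstraints ρ (φ t)) → ∀ t : ℝ, MaxwellConstraints ρ (φ t))) ∧
    -- Lipschitz bound
    (∀ ρ : Fin N → ChargeDensity, ∃ C : ℝ≥0 × ℝ≥0 × ℝ≥0 → ℝ≥0, IsBound C ∧
      ∀ φ : ℝ → PhaseSpace w N, IsSolutionOn m e ρ Set.univ φ →
      ∀ (Λ : Set ℝ) (ψ : ℝ → PhaseSpace w N), IsOpen Λ → Λ.OrdConnected →
        IsSolutionOn m e ρ Λ ψ →
        ∀ T : ℝ≥0, 0 < T → Set.Ioo (-(T : ℝ)) T ⊆ Λ →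
        ∀ t₀ ∈ Set.Icc (-(T : ℝ)) T ∩ Λ, ∀ t ∈ Set.Icc (-(T : ℝ)) T ∩ Λ,
          ‖φ t - ψ t‖ ≤ C (T, ‖φ t₀‖₊, ‖ψ t₀‖₊) * ‖φ t₀ - ψ t₀‖) ∧
    -- growth bound
    (∃ C : ℝ≥0 × ℝ≥0 × (Fin N → ℝ≥0) × (Fin N → ℝ≥0) → ℝ≥0, IsBound C ∧
      ∀ (ρ : Fin N → ChargeDensity) (φ : ℝ → PhaseSpace w N),
        IsSolutionOn m e ρ Set.univ φ →
        ∀ T : ℝ≥0, 0 < T → ∀ t ∈ Set.Icc (-(T : ℝ)) T,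
          ‖φ t‖ ≤ C (T, ‖φ 0‖₊, (fun i => normInvSqrt w (ρ i)), (fun i => normL2w w (ρ i))) *
            ‖φ 0‖) := by
  refine ⟨fun ρ n hn φ₀ h0 => ?_, fun ρ => ?_, exists_growth_bound hm e hw⟩
  · obtain ⟨φ, hc, hφ0, hφ, hdom⟩ := exists_isSolutionOn hm hw e ρ hn h0
    exact ⟨φ, hc, hφ0, hφ, hdom,
      fun Λ ψ _ hΛ hψ ⟨s, hs, h⟩ t ht => hφ.eq_of_eq hm hw hΛ hψ hs ht h,
      fun ⟨s, hs⟩ t => hφ.maxwellConstraints hs t⟩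
  · obtain ⟨C, hC, h⟩ := exists_lipschitz_bound hm e hw ρ
    exact ⟨C, hC, fun φ hφ Λ ψ _ hΛ hψ T _ _ => h φ hφ Λ ψ hΛ hψ T⟩
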